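/- **Setting.** Functions are complex-valued. $\widetilde L_2(-1,1)$ is the space of measurable $u$ on $(-1,1)$ with $\int_{-1}^1\frac{|u(x)|^2}{1-x^2}\,dx<\infty$, and $$U(\xi)=\mathcal P[u](\xi)=\int_{-1}^1u(y)\Bigl(\frac{1-y}{1+y}\Bigr)^{i\xi}\frac{dy}{1-y^2},\qquad \xi\in\mathbb R,$$ extended by continuity to all $u\in\widetilde L_2(-1,1)$, with values in $L_2(\mathbb R)$. For $s\ge 0$, $\widetilde H^s=\widetilde H^s(-1,1)$ is the space of $u\in\widetilde L_2(-1,1)$ with $$\|u\|_{\widetilde H^s}^2=\frac1\pi\int_{-\infty}^{\infty}(1+4\xi^2)^s|U(\xi)|^2\,d\xi<\infty .$$ $(\widetilde H^s)^*$ is the dual of $\widetilde H^s$ with respect to the pairing of $L_2(-1,1)$, that is, the space of continuous anti-linear functionals $g\mapsto(f,g)$ on $\widetilde H^s$, where $(f,g)=\int_{-1}^1f\bar g\,dx$ when $f$ is a function, with the norm $\sup_{g\ne0}|(f,g)|/\|g\|_{\widetilde H^s}$. By restriction of functionals, $(\widetilde H^s)^*\subset(\widetilde H^t)^*$ for $s\le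 t$; and $(\widetilde H^0)^*$ consists of the functions $f$ with $\int_{-1}^1(1-x^2)|f|^2dx<\infty$. Let $V$ be a real measurable function on $(-1,1)$ with $V(x)\ge0$ and $(1-x^2)V(x)\le M<\infty$ for almost every $x\in(-1,1)$. Consider the Dirichlet problem for the Prandtl equation $$V(x)u(x)-\frac1{2\pi}\int_{-1}^1\frac{u'(t)}{t-x}\,dt=f(x),\quad x\in(-1,1),\qquad u(-1)=u(1)=0, \tag{1}$$ and put, with $G=\mathcal P[g]$, $$[u,g]=\int_{-1}^1V(x)u(x)\overline{g(x)}\,dx+\frac1\pi\int_{-\infty}^\infty\xi\coth(\pi\xi)\,U(\xi)\overline{G(\xi)}\,d\xi .$$ * A *very weak solution* of (1), for $f\in(\widetilde H^1)^*$, is a $u\in\widetilde L_2(-1,1)$ with $[u,g]=(f,g)$ for all $g\in\widetilde H^1$. * A *weak solution* of (1), for $f\in(\widetilde H^{1/2})^*$, is a $u\in\widetilde H^{1/2}$ with $[u,g]=(f,g)$ for all $g\in\widetilde H^{1/2}$. * A *strong solution* of (1), for $f\in(\widetilde H^0)^*$, is a $u\in\widetilde H^1$ that is continuous on $[-1,1]$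 (after a change on a null set) with $u(-1)=u(1)=0$ and satisfies the equation in (1) for almost every $x\in(-1,1)$. Here $u'$ is the generalized derivative, and the integral is a principal value at $t=x$ and an improper integral at $t=\pm1$. **Theorem.** Let $0\le s\le1$ and $f\in(\widetilde H^{1-s})^*$. Then problem (1) has a unique solution, where "solution" means very weak solution if $0\le s<1/2$, weak solution if $1/2\le s<1$, and strong solution if $s=1$. This solution belongs to $\widetilde H^s(-1,1)$ and satisfies $$\|u\|_{\widetilde H^s}\le\sqrt{C_2}\,\|f\|_{(\widetilde H^{1-s})^*},\qquad C_2=\pi^2\Bigl(2+\frac{\pi}{2}M\Bigr).$$ -/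

import Mathlib

open MeasureTheory Set Filter Topology
open scoped ENNReal ContDiff FourierTransform ComplexConjugate

noncomputable section

namespace Prandtl

/-! ### The space `L̃₂(-1,1)` -/

/-- The measure `dx / (1 - x²)` on the interval `(-1,1)`. -/
def tildeMeasure : Measure ℝ :=
  (volume.restrict (Ioo (-1) 1)).withDensity fun x => ENNReal.ofReal (1 / (1 - x ^ 2))

/-- The space `L̃₂(-1,1)` of (classes of) measurable functions `u : (-1,1) → ℂ` with
`∫ |u(x)|² / (1 - x²) dx < ∞`. -/
abbrev LTilde2 : Type := Lp ℂ 2 tildeMeasure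

theorem hasDerivAt_tanh (w : ℝ) : HasDerivAt Real.tanh (1 - Real.tanh w ^ 2) w := by
  have h := (Real.hasDerivAt_sinh w).div (Real.hasDerivAt_cosh w) (Real.cosh_pos w).ne'
  have e : Real.tanh = Real.sinh / Real.cosh := by
    ext x; simp [Real.tanh_eq_sinh_div_cosh]
  rw [← e] at h
  refine h.congr_deriv ?_
  have := (Real.cosh_pos w).ne'
  rw [Real.tanh_eq_sinh_div_cosh]
  field_simp

theorem measurable_tanh : Measurable Real.tanh :=
  (continuous_iff_continuousAt.2 fun w => (hasDerivAt_tanh w).continuousAt).measurable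

/-- The substitution `x = tanh ω` maps `dω` on the line to `dx / (1 - x²)` on `(-1,1)`. -/
theorem measurePreserving_tanh : MeasurePreserving Real.tanh volume tildeMeasure := by
  refine ⟨measurable_tanh, ?_⟩
  ext E hE
  rw [Measure.map_apply measurable_tanh hE, tildeMeasure, withDensity_apply _ hE,
    Measure.restrict_restrict hE]
  have himg : Real.tanh '' (Real.tanh ⁻¹' E) = E ∩ Ioo (-1) 1 := by
    rw [image_preimage_eq_inter_range]
    congr 1
    ext x
    constructor
    · rintro ⟨w, rfl⟩; exact ⟨Real.neg_one_lt_tanh w, Real.tanh_lt_one w⟩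
    · intro hx; exact ⟨Real.artanh x, Real.tanh_artanh hx⟩
  rw [← himg, lintegral_image_eq_lintegral_abs_deriv_mul (measurable_tanh hE)
    (fun w _ => (hasDerivAt_tanh w).hasDerivWithinAt)
    (fun a _ b _ hab => by rw [← Real.artanh_tanh a, hab, Real.artanh_tanh])]
  rw [← setLIntegral_one]
  refine lintegral_congr fun w => ?_
  have h1 : 0 < 1 - Real.tanh w ^ 2 := by nlinarith [Real.tanh_sq_lt_one w]
  rw [← ENNReal.ofReal_mul (abs_nonneg _), abs_of_pos h1, mul_one_div_cancel h1.ne',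
    ENNReal.ofReal_one]

theorem integral_tildeMeasure (F : ℝ → ℂ) :
    ∫ y, F y ∂tildeMeasure = ∫ y in Ioo (-1 : ℝ) 1, (1 / (1 - y ^ 2)) • F y := by
  rw [tildeMeasure, integral_withDensity_eq_integral_toReal_smul (by fun_prop)
    (ae_of_all _ fun _ => ENNReal.ofReal_lt_top)]
  refine setIntegral_congr_fun measurableSet_Ioo fun y hy => ?_
  have h1 : 0 < 1 - y ^ 2 := by nlinarith [hy.1, hy.2]
  simp only [ENNReal.toReal_ofReal (one_div_pos.2 h1).le]

/-- The isometry `u ↦ u ∘ tanh` from `L̃₂(-1,1)` to `L₂(ℝ)`. -/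
def toLine : LTilde2 →ₗᵢ[ℂ] Lp ℂ 2 (volume : Measure ℝ) :=
  Lp.compMeasurePreservingₗᵢ ℂ Real.tanh measurePreserving_tanh

/-! ### The transform `𝓟` -/

/-- The transform `U(ξ) = ∫_{-1}^{1} u(y) ((1 - y)/(1 + y))^{iξ} dy / (1 - y²)`, extended to
`L̃₂(-1,1)` by the Plancherel theorem.
With `y = tanh ω` we have `((1 - y)/(1 + y))^{iξ} = e^{-2iξω}`, so `U(ξ)` is the `L₂`-Fourier
transform of `u ∘ tanh` at the frequency `ξ / π` in Mathlib's normalization `e^{-2πi·}`;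
`pTransform_ae_eq` below checks this against the integral formula. -/
def pTransform (u : LTilde2) (ξ : ℝ) : ℂ :=
  (𝓕 (toLine u) : Lp ℂ 2 (volume : Measure ℝ)) (ξ / Real.pi)

theorem quasi_div_pi :
    Measure.QuasiMeasurePreserving (fun ξ : ℝ => ξ / Real.pi) volume volume := by
  refine ⟨by fun_prop, ?_⟩
  have : (fun ξ : ℝ => ξ / Real.pi) = fun ξ => Real.pi⁻¹ * ξ := by ext; ring
  rw [this, Real.map_volume_mul_left (by positivity)]
  exact Measure.smul_absolutelyContinuous

/-- The Fourier transform on `L²` is given by the Fourier integral for integrable functions. -/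
theorem fourier_Lp_ae_eq (f : Lp ℂ 2 (volume : Measure ℝ)) (hf : Integrable f) :
    (𝓕 f : Lp ℂ 2 (volume : Measure ℝ)) =ᵐ[volume] 𝓕 (f : ℝ → ℂ) := by
  have hcont : Continuous (𝓕 (f : ℝ → ℂ)) :=
    VectorFourier.fourierIntegral_continuous Real.continuous_fourierChar
      (by exact continuous_inner) hf
  refine ae_eq_of_integral_contDiff_smul_eq
    ((Lp.memLp _).locallyIntegrable (by norm_num)) hcont.locallyIntegrable ?_
  intro g hg hgs
  have hg' : ContDiff ℝ ∞ fun x => (g x : ℂ) := Complex.ofRealCLM.contDiff.comp hg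
  have hgs' : HasCompactSupport fun x => (g x : ℂ) :=
    hgs.comp_left (g := fun r : ℝ => (r : ℂ)) Complex.ofReal_zero
  set φ : SchwartzMap ℝ ℂ := hgs'.toSchwartzMap hg' with hφ
  have hφx : ∀ x, φ x = (g x : ℂ) := fun x => rfl
  have h1 := congrArg (fun T => T φ) (Lp.fourier_toTemperedDistribution_eq f)
  simp only [TemperedDistribution.fourier_apply, Lp.toTemperedDistribution_apply, hφx] at h1
  have h2 := VectorFourier.integral_fourierIntegral_smul_eq_flip (L := innerₗ ℝ)
    (μ := volume) (ν := volume) Real.continuous_fourierChar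
    (by exact continuous_inner) (φ.integrable) hf
  have h3 : (∫ x, (𝓕 φ) x • f x) = ∫ x, φ x • (𝓕 (f : ℝ → ℂ)) x := by
    rw [flip_innerₗ] at h2
    simpa only [SchwartzMap.fourier_coe] using! h2
  have h4 := h1.symm.trans h3
  simp only [hφx] at h4
  simpa [Complex.real_smul] using h4

/-- The defining integral formula of `𝓟` on `L̃₁ ∩ L̃₂`. -/
theorem pTransform_ae_eq (u : LTilde2) (hu : Integrable u tildeMeasure) :
    pTransform u =ᵐ[volume] fun ξ =>
      ∫ y in Ioo (-1 : ℝ) 1,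
        u y * (((1 - y) / (1 + y) : ℝ) : ℂ) ^ (Complex.I * ξ) / ((1 - y ^ 2 : ℝ) : ℂ) := by
  have hco : (toLine u : ℝ → ℂ) =ᵐ[volume] u ∘ Real.tanh :=
    Lp.coeFn_compMeasurePreserving u measurePreserving_tanh
  have hint : Integrable (toLine u : ℝ → ℂ) :=
    (measurePreserving_tanh.integrable_comp_of_integrable hu).congr hco.symm
  have h := quasi_div_pi.ae_eq (fourier_Lp_ae_eq (toLine u) hint)
  refine h.trans (ae_of_all _ fun ξ => ?_)
  have hemb : MeasurableEmbedding Real.tanh :=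
    measurable_tanh.measurableEmbedding
      (fun a b hab => by rw [← Real.artanh_tanh a, hab, Real.artanh_tanh])
  have hker : ∀ w : ℝ, Complex.exp (((-2 * Real.pi * w * (ξ / Real.pi) : ℝ) : ℂ) * Complex.I) =
      (((1 - Real.tanh w) / (1 + Real.tanh w) : ℝ) : ℂ) ^ (Complex.I * ξ) := by
    intro w
    have h1 : 0 < 1 - Real.tanh w := by linarith [Real.tanh_lt_one w]
    have h2 : 0 < 1 + Real.tanh w := by linarith [Real.neg_one_lt_tanh w]
    have h3 : (1 - Real.tanh w) / (1 + Real.tanh w) = Real.exp (-2 * w) := by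
      have hc := (Real.cosh_pos w).ne'
      rw [div_eq_iff h2.ne', Real.tanh_eq]
      have hp := Real.exp_pos w
      have hn := Real.exp_pos (-w)
      have e1 : Real.exp (-2 * w) = Real.exp (-w) * Real.exp (-w) := by
        rw [← Real.exp_add]; ring_nf
      have e2 : Real.exp w * Real.exp (-w) = 1 := by rw [← Real.exp_add]; simp
      have e3 : Real.exp w + Real.exp (-w) ≠ 0 := by positivity
      rw [e1]
      field_simp
      linear_combination (-2 * Real.exp (-w)) * e2
    rw [h3, Complex.cpow_def_of_ne_zero (by exact_mod_cast (Real.exp_pos _).ne'),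
      ← Complex.ofReal_log (Real.exp_pos _).le, Real.log_exp]
    congr 1
    have := Real.pi_pos.ne'
    push_cast
    field_simp
  calc 𝓕 (toLine u : ℝ → ℂ) (ξ / Real.pi)
      = ∫ w : ℝ, u (Real.tanh w) *
          (((1 - Real.tanh w) / (1 + Real.tanh w) : ℝ) : ℂ) ^ (Complex.I * ξ) := by
        rw [Real.fourier_eq' ]
        refine integral_congr_ae ?_
        filter_upwards [hco] with w hw
        rw [hw, ← hker w, smul_eq_mul, mul_comm, Function.comp_apply]
        simp only [RCLike.inner_apply, conj_trivial]
        congr 3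
        push_cast
        ring
    _ = ∫ y, u y * (((1 - y) / (1 + y) : ℝ) : ℂ) ^ (Complex.I * ξ) ∂tildeMeasure :=
        measurePreserving_tanh.integral_comp hemb
          (fun y => u y * (((1 - y) / (1 + y) : ℝ) : ℂ) ^ (Complex.I * ξ))
    _ = _ := by
        rw [integral_tildeMeasure]
        refine setIntegral_congr_fun measurableSet_Ioo fun y hy => ?_
        rw [Complex.real_smul]
        push_cast
        ring

theorem aestronglyMeasurable_pTransform (u : LTilde2) :
    AEStronglyMeasurable (pTransform u) volume :=
  (Lp.aestronglyMeasurable _).comp_quasiMeasurePreserving quasi_div_pi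

theorem pTransform_add (u v : LTilde2) :
    pTransform (u + v) =ᵐ[volume] pTransform u + pTransform v := by
  have h : (𝓕 (toLine (u + v)) : Lp ℂ 2 (volume : Measure ℝ)) =
      𝓕 (toLine u) + 𝓕 (toLine v) := by
    rw [map_add, FourierTransform.fourier_add]
  have := quasi_div_pi.ae_eq
    (Lp.coeFn_add (𝓕 (toLine u) : Lp ℂ 2 (volume : Measure ℝ)) (𝓕 (toLine v)))
  rw [← h] at this
  exact this

theorem pTransform_smul (c : ℂ) (u : LTilde2) :
    pTransform (c • u) =ᵐ[volume] c • pTransform u := by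
  have h : (𝓕 (toLine (c • u)) : Lp ℂ 2 (volume : Measure ℝ)) = c • 𝓕 (toLine u) := by
    rw [map_smul, FourierTransform.fourier_smul]
  have := quasi_div_pi.ae_eq
    (Lp.coeFn_smul c (𝓕 (toLine u) : Lp ℂ 2 (volume : Measure ℝ)))
  rw [← h] at this
  exact this

theorem pTransform_injective (u : LTilde2) (hu : pTransform u =ᵐ[volume] 0) : u = 0 := by
  have hq : Measure.QuasiMeasurePreserving (fun ξ : ℝ => Real.pi * ξ) volume volume := by
    refine ⟨by fun_prop, ?_⟩
    rw [Real.map_volume_mul_left Real.pi_pos.ne']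
    exact Measure.smul_absolutelyContinuous
  have h1 : (𝓕 (toLine u) : Lp ℂ 2 (volume : Measure ℝ)) = 0 := by
    rw [Lp.eq_zero_iff_ae_eq_zero]
    filter_upwards [hq.ae_eq hu] with ξ h
    have e : Real.pi * ξ / Real.pi = ξ := by field_simp
    simpa [pTransform, e] using h
  have h2 : ‖u‖ = 0 := by
    rw [← toLine.norm_map, ← Lp.norm_fourier_eq, h1, norm_zero]
  exact norm_eq_zero.1 h2

/-! ### The scale `H̃ˢ(-1,1)` -/

/-- `u ∈ H̃ˢ(-1,1)`: the integral `∫ (1 + 4ξ²)ˢ |U(ξ)|² dξ` is finite. -/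
def MemHTilde (s : ℝ) (u : LTilde2) : Prop :=
  Integrable fun ξ : ℝ => (1 + 4 * ξ ^ 2) ^ s * ‖pTransform u ξ‖ ^ 2

/-- The function `(1 + 4ξ²)^{s/2} U(ξ)`. -/
def weighted (s : ℝ) (u : LTilde2) (ξ : ℝ) : ℂ :=
  (((1 + 4 * ξ ^ 2) ^ (s / 2) : ℝ) : ℂ) * pTransform u ξ

theorem norm_weighted_sq (s : ℝ) (u : LTilde2) (ξ : ℝ) :
    ‖weighted s u ξ‖ ^ 2 = (1 + 4 * ξ ^ 2) ^ s * ‖pTransform u ξ‖ ^ 2 := by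
  have h : 0 < 1 + 4 * ξ ^ 2 := by positivity
  rw [weighted, norm_mul, mul_pow, Complex.norm_real, Real.norm_of_nonneg (by positivity),
    ← Real.rpow_natCast, ← Real.rpow_mul h.le]
  norm_num

theorem continuous_weight (s : ℝ) : Continuous fun ξ : ℝ => (1 + 4 * ξ ^ 2) ^ s :=
  Continuous.rpow_const (by fun_prop) fun ξ => Or.inl (by positivity)

theorem aestronglyMeasurable_weighted (s : ℝ) (u : LTilde2) :
    AEStronglyMeasurable (weighted s u) volume :=
  (Complex.continuous_ofReal.comp (continuous_weight (s / 2))).aestronglyMeasurable.mul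
    (aestronglyMeasurable_pTransform u)

theorem memHTilde_iff (s : ℝ) (u : LTilde2) :
    MemHTilde s u ↔ MemLp (weighted s u) 2 volume := by
  rw [memLp_two_iff_integrable_sq_norm (aestronglyMeasurable_weighted s u)]
  simp only [norm_weighted_sq]
  rfl

theorem weighted_add (s : ℝ) (u v : LTilde2) :
    weighted s (u + v) =ᵐ[volume] weighted s u + weighted s v := by
  filter_upwards [pTransform_add u v] with ξ h
  simp [weighted, h, mul_add]

theorem weighted_smul (s : ℝ) (c : ℂ) (u : LTilde2) :
    weighted s (c • u) =ᵐ[volume] c • weighted s u := by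
  filter_upwards [pTransform_smul c u] with ξ h
  simp only [weighted, h, Pi.smul_apply, smul_eq_mul]
  ring

/-- `H̃ˢ(-1,1)` as a subspace of `L̃₂(-1,1)`. -/
def hTilde (s : ℝ) : Submodule ℂ LTilde2 where
  carrier := {u | MemHTilde s u}
  add_mem' {u v} hu hv := by
    have hu' := (memHTilde_iff s u).1 hu
    have hv' := (memHTilde_iff s v).1 hv
    exact (memHTilde_iff s _).2 ((memLp_congr_ae (weighted_add s u v)).2 (hu'.add hv'))
  zero_mem' := by
    have h := weighted_smul s 0 0
    rw [zero_smul] at h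
    refine (memHTilde_iff s _).2 ((memLp_congr_ae h).2 ?_)
    simp
  smul_mem' c u hu := by
    have hu' := (memHTilde_iff s u).1 hu
    exact (memHTilde_iff s _).2 ((memLp_congr_ae (weighted_smul s c u)).2 (hu'.const_smul c))

/-- The Hilbert space `H̃ˢ(-1,1)`, with its own norm (and not the norm of `L̃₂`). -/
def HTilde (s : ℝ) : Type := hTilde s

namespace HTilde

variable {s t : ℝ}

instance : AddCommGroup (HTilde s) := inferInstanceAs (AddCommGroup (hTilde s))

instance : Module ℂ (HTilde s) := inferInstanceAs (Module ℂ (hTilde s))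

/-- The embedding of `H̃ˢ` in `L̃₂`. -/
def val : HTilde s →ₗ[ℂ] LTilde2 := (hTilde s).subtype

theorem val_mem (u : HTilde s) : MemHTilde s u.val := Subtype.property (p := (· ∈ hTilde s)) u

/-- `‖u‖² = (1/π) ∫ (1 + 4ξ²)ˢ |U(ξ)|² dξ`. -/
instance : Norm (HTilde s) where
  norm u := √(1 / Real.pi * ∫ ξ : ℝ, (1 + 4 * ξ ^ 2) ^ s * ‖pTransform u.val ξ‖ ^ 2)

theorem norm_def (u : HTilde s) :
    ‖u‖ = √(1 / Real.pi * ∫ ξ : ℝ, (1 + 4 * ξ ^ 2) ^ s * ‖pTransform u.val ξ‖ ^ 2) := rfl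

/-- The weighted transform as a linear map to `L₂(ℝ)`. -/
def toL2 (s : ℝ) : HTilde s →ₗ[ℂ] Lp ℂ 2 (volume : Measure ℝ) where
  toFun u := ((memHTilde_iff s u.val).1 u.val_mem).toLp
  map_add' u v := by
    rw [← MemLp.toLp_add]
    exact (MemLp.toLp_eq_toLp_iff _ _).2 (weighted_add s u.val v.val)
  map_smul' c u := by
    rw [RingHom.id_apply, ← MemLp.toLp_const_smul]
    exact (MemLp.toLp_eq_toLp_iff _ _).2 (weighted_smul s c u.val)

theorem norm_toL2 (u : HTilde s) : ‖u‖ = √(1 / Real.pi) * ‖toL2 s u‖ := by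
  rw [norm_def, Real.sqrt_mul (by positivity)]
  congr 1
  rw [Real.sqrt_eq_iff_eq_sq (integral_nonneg fun ξ => by positivity) (norm_nonneg _)]
  have h := (memHTilde_iff s u.val).1 u.val_mem
  have h2 : ‖toL2 s u‖ ^ 2 = ∫ ξ, ‖toL2 s u ξ‖ ^ 2 := by
    have h3 := congrArg Complex.re (L2.inner_def (𝕜 := ℂ) (toL2 s u) (toL2 s u))
    have h4 := integral_re (L2.integrable_inner (𝕜 := ℂ) (toL2 s u) (toL2 s u))
    have h5 := inner_self_eq_norm_sq (𝕜 := ℂ) (toL2 s u)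
    rw [← h5]
    refine h3.trans (h4.symm.trans ?_)
    exact integral_congr_ae (ae_of_all _ fun ξ => inner_self_eq_norm_sq (𝕜 := ℂ) _)
  rw [h2]
  refine integral_congr_ae ?_
  filter_upwards [h.coeFn_toLp] with ξ hξ
  rw [← norm_weighted_sq]
  exact congrArg (‖·‖ ^ 2) hξ.symm

theorem toL2_eq_zero (u : HTilde s) (h : toL2 s u = 0) : u = 0 := by
  have h1 : weighted s u.val =ᵐ[volume] 0 :=
    (((memHTilde_iff s u.val).1 u.val_mem).coeFn_toLp).symm.trans
      ((Lp.eq_zero_iff_ae_eq_zero (f := toL2 s u)).1 h)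
  have h2 : u.val = 0 := by
    refine pTransform_injective _ ?_
    filter_upwards [h1] with ξ hξ
    have hw : 0 < (1 + 4 * ξ ^ 2 : ℝ) ^ (s / 2) := by positivity
    simp only [weighted, Pi.zero_apply, mul_eq_zero, Complex.ofReal_eq_zero, hw.ne',
      false_or] at hξ
    simpa using hξ
  exact Subtype.ext h2

theorem core (s : ℝ) : NormedSpace.Core ℂ (HTilde s) where
  norm_nonneg u := Real.sqrt_nonneg _
  norm_smul c u := by
    rw [norm_toL2, norm_toL2, map_smul, norm_smul]
    ring
  norm_triangle u v := by
    rw [norm_toL2, norm_toL2, norm_toL2, map_add, ← mul_add]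
    exact mul_le_mul_of_nonneg_left (norm_add_le _ _) (Real.sqrt_nonneg _)
  norm_eq_zero_iff u := by
    have hp : √(1 / Real.pi) ≠ 0 := (Real.sqrt_pos.2 (by positivity)).ne'
    rw [norm_toL2, mul_eq_zero, norm_eq_zero]
    constructor
    · rintro (h | h)
      · exact absurd h hp
      · exact toL2_eq_zero u h
    · rintro rfl
      exact Or.inr (map_zero _)

instance : NormedAddCommGroup (HTilde s) := NormedAddCommGroup.ofCore (core s)

instance : NormedSpace ℂ (HTilde s) := NormedSpace.ofCore (core s)

end HTilde

theorem MemHTilde.mono {s t : ℝ} (hst : s ≤ t) {u : LTilde2} (hu : MemHTilde t u) :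
    MemHTilde s u := by
  refine Integrable.mono' hu ((continuous_weight s).aestronglyMeasurable.mul
    ((aestronglyMeasurable_pTransform u).norm.pow 2)) (ae_of_all _ fun ξ => ?_)
  rw [Real.norm_of_nonneg (by positivity)]
  gcongr
  nlinarith [sq_nonneg ξ]

/-- The embedding `H̃ᵗ ⊂ H̃ˢ` for `s ≤ t`. -/
def HTilde.incl {s t : ℝ} (hst : s ≤ t) : HTilde t →L[ℂ] HTilde s :=
  LinearMap.mkContinuous
    { toFun u := (⟨u.val, MemHTilde.mono hst u.val_mem⟩ : hTilde s)
      map_add' _ _ := rfl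
      map_smul' _ _ := rfl } 1
    fun u => by
      rw [one_mul, HTilde.norm_def, HTilde.norm_def]
      refine Real.sqrt_le_sqrt (mul_le_mul_of_nonneg_left ?_ (by positivity))
      refine integral_mono (MemHTilde.mono hst u.val_mem) u.val_mem fun ξ => ?_
      change (1 + 4 * ξ ^ 2) ^ s * ‖pTransform u.val ξ‖ ^ 2 ≤ _
      gcongr
      nlinarith [sq_nonneg ξ]

theorem HTilde.val_incl {s t : ℝ} (hst : s ≤ t) (u : HTilde t) :
    (HTilde.incl hst u).val = u.val := rfl

/-- The space `(H̃ˢ)*` of continuous anti-linear functionals `g ↦ (f, g)` on `H̃ˢ`, where `(f, g)`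
extends the pairing of `L₂(-1,1)`; its norm is the operator norm `sup |(f, g)| / ‖g‖`. -/
abbrev HTildeDual (s : ℝ) : Type := HTilde s →SL[starRingEnd ℂ] ℂ

/-- The embedding `(H̃ˢ)* ⊂ (H̃ᵗ)*` for `s ≤ t`: restriction of functionals to `H̃ᵗ`. -/
def HTildeDual.restrict {s t : ℝ} (f : HTildeDual s) (hst : s ≤ t) : HTildeDual t :=
  f.comp (HTilde.incl hst)

/-! ### Solutions of the Dirichlet problem -/

/-- The sesquilinear form
`[u, g] = ∫_{-1}^{1} V u ḡ dx + (1/π) ∫ ξ coth(πξ) U(ξ) conj(G(ξ)) dξ`. -/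
def form (V : ℝ → ℝ) (u g : LTilde2) : ℂ :=
  (∫ x in Ioo (-1 : ℝ) 1, (V x : ℂ) * u x * conj (g x)) +
    1 / (Real.pi : ℂ) *
      ∫ ξ : ℝ, ((ξ * (Real.cosh (Real.pi * ξ) / Real.sinh (Real.pi * ξ)) : ℝ) : ℂ) *
        pTransform u ξ * conj (pTransform g ξ)

/-- Very weak solutions: `u ∈ L̃₂` with `[u, g] = (f, g)` for all `g ∈ H̃¹`. -/
def IsVeryWeakSolution (V : ℝ → ℝ) (f : HTildeDual 1) (u : LTilde2) : Prop :=
  ∀ g : HTilde 1, form V u g.val = f g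

/-- Weak solutions: `u ∈ H̃^{1/2}` with `[u, g] = (f, g)` for all `g ∈ H̃^{1/2}`. -/
def IsWeakSolution (V : ℝ → ℝ) (f : HTildeDual (1 / 2)) (u : LTilde2) : Prop :=
  MemHTilde (1 / 2) u ∧ ∀ g : HTilde (1 / 2), form V u g.val = f g

/-- `w` is the generalized derivative of `u` on `(-1,1)`. -/
def IsWeakDeriv (u w : ℝ → ℂ) : Prop :=
  LocallyIntegrableOn u (Ioo (-1) 1) ∧ LocallyIntegrableOn w (Ioo (-1) 1) ∧
    ∀ φ : ℝ → ℝ, ContDiff ℝ ∞ φ → HasCompactSupport φ → tsupport φ ⊆ Ioo (-1) 1 →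
      ∫ x in Ioo (-1 : ℝ) 1, deriv φ x • u x = -∫ x in Ioo (-1 : ℝ) 1, φ x • w x

/-- `I` is the value of `∫_{-1}^{1} w(t) / (t - x) dt`, where the integral is understood in the
principal value sense at `t = x` and as an improper integral at the ends of the interval: a
function `w = u'` with `∫ (1 - t²) |w(t)|² dt < ∞` need not be integrable near `±1`. -/
def IsSingularIntegral (w : ℝ → ℂ) (x : ℝ) (I : ℂ) : Prop :=
  Tendsto
    (fun p : ℝ × ℝ × ℝ =>
      ∫ t in {t | t ∈ Ioo (-1 + p.2.1) (1 - p.2.2) ∧ p.1 < |t - x|}, w t / ((t - x : ℝ) : ℂ))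
    (𝓝[>] 0 ×ˢ 𝓝[>] 0 ×ˢ 𝓝[>] 0) (𝓝 I)

/-- `f ∈ (H̃⁰)*` is the functional `g ↦ ∫_{-1}^{1} f₀ ḡ dx` of the function `f₀` with
`∫_{-1}^{1} (1 - x²) |f₀(x)|² dx < ∞`. -/
def IsRepresentedBy (f : HTildeDual 0) (f₀ : ℝ → ℂ) : Prop :=
  AEStronglyMeasurable f₀ (volume.restrict (Ioo (-1) 1)) ∧
    IntegrableOn (fun x => (1 - x ^ 2) * ‖f₀ x‖ ^ 2) (Ioo (-1) 1) ∧
    ∀ g : HTilde 0, f g = ∫ x in Ioo (-1 : ℝ) 1, f₀ x * conj (g.val x)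

/-- Strong solutions: `u ∈ H̃¹` is continuous on `[-1,1]`, vanishes at `±1`, and satisfies
`V(x) u(x) - (1/2π) ∫_{-1}^{1} u'(t) / (t - x) dt = f(x)` for almost all `x ∈ (-1,1)`. -/
def IsStrongSolution (V : ℝ → ℝ) (f : HTildeDual 0) (u : LTilde2) : Prop :=
  MemHTilde 1 u ∧
    ∃ u₀ w f₀ : ℝ → ℂ,
      u₀ =ᵐ[volume.restrict (Ioo (-1) 1)] u ∧
      ContinuousOn u₀ (Icc (-1) 1) ∧ u₀ (-1) = 0 ∧ u₀ 1 = 0 ∧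
      IsWeakDeriv u₀ w ∧ IsRepresentedBy f f₀ ∧
      ∀ᵐ x ∂volume.restrict (Ioo (-1) 1), ∃ I : ℂ, IsSingularIntegral w x I ∧
        (V x : ℂ) * u₀ x - 1 / (2 * (Real.pi : ℂ)) * I = f₀ x

/-- Solutions `u` of the Dirichlet problem with the right-hand side `f ∈ (H̃^{1-s})*`, `0 ≤ s ≤ 1`:
very weak for `s < 1/2`, weak for `1/2 ≤ s < 1`, strong for `s = 1`. -/
def IsSolution (V : ℝ → ℝ) {s : ℝ} (hs : 0 ≤ s) (f : HTildeDual (1 - s)) (u : LTilde2) : Prop :=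
  if h : s < 1 / 2 then IsVeryWeakSolution V (f.restrict (t := 1) (by linarith)) u
  else if h' : s < 1 then IsWeakSolution V (f.restrict (t := 1 / 2) (by linarith)) u
  else IsStrongSolution V (f.restrict (t := 0) (by linarith)) u

end Prandtl

end

/-! The substitution `x = tanh w` turns the Prandtl equation into an equation on the real line. There
`H̃ˢ` is the space of functions whose Fourier transform is in `L₂` with the weight `dˢ`,
`d = (1 + 4ξ²)^{1/2}`; the potential becomes multiplication by `(1 - x²) V`, which is a bounded
self-adjoint operator `W` with `0 ≤ W ≤ M` on the Fourier side; and `[u, g]` is the form of `a + W`,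
where the symbol `a = ξ coth(πξ)` satisfies `a ≤ d ≤ π a` (`IsPotential.form_eq`,
`isEllipticSymbol_symb`).

*Existence and the bound* (`IsEllipticSymbol.exists_solution`). Let `R = (a + W)⁻¹` in `L₂`. The
energy identity together with `‖W y‖² ≤ M (W y, y)` gives `‖a R x‖² ≤ (2 + πM/2) ‖x‖²`, hence
`‖d R‖ ≤ √C₂`. As `R` is self-adjoint, `‖R d‖ ≤ √C₂`, and Hadamard's three lines theorem for
`z ↦ d^z R d^{1-z}` gives `‖d^s R d^{1-s}‖ ≤ √C₂` for `0 ≤ s ≤ 1`. A functional in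
`(H̃^{1-s})*` is `d^{1-s} φ` with `‖φ‖` its norm, so this is the estimate for the solution.
Unbounded weights are avoided by working with `min d n` and letting `n → ∞`.

*Uniqueness* (`IsPotential.eq_of_form_eq`). If `[u, g] = [v, g]` for all `g ∈ H̃¹`, the choice
`ĝ = ψ / a` with arbitrary `ψ ∈ L₂` shows that `û - v̂` is in the kernel of `a + W`, which is
positive definite. All the notions of solution satisfy the identity `[u, g] = (f, g)` at least for
`g ∈ H̃¹`.

*Strong solutions.* What remains is to show that for `u ∈ H̃¹` the singular integral of `u'` exists
almost everywhere and is given by the multiplier `a` (`exists_singularIntegral`). Put `U = u ∘ tanh`.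
Up to a constant factor, `1 / (t - x)` is a primitive of `-1 / sinh²(y - w)` in the variables
`t = tanh y`, `x = tanh w`, so that an integration by parts turns
the truncated integral of `u'` into the truncated hypersingular integral
`∫ (U(w + s) - U(w)) / sinh² s ds` plus boundary terms (`isSingularIntegral_pullDeriv`). By the
partial fractions of the cotangent, `a` is the Lévy–Khintchine symbol of that integral
(`symb_eq_integral`). The hypersingular integral cut off at `2⁻ᵏ` differs from the average
over `[w - 2⁻ᵏ, w + 2⁻ᵏ]` of the function with the transform `a û` by a function whose symbol is
`O(d min(t, 1/t))` with `t = 2⁻ᵏ |η|`. These symbols are square summable over `k`, so the difference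
tends to zero almost everywhere, while the averages converge by Lebesgue's theorem
(`ae_tendsto_truncOp`). At a point where `U` is differentiable, general cut-offs reduce
to dyadic ones, and unequal cut-offs on the two sides to equal ones (`tendsto_tail_of_dyadic`,
`tendsto_tail_sub`); this is needed because the cut-off `|t - x| > ε` is not symmetric in `w`.
Consequently a function in `H̃¹` is a strong solution if and only if it satisfies the identity
`[u, g] = (f, g)` (`IsPotential.form_eq_of_isStrongSolution`,
`IsPotential.isStrongSolution_of_form_eq`). -/

noncomputable section

namespace Prandtl

/-! ### Interpolation of a two-sided bound -/

open NormedSpace Complex in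
/-- Two bounds `‖R e^L‖ ≤ K` and `‖e^L R‖ ≤ K` interpolate to `‖e^{sL} R e^{(1-s)L}‖ ≤ K`: on vertical
lines `e^{zL} R e^{(1-z)L}` changes only by unitary factors, so Hadamard's three lines theorem
applies. -/
theorem norm_exp_mul_mul_exp_le {A : Type*} [CStarAlgebra A] {L R : A} (hL : IsSelfAdjoint L)
    {K : ℝ} (h0 : ‖R * exp L‖ ≤ K) (h1 : ‖exp L * R‖ ≤ K) {s : ℝ} (hs0 : 0 ≤ s) (hs1 : s ≤ 1) :
    ‖exp ((s : ℂ) • L) * R * exp (((1 - s : ℝ) : ℂ) • L)‖ ≤ K := by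
  let +nondep : NormedAlgebra ℚ A := .restrictScalars ℚ ℂ A
  set F : ℂ → A := fun z => exp (z • L) * R * exp ((1 - z) • L) with hF
  have hadd : ∀ z w : ℂ, exp ((z + w) • L) = exp (z • L) * exp (w • L) := fun z w => by
    rw [add_smul, exp_add_of_commute (((Commute.refl L).smul_left z).smul_right w)]
  have hun : ∀ y : ℝ, exp ((y * I) • L) ∈ unitary A := fun y => by
    have h := (selfAdjoint.expUnitary ⟨(y : ℂ) • L, by
      rw [selfAdjoint.mem_iff, star_smul, hL.star_eq]; simp⟩).2
    rw [mul_comm, mul_smul]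
    exact h
  have hd : Differentiable ℂ F := fun z => by
    have h1 : DifferentiableAt ℂ (fun z : ℂ => exp (z • L)) z :=
      (hasDerivAt_exp_smul_const L z).differentiableAt
    have h2 : DifferentiableAt ℂ (fun z : ℂ => exp ((1 - z) • L)) z :=
      (hasDerivAt_exp_smul_const L (1 - z)).differentiableAt.comp z (by fun_prop)
    exact (h1.mul_const R).mul h2
  have hnorm : ∀ z : ℂ, ‖F z‖ = ‖exp ((z.re : ℂ) • L) * R * exp (((1 - z.re : ℝ) : ℂ) • L)‖ := by
    intro z
    have e1 : exp (z • L) = exp ((z.im * I) • L) * exp ((z.re : ℂ) • L) := by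
      rw [← hadd, add_comm, Complex.re_add_im]
    have e2 : exp ((1 - z) • L) =
        exp (((1 - z.re : ℝ) : ℂ) • L) * exp ((((-z.im : ℝ) : ℂ) * I) • L) := by
      rw [← hadd]; congr 2
      apply Complex.ext <;> simp
    have e3 : F z = exp ((z.im * I) • L) *
        ((exp ((z.re : ℂ) • L) * R * exp (((1 - z.re : ℝ) : ℂ) • L)) *
          exp ((((-z.im : ℝ) : ℂ) * I) • L)) := by
      rw [hF]; simp only [e1, e2, mul_assoc]
    rw [e3, CStarRing.norm_mem_unitary_mul _ (hun _), CStarRing.norm_mul_mem_unitary _ (hun _)]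
  have key := Complex.HadamardThreeLines.norm_le_interp_of_mem_verticalClosedStrip₀₁' F
    (z := (s : ℂ)) (a := K) (b := K)
    (by simp [Complex.HadamardThreeLines.verticalClosedStrip, hs0, hs1])
    hd.diffContOnCl ?_ ?_ ?_
  · have hK : 0 ≤ K := (norm_nonneg _).trans h0
    rw [Complex.ofReal_re, ← Real.rpow_add' hK (by norm_num)] at key
    simpa [hF] using key
  · obtain ⟨C, hC⟩ := (isCompact_Icc (a := (0 : ℝ)) (b := 1)).exists_bound_of_continuousOn
      (hd.continuous.comp Complex.continuous_ofReal).continuousOn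
    refine ⟨C, ?_⟩
    rintro _ ⟨z, hz, rfl⟩
    have h := hC z.re hz
    rw [Function.comp_apply, hnorm] at h
    rw [Function.comp_apply, hnorm]
    simpa using h
  · intro z hz
    have hz' : z.re = 0 := hz
    rw [hnorm, hz']
    simpa using h0
  · intro z hz
    have hz' : z.re = 1 := hz
    rw [hnorm, hz']
    simpa using h1

/-! ### Multiplication operators -/

/-- The Hilbert space `L₂(ℝ)`. -/
abbrev L2R : Type := Lp ℂ 2 (volume : Measure ℝ)

/-- Multiplication by a bounded function, as an operator in `L₂(ℝ)`. -/
def mulOp (m : ℝ → ℂ) (hm : MemLp m ∞ volume) : L2R →L[ℂ] L2R :=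
  (ContinuousLinearMap.mul ℂ ℂ).holderL volume ∞ 2 2 hm.toLp

theorem coeFn_mulOp {m : ℝ → ℂ} (hm : MemLp m ∞ volume) (f : L2R) :
    mulOp m hm f =ᵐ[volume] fun x => m x * f x := by
  have h := (ContinuousLinearMap.mul ℂ ℂ).coeFn_holder (r := 2) (hm.toLp m) f
  filter_upwards [h, hm.coeFn_toLp] with x hx hx'
  rw [mulOp, ContinuousLinearMap.holderL_apply_apply, hx, hx']
  rfl

theorem mulOp_mulOp {m n k : ℝ → ℂ} (hm : MemLp m ∞ volume) (hn : MemLp n ∞ volume)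
    (hk : MemLp k ∞ volume) (h : ∀ᵐ x, m x * n x = k x) (f : L2R) :
    mulOp m hm (mulOp n hn f) = mulOp k hk f := by
  refine Lp.ext ?_
  filter_upwards [coeFn_mulOp hm (mulOp n hn f), coeFn_mulOp hn f, coeFn_mulOp hk f, h]
    with x h1 h2 h3 h4
  rw [h1, h2, h3, ← h4, mul_assoc]

theorem inner_L2R (f g : L2R) : inner ℂ f g = ∫ x, g x * conj (f x) := by
  rw [L2.inner_def]
  simp [RCLike.inner_apply]

theorem inner_mulOp_left {m : ℝ → ℂ} (hm : MemLp m ∞ volume) (h : ∀ᵐ x, conj (m x) = m x)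
    (f g : L2R) : inner ℂ (mulOp m hm f) g = inner ℂ f (mulOp m hm g) := by
  rw [inner_L2R, inner_L2R]
  refine integral_congr_ae ?_
  filter_upwards [coeFn_mulOp hm f, coeFn_mulOp hm g, h] with x h1 h2 h3
  rw [h1, h2, map_mul, h3]
  ring

theorem isSelfAdjoint_mulOp {m : ℝ → ℂ} (hm : MemLp m ∞ volume) (h : ∀ᵐ x, conj (m x) = m x) :
    IsSelfAdjoint (mulOp m hm) :=
  ContinuousLinearMap.isSelfAdjoint_iff_isSymmetric.2 (inner_mulOp_left hm h)

theorem norm_sq_L2R (f : L2R) : ‖f‖ ^ 2 = ∫ x, ‖f x‖ ^ 2 := by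
  have h3 := congrArg Complex.re (L2.inner_def (𝕜 := ℂ) f f)
  have h4 := integral_re (L2.integrable_inner (𝕜 := ℂ) f f)
  rw [← inner_self_eq_norm_sq (𝕜 := ℂ) f]
  refine h3.trans (h4.symm.trans ?_)
  exact integral_congr_ae (ae_of_all _ fun ξ => inner_self_eq_norm_sq (𝕜 := ℂ) _)

theorem integrable_norm_sq_L2R (f : L2R) : Integrable fun x => ‖f x‖ ^ 2 :=
  (memLp_two_iff_integrable_sq_norm (Lp.aestronglyMeasurable f)).1 (Lp.memLp f)

theorem norm_le_of_ae_norm_le {f g : L2R} {c : ℝ} (h : ∀ᵐ x, ‖f x‖ ≤ c * ‖g x‖) :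
    ‖f‖ ≤ c * ‖g‖ :=
  Lp.norm_le_mul_norm_of_ae_le_mul h

/-- Multiplication by bounded continuous functions, as a homomorphism of algebras. -/
def mulBCF : BoundedContinuousFunction ℝ ℂ →ₐ[ℂ] (L2R →L[ℂ] L2R) where
  toFun m := mulOp m (memLp_top_of_bound m.continuous.aestronglyMeasurable ‖m‖
    (ae_of_all _ m.norm_coe_le_norm))
  map_one' := by
    ext1 f
    refine Lp.ext ?_
    filter_upwards [coeFn_mulOp (memLp_top_of_bound
      (1 : BoundedContinuousFunction ℝ ℂ).continuous.aestronglyMeasurable _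
      (ae_of_all _ (1 : BoundedContinuousFunction ℝ ℂ).norm_coe_le_norm)) f] with x hx
    exact hx.trans (by simp)
  map_zero' := by
    ext1 f
    refine Lp.ext ?_
    filter_upwards [coeFn_mulOp (memLp_top_of_bound
      (0 : BoundedContinuousFunction ℝ ℂ).continuous.aestronglyMeasurable _
      (ae_of_all _ (0 : BoundedContinuousFunction ℝ ℂ).norm_coe_le_norm)) f] with x hx
    exact hx.trans (by simp)
  map_mul' m n := by
    ext1 f
    exact (mulOp_mulOp _ _ _ (ae_of_all _ fun _ => rfl) f).symm
  map_add' m n := by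
    ext1 f
    rw [_root_.add_apply]
    refine Lp.ext ?_
    filter_upwards [coeFn_mulOp (memLp_top_of_bound m.continuous.aestronglyMeasurable ‖m‖
      (ae_of_all _ m.norm_coe_le_norm)) f, coeFn_mulOp (memLp_top_of_bound
      n.continuous.aestronglyMeasurable ‖n‖ (ae_of_all _ n.norm_coe_le_norm)) f,
      coeFn_mulOp (memLp_top_of_bound (m + n).continuous.aestronglyMeasurable ‖m + n‖
      (ae_of_all _ (m + n).norm_coe_le_norm)) f, Lp.coeFn_add (mulOp m (memLp_top_of_bound
        m.continuous.aestronglyMeasurable ‖m‖ (ae_of_all _ m.norm_coe_le_norm)) f)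
        (mulOp n (memLp_top_of_bound
      n.continuous.aestronglyMeasurable ‖n‖ (ae_of_all _ n.norm_coe_le_norm)) f)] with x h1 h2 h3 h4
    rw [h3, h4, Pi.add_apply, h1, h2, BoundedContinuousFunction.coe_add, Pi.add_apply, add_mul]
  commutes' c := by
    ext1 f
    refine Lp.ext ?_
    filter_upwards [coeFn_mulOp (memLp_top_of_bound
      (algebraMap ℂ (BoundedContinuousFunction ℝ ℂ) c).continuous.aestronglyMeasurable _
      (ae_of_all _ (algebraMap ℂ (BoundedContinuousFunction ℝ ℂ) c).norm_coe_le_norm)) f,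
      Lp.coeFn_smul c f] with x hx h2
    refine hx.trans ?_
    rw [show (algebraMap ℂ (BoundedContinuousFunction ℝ ℂ) c) x = c from rfl,
      Algebra.algebraMap_eq_smul_one, _root_.smul_apply, one_apply_eq_self, h2]
    simp

theorem coeFn_mulBCF (m : BoundedContinuousFunction ℝ ℂ) (f : L2R) :
    mulBCF m f =ᵐ[volume] fun x => m x * f x :=
  coeFn_mulOp _ f

theorem continuous_mulBCF : Continuous mulBCF := by
  refine AddMonoidHomClass.continuous_of_bound mulBCF 1 fun m => ?_
  rw [one_mul]
  refine ContinuousLinearMap.opNorm_le_bound _ (norm_nonneg _) fun f => ?_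
  refine norm_le_of_ae_norm_le ?_
  filter_upwards [coeFn_mulBCF m f] with x hx
  rw [hx, norm_mul]
  gcongr
  exact m.norm_coe_le_norm x

open NormedSpace in
theorem exp_mulBCF_ae (m : BoundedContinuousFunction ℝ ℂ) (f : L2R) :
    exp (mulBCF m) f =ᵐ[volume] fun x => Complex.exp (m x) * f x := by
  let +nondep : NormedAlgebra ℚ (BoundedContinuousFunction ℝ ℂ) := .restrictScalars ℚ ℂ _
  let +nondep : NormedAlgebra ℚ (L2R →L[ℂ] L2R) := .restrictScalars ℚ ℂ _
  let +nondep : NormedAlgebra ℚ ℂ := .restrictScalars ℚ ℂ _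
  rw [← map_exp mulBCF continuous_mulBCF m]
  filter_upwards [coeFn_mulBCF (exp m) f] with x hx
  rw [hx]
  congr 1
  let ev : BoundedContinuousFunction ℝ ℂ →+* ℂ :=
    { toFun := fun g => g x
      map_one' := rfl
      map_zero' := rfl
      map_mul' := fun _ _ => rfl
      map_add' := fun _ _ => rfl }
  have := map_exp ev ((BoundedContinuousFunction.lipschitz_eval_const x).continuous) m
  rw [Complex.exp_eq_exp_ℂ]
  exact this

/-! ### The equation `a u + W u = f` on the frequency side -/

theorem le_re_inner_of_ae_eq_mul {a : ℝ → ℝ} {c : ℝ} (ha : ∀ᵐ x, c ≤ a x) {y z : L2R}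
    (h : ∀ᵐ x, z x = a x * y x) : c * ‖y‖ ^ 2 ≤ (inner ℂ y z).re := by
  have h1 : (inner ℂ y z).re = ∫ x, (z x * conj (y x)).re := by
    rw [inner_L2R]
    have hi : Integrable fun x => z x * conj (y x) := by
      simpa [RCLike.inner_apply] using L2.integrable_inner (𝕜 := ℂ) y z
    exact (integral_re hi).symm
  rw [h1, norm_sq_L2R, ← integral_const_mul]
  refine integral_mono_ae ((integrable_norm_sq_L2R y).const_mul c) ?_ ?_
  · have hi : Integrable fun x => z x * conj (y x) := by
      simpa [RCLike.inner_apply] using L2.integrable_inner (𝕜 := ℂ) y z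
    exact hi.re
  · filter_upwards [ha, h] with x h2 h3
    have h4 : (z x * conj (y x)).re = a x * ‖y x‖ ^ 2 := by
      rw [h3, mul_assoc, Complex.mul_conj, Complex.normSq_eq_norm_sq, ← Complex.ofReal_mul,
        Complex.ofReal_re]
    simp only [h4]
    gcongr

/-- A bounded operator that is self-adjoint and satisfies `0 ≤ W ≤ M`, in the form
`‖W x‖² ≤ M (W x, x)`. -/
structure IsBoundedPotential (W : L2R →L[ℂ] L2R) (M : ℝ) : Prop where
  isSelfAdjoint : IsSelfAdjoint W
  re_inner_nonneg : ∀ x, 0 ≤ (inner ℂ x (W x)).re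
  norm_sq_le : ∀ x, ‖W x‖ ^ 2 ≤ M * (inner ℂ x (W x)).re
  nonneg : 0 ≤ M

/-- A measurable symbol `a` bounded from below by the weight `d / π`, where `d ≥ 1`. -/
structure IsEllipticSymbol (a d : ℝ → ℝ) : Prop where
  measurable : Measurable a
  continuous_weight : Continuous d
  one_le : ∀ x, 1 ≤ d x
  le_mul : ∀ᵐ x, d x ≤ Real.pi * a x

namespace IsEllipticSymbol

variable {a d : ℝ → ℝ} {W : L2R →L[ℂ] L2R} {M : ℝ}

theorem pos (h : IsEllipticSymbol a d) : ∀ᵐ x, 0 < a x := by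
  filter_upwards [h.le_mul] with x hx
  have := h.one_le x
  have : 0 < Real.pi * a x := by linarith
  exact pos_of_mul_pos_right this Real.pi_pos.le

theorem inv_pi_le (h : IsEllipticSymbol a d) : ∀ᵐ x, Real.pi⁻¹ ≤ a x := by
  filter_upwards [h.le_mul] with x hx
  rw [inv_le_iff_one_le_mul₀' Real.pi_pos]
  exact (h.one_le x).trans hx

theorem eq_zero (h : IsEllipticSymbol a d) (hW : IsBoundedPotential W M) {u : L2R}
    (hu : ∀ᵐ x, a x * u x = -(W u) x) : u = 0 := by
  have h1 := le_re_inner_of_ae_eq_mul (y := u) (z := -(W u)) h.inv_pi_le (by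
    filter_upwards [hu, Lp.coeFn_neg (W u)] with x h1 h2
    rw [h2, h1, Pi.neg_apply])
  have h2 := hW.re_inner_nonneg u
  rw [inner_neg_right, Complex.neg_re] at h1
  have h3 : ‖u‖ ^ 2 ≤ 0 := by
    have : 0 < Real.pi⁻¹ := by positivity
    by_contra h4
    nlinarith
  exact norm_eq_zero.1 (by nlinarith [norm_nonneg u])

/-- The square root in the potential bound `M` comes from the energy identity: testing the
equation with `y` itself bounds `(W y, y)`, hence `‖W y‖² ≤ M (W y, y)`. -/
theorem norm_sub_sq_le (h : IsEllipticSymbol a d) (hW : IsBoundedPotential W M) {x y : L2R}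
    (hy : ∀ᵐ ξ, a ξ * y ξ = (x - W y) ξ) :
    ‖x - W y‖ ^ 2 ≤ (2 + Real.pi / 2 * M) * ‖x‖ ^ 2 := by
  have h1 := le_re_inner_of_ae_eq_mul (y := y) (z := x - W y) h.inv_pi_le (by
    filter_upwards [hy] with ξ h1 using h1.symm)
  rw [inner_sub_right, Complex.sub_re] at h1
  have h2 : (inner ℂ y x).re ≤ ‖y‖ * ‖x‖ :=
    (Complex.re_le_norm _).trans (norm_inner_le_norm y x)
  have h3 : (inner ℂ y (W y)).re ≤ Real.pi / 4 * ‖x‖ ^ 2 := by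
    have h4 : 0 ≤ Real.pi⁻¹ * (‖y‖ - Real.pi / 2 * ‖x‖) ^ 2 := by positivity
    have h5 : Real.pi⁻¹ * (‖y‖ - Real.pi / 2 * ‖x‖) ^ 2 =
        Real.pi⁻¹ * ‖y‖ ^ 2 - ‖y‖ * ‖x‖ + Real.pi / 4 * ‖x‖ ^ 2 := by
      have := Real.pi_pos.ne'
      field_simp
      ring
    linarith
  have h6 : ‖W y‖ ^ 2 ≤ M * (Real.pi / 4 * ‖x‖ ^ 2) :=
    (hW.norm_sq_le y).trans (mul_le_mul_of_nonneg_left h3 hW.nonneg)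
  have h7 : ‖x - W y‖ ≤ ‖x‖ + ‖W y‖ := norm_sub_le _ _
  have h8 : ‖x - W y‖ ^ 2 ≤ (‖x‖ + ‖W y‖) ^ 2 := by gcongr
  nlinarith [sq_nonneg (‖x‖ - ‖W y‖)]

theorem memLp_div (h : IsEllipticSymbol a d) {p : ℝ → ℝ} (hp : Measurable p)
    (hpd : ∀ x, |p x| ≤ d x) : MemLp (fun x => ((p x / a x : ℝ) : ℂ)) ∞ volume := by
  refine memLp_top_of_bound ?_ Real.pi ?_
  · exact (Complex.measurable_ofReal.comp (hp.div h.measurable)).aestronglyMeasurable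
  · filter_upwards [h.le_mul, h.pos] with x h1 h2
    rw [Complex.norm_real, Real.norm_eq_abs, abs_div, abs_of_pos h2, div_le_iff₀ h2]
    exact (hpd x).trans h1

theorem memLp_sqrt_inv (h : IsEllipticSymbol a d) :
    MemLp (fun x => (((√(a x))⁻¹ : ℝ) : ℂ)) ∞ volume := by
  refine memLp_top_of_bound ?_ √Real.pi ?_
  · exact (Complex.measurable_ofReal.comp h.measurable.sqrt.inv).aestronglyMeasurable
  · filter_upwards [h.inv_pi_le] with x h1
    rw [Complex.norm_real, Real.norm_of_nonneg (by positivity), ← Real.sqrt_inv]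
    refine Real.sqrt_le_sqrt ?_
    rw [inv_le_comm₀ (lt_of_lt_of_le (by positivity) h1) Real.pi_pos]
    exact h1

/-- The inverse of `a + W`. With `S` the multiplication by `a^{-1/2}` it is
`S (1 + S W S)⁻¹ S`. -/
theorem exists_resolvent (h : IsEllipticSymbol a d) (hW : IsBoundedPotential W M) :
    ∃ R : L2R →L[ℂ] L2R, IsSelfAdjoint R ∧ ∀ x, ∀ᵐ ξ, a ξ * (R x) ξ = (x - W (R x)) ξ := by
  set S := mulOp _ h.memLp_sqrt_inv with hS
  have hSsa : IsSelfAdjoint S := isSelfAdjoint_mulOp _ (ae_of_all _ fun x => by simp)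
  have hsym : ∀ x y, inner ℂ (S x) y = inner ℂ x (S y) :=
    inner_mulOp_left _ (ae_of_all _ fun x => by simp)
  set T : L2R →L[ℂ] L2R := 1 + S * W * S with hT
  have hTsa : IsSelfAdjoint T := by
    refine (IsSelfAdjoint.one _).add ?_
    have := hW.isSelfAdjoint.conjugate S
    rwa [hSsa.star_eq] at this
  have hu : IsUnit T := by
    refine ContinuousLinearMap.isUnit_of_forall_le_norm_inner_map T (c := 1) one_pos fun x => ?_
    rw [NNReal.coe_one, mul_one]
    refine le_trans ?_ (Complex.re_le_norm _)
    have e : T x = x + S (W (S x)) := rfl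
    rw [e, inner_add_left, hsym, Complex.add_re, ← inner_conj_symm (W (S x)), Complex.conj_re]
    have h1 := hW.re_inner_nonneg (S x)
    have h2 : (inner ℂ x x).re = ‖x‖ ^ 2 := inner_self_eq_norm_sq (𝕜 := ℂ) x
    linarith
  obtain ⟨v, hv⟩ := hu
  set Ti : L2R →L[ℂ] L2R := ↑v⁻¹ with hTi
  have hTTi : T * Ti = 1 := by rw [← hv, hTi, Units.mul_inv]
  have hTiT : Ti * T = 1 := by rw [← hv, hTi, Units.inv_mul]
  have hTisa : IsSelfAdjoint Ti := by
    have h1 : star Ti * T = 1 := by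
      rw [← hTsa.star_eq, ← star_mul, hTTi, star_one]
    calc star Ti = star Ti * (T * Ti) := by rw [hTTi, mul_one]
      _ = Ti := by rw [← mul_assoc, h1, one_mul]
  refine ⟨S * Ti * S, ?_, fun x => ?_⟩
  · have := hTisa.conjugate S
    rwa [hSsa.star_eq] at this
  · set z := Ti (S x) with hz
    have e1 : (S * Ti * S) x = S z := rfl
    have e2 : z + S (W (S z)) = S x := by
      have := congrArg (fun B => B (S x)) hTTi
      exact this
    have e3 : z = S (x - W (S z)) := by
      rw [map_sub, ← e2]; abel
    rw [e1]
    have h1 := coeFn_mulOp h.memLp_sqrt_inv z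
    have h2 := coeFn_mulOp h.memLp_sqrt_inv (x - W (S z))
    rw [← hS, ← e3] at h2
    filter_upwards [h1, h2, h.pos] with ξ g1 g2 g3
    rw [g1, g2]
    have h4 : ((√(a ξ) : ℝ) : ℂ) ≠ 0 := by
      exact_mod_cast (Real.sqrt_pos.2 g3).ne'
    have h5 : (a ξ : ℂ) = (√(a ξ) : ℝ) * (√(a ξ) : ℝ) := by
      rw [← Complex.ofReal_mul, Real.mul_self_sqrt g3.le]
    rw [h5]
    push_cast
    field_simp

/-- The logarithm of the truncated weight `min d n`. -/
def logWeight (h : IsEllipticSymbol a d) (n : ℕ) : BoundedContinuousFunction ℝ ℂ :=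
  BoundedContinuousFunction.ofNormedAddCommGroup
    (fun x => ((Real.log (min (d x) (n + 1)) : ℝ) : ℂ))
    (Complex.continuous_ofReal.comp ((h.continuous_weight.min continuous_const).log fun x =>
      (lt_min (by linarith [h.one_le x]) (by positivity)).ne')) (Real.log (n + 1)) fun x => by
    have h1 : 1 ≤ min (d x) (n + 1) := le_min (h.one_le x) (by linarith [n.cast_nonneg (α := ℝ)])
    rw [Complex.norm_real, Real.norm_of_nonneg (Real.log_nonneg h1)]
    exact Real.log_le_log (by linarith) (min_le_right _ _)

theorem one_le_min (h : IsEllipticSymbol a d) (n : ℕ) (x : ℝ) : 1 ≤ min (d x) (n + 1) :=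
  le_min (h.one_le x) (by linarith [n.cast_nonneg (α := ℝ)])

/-- Multiplication by the power `(min d n)^t` of the truncated weight. -/
def truncPow (h : IsEllipticSymbol a d) (n : ℕ) (t : ℝ) : L2R →L[ℂ] L2R :=
  NormedSpace.exp ((t : ℂ) • mulBCF (h.logWeight n))

theorem coeFn_truncPow (h : IsEllipticSymbol a d) (n : ℕ) (t : ℝ) (f : L2R) :
    h.truncPow n t f =ᵐ[volume] fun x => ((min (d x) (n + 1) ^ t : ℝ) : ℂ) * f x := by
  rw [truncPow, ← map_smul]
  filter_upwards [exp_mulBCF_ae ((t : ℂ) • h.logWeight n) f] with x hx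
  rw [hx, Real.rpow_def_of_pos (by linarith [h.one_le_min n x])]
  congr 1
  change Complex.exp ((t : ℂ) * ((Real.log (min (d x) (n + 1)) : ℝ) : ℂ)) = _
  push_cast
  rw [mul_comm]

theorem isSelfAdjoint_mulBCF_logWeight (h : IsEllipticSymbol a d) (n : ℕ) :
    IsSelfAdjoint (mulBCF (h.logWeight n)) :=
  isSelfAdjoint_mulOp _ (ae_of_all _ fun _ => Complex.conj_ofReal _)

/-- The interpolated bound of the resolvent, for the truncated weight. -/
theorem norm_truncPow_resolvent_le (h : IsEllipticSymbol a d) (hW : IsBoundedPotential W M)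
    {R : L2R →L[ℂ] L2R} (hR : IsSelfAdjoint R)
    (hRW : ∀ x, ∀ᵐ ξ, a ξ * (R x) ξ = (x - W (R x)) ξ) (n : ℕ) {s : ℝ}
    (hs0 : 0 ≤ s) (hs1 : s ≤ 1) :
    ‖h.truncPow n s * R * h.truncPow n (1 - s)‖ ≤
      √(Real.pi ^ 2 * (2 + Real.pi / 2 * M)) := by
  have hM := hW.nonneg
  have h1 : ‖NormedSpace.exp (mulBCF (h.logWeight n)) * R‖ ≤
      √(Real.pi ^ 2 * (2 + Real.pi / 2 * M)) := by
    refine ContinuousLinearMap.opNorm_le_bound _ (Real.sqrt_nonneg _) fun x => ?_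
    have h2 : ‖h.truncPow n 1 (R x)‖ ≤ Real.pi * ‖x - W (R x)‖ := by
      refine norm_le_of_ae_norm_le ?_
      filter_upwards [h.coeFn_truncPow n 1 (R x), hRW x, h.le_mul, h.pos] with ξ g1 g2 g3 g4
      rw [g1, ← g2, norm_mul, norm_mul, Real.rpow_one, Complex.norm_real, Complex.norm_real,
        Real.norm_of_nonneg (by linarith [h.one_le_min n ξ]), Real.norm_of_nonneg g4.le,
        ← mul_assoc]
      gcongr
      exact (min_le_left _ _).trans g3
    have h3 := h.norm_sub_sq_le hW (hRW x)
    have e : h.truncPow n 1 = NormedSpace.exp (mulBCF (h.logWeight n)) := by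
      rw [truncPow, Complex.ofReal_one, one_smul]
    rw [e] at h2
    change ‖NormedSpace.exp (mulBCF (h.logWeight n)) (R x)‖ ≤ _
    refine h2.trans ?_
    rw [Real.sqrt_mul (by positivity), Real.sqrt_sq Real.pi_pos.le, mul_assoc]
    gcongr
    rw [← Real.sqrt_sq (norm_nonneg x), ← Real.sqrt_mul (by positivity)]
    exact Real.le_sqrt_of_sq_le h3
  refine norm_exp_mul_mul_exp_le (h.isSelfAdjoint_mulBCF_logWeight n) ?_ h1 hs0 hs1
  have hsa : IsSelfAdjoint (NormedSpace.exp (mulBCF (h.logWeight n))) :=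
    (h.isSelfAdjoint_mulBCF_logWeight n).exp
  have e : R * NormedSpace.exp (mulBCF (h.logWeight n)) =
      star (NormedSpace.exp (mulBCF (h.logWeight n)) * R) := by
    rw [star_mul, hR.star_eq, hsa.star_eq]
  rw [e, ContinuousLinearMap.star_eq_adjoint, LinearIsometryEquiv.norm_map]
  exact h1

/-- Convergence in `L₂` of `q_n φ` to `φ` for multipliers `0 ≤ q_n ≤ 1` that tend to `1`. -/
theorem tendsto_of_ae_eq_mul {φ : L2R} {φn : ℕ → L2R} {q : ℕ → ℝ → ℝ}
    (h : ∀ n, ∀ᵐ x, φn n x = q n x * φ x) (hq0 : ∀ n x, 0 ≤ q n x) (hq1 : ∀ n x, q n x ≤ 1)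
    (hq : ∀ x, Tendsto (fun n => q n x) atTop (𝓝 1)) : Tendsto φn atTop (𝓝 φ) := by
  rw [tendsto_iff_norm_sub_tendsto_zero]
  have h1 : Tendsto (fun n => ‖φn n - φ‖ ^ 2) atTop (𝓝 0) := by
    simp only [norm_sq_L2R]
    have h2 : (0 : ℝ) = ∫ x : ℝ, (0 : ℝ) := by simp
    rw [h2]
    refine tendsto_integral_of_dominated_convergence (fun x => ‖φ x‖ ^ 2)
      (fun n => (Lp.aestronglyMeasurable _).norm.pow 2) (integrable_norm_sq_L2R φ)
      (fun n => ?_) ?_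
    · filter_upwards [h n, Lp.coeFn_sub (φn n) φ] with x g1 g2
      rw [g2, Pi.sub_apply, g1, Real.norm_of_nonneg (by positivity)]
      have e : (q n x : ℂ) * φ x - φ x = ((q n x - 1 : ℝ) : ℂ) * φ x := by push_cast; ring
      rw [e, norm_mul, Complex.norm_real, Real.norm_eq_abs]
      have : |q n x - 1| ≤ 1 := by rw [abs_le]; constructor <;> linarith [hq0 n x, hq1 n x]
      gcongr
      exact mul_le_of_le_one_left (norm_nonneg _) this
    · filter_upwards [ae_all_iff.2 h, ae_all_iff.2 fun n => Lp.coeFn_sub (φn n) φ] with x g1 g2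
      have e : ∀ n, (φn n - φ) x = ((q n x : ℝ) : ℂ) * φ x - φ x := fun n => by
        rw [g2, Pi.sub_apply, g1]
      simp only [e]
      have h3 : Tendsto (fun n => ((q n x : ℝ) : ℂ) * φ x - φ x) atTop
          (𝓝 (((1 : ℝ) : ℂ) * φ x - φ x)) :=
        (((Complex.continuous_ofReal.tendsto _).comp (hq x)).mul_const _).sub_const _
      have h4 := (h3.norm).pow 2
      simpa using h4
  have h5 := h1.sqrt
  simpa using h5

/-- Solution of `a u + W u = d^{1-s} φ`, with the bound of `d^s u` that interpolation gives. -/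
theorem exists_solution (h : IsEllipticSymbol a d) (hW : IsBoundedPotential W M) {s : ℝ}
    (hs0 : 0 ≤ s) (hs1 : s ≤ 1) (φ : L2R) :
    ∃ u : L2R, (∀ᵐ ξ, a ξ * u ξ = ((d ξ ^ (1 - s) : ℝ) : ℂ) * φ ξ - (W u) ξ) ∧
      eLpNorm (fun ξ => ((d ξ ^ s : ℝ) : ℂ) * u ξ) 2 volume ≤
        ENNReal.ofReal (√(Real.pi ^ 2 * (2 + Real.pi / 2 * M)) * ‖φ‖) := by
  obtain ⟨R, hR, hRW⟩ := h.exists_resolvent hW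
  have hd0 : ∀ x, 0 < d x := fun x => by linarith [h.one_le x]
  have hpow : ∀ x, |d x ^ (1 - s)| ≤ d x := fun x => by
    rw [abs_of_nonneg (Real.rpow_nonneg (hd0 x).le _)]
    conv_rhs => rw [← Real.rpow_one (d x)]
    exact Real.rpow_le_rpow_of_exponent_le (h.one_le x) (by linarith)
  have hG := h.memLp_div (p := fun _ => 1) measurable_const
    (fun x => by rw [abs_one]; exact h.one_le x)
  have hQ := h.memLp_div (p := fun x => d x ^ (1 - s))
    (h.continuous_weight.measurable.pow_const _) hpow
  set G := mulOp _ hG with hGdef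
  set Q := mulOp _ hQ with hQdef
  have hGsa : IsSelfAdjoint G := isSelfAdjoint_mulOp _ (ae_of_all _ fun _ => Complex.conj_ofReal _)
  -- `R = G - G W R`, and the adjoint identity `R = G - R W G`
  have hR1 : R = G - G * W * R := by
    ext1 x
    have e : (G - G * W * R) x = G (x - W (R x)) := by
      rw [map_sub]; rfl
    rw [e]
    refine Lp.ext ?_
    filter_upwards [coeFn_mulOp hG (x - W (R x)), hRW x, h.pos] with ξ g1 g2 g3
    rw [g1, ← g2]
    have : (a ξ : ℂ) ≠ 0 := by exact_mod_cast g3.ne'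
    push_cast
    field_simp
  have hR2 : R = G - R * W * G := by
    have := congrArg star hR1
    rwa [star_sub, star_mul, star_mul, hR.star_eq, hW.isSelfAdjoint.star_eq, hGsa.star_eq,
      ← mul_assoc] at this
  set B : L2R →L[ℂ] L2R := Q - R * W * Q with hB
  have hBx : ∀ x, B x = Q x - R (W (Q x)) := fun x => rfl
  refine ⟨B φ, ?_, ?_⟩
  · have e : W (B φ) = W (Q φ) - W (R (W (Q φ))) := by rw [hBx, map_sub]
    rw [e]
    filter_upwards [coeFn_mulOp hQ φ, hRW (W (Q φ)), Lp.coeFn_sub (Q φ) (R (W (Q φ))), h.pos]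
      with ξ g1 g2 g3 g4
    rw [hBx, g3, Pi.sub_apply, mul_sub, g2, g1]
    have : (a ξ : ℂ) ≠ 0 := by exact_mod_cast g4.ne'
    push_cast
    field_simp
  · have hmin0 : ∀ (n : ℕ) x, 0 < min (d x) (n + 1) := fun n x => by linarith [h.one_le_min n x]
    -- the data `φ` is replaced by `(min d n / d)^{1-s} φ`
    have hq : ∀ n : ℕ, MemLp (fun x => (((min (d x) (n + 1) / d x) ^ (1 - s) : ℝ) : ℂ)) ∞
        volume := by
      intro n
      refine memLp_top_of_bound (Complex.measurable_ofReal.comp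
        (((h.continuous_weight.measurable.min measurable_const).div
          h.continuous_weight.measurable).pow_const _)).aestronglyMeasurable 1
        (ae_of_all _ fun x => ?_)
      have h0 : 0 ≤ min (d x) (n + 1) / d x := div_nonneg (hmin0 n x).le (hd0 x).le
      rw [Complex.norm_real, Real.norm_of_nonneg (Real.rpow_nonneg h0 _)]
      exact Real.rpow_le_one h0 (div_le_one_of_le₀ (min_le_left _ _) (hd0 x).le) (by linarith)
    set φn : ℕ → L2R := fun n => mulOp _ (hq n) φ with hφn
    have hlim : Tendsto φn atTop (𝓝 φ) := by
      refine tendsto_of_ae_eq_mul (fun n => coeFn_mulOp (hq n) φ) (fun n x => ?_) (fun n x => ?_)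
        fun x => ?_
      · exact Real.rpow_nonneg (div_nonneg (hmin0 n x).le (hd0 x).le) _
      · exact Real.rpow_le_one (div_nonneg (hmin0 n x).le (hd0 x).le)
          (div_le_one_of_le₀ (min_le_left _ _) (hd0 x).le) (by linarith)
      · refine tendsto_const_nhds.congr' ?_
        obtain ⟨N, hN⟩ := exists_nat_ge (d x)
        filter_upwards [eventually_ge_atTop N] with n hn
        have : (N : ℝ) ≤ n := by exact_mod_cast hn
        rw [min_eq_left (by linarith), div_self (hd0 x).ne', Real.one_rpow]
    have hBn : ∀ n, B (φn n) = R (h.truncPow n (1 - s) φ) := by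
      intro n
      have e1 : Q (φn n) = G (h.truncPow n (1 - s) φ) := by
        refine Lp.ext ?_
        filter_upwards [coeFn_mulOp hQ (φn n), coeFn_mulOp (hq n) φ,
          coeFn_mulOp hG (h.truncPow n (1 - s) φ), h.coeFn_truncPow n (1 - s) φ] with x g1 g2 g3 g4
        have e2 : φn n x = (((min (d x) (n + 1) / d x) ^ (1 - s) : ℝ) : ℂ) * φ x := g2
        rw [g1, g3, g4, e2, ← mul_assoc, ← mul_assoc, ← Complex.ofReal_mul, ← Complex.ofReal_mul,
          Real.div_rpow (hmin0 n x).le (hd0 x).le]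
        congr 2
        have := (Real.rpow_pos_of_pos (hd0 x) (1 - s)).ne'
        field_simp
      rw [hBx, e1]
      conv_rhs => rw [hR2]
      rfl
    have hbound : ∀ N : ℕ, ‖h.truncPow N s (B φ)‖ ≤
        √(Real.pi ^ 2 * (2 + Real.pi / 2 * M)) * ‖φ‖ := by
      intro N
      have hl : Tendsto (fun n => ‖h.truncPow N s (B (φn n))‖) atTop
          (𝓝 ‖h.truncPow N s (B φ)‖) :=
        (((h.truncPow N s).continuous.tendsto _).comp
          ((B.continuous.tendsto _).comp hlim)).norm
      refine le_of_tendsto hl ?_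
      filter_upwards [eventually_ge_atTop N] with n hn
      rw [hBn]
      have h1 : ‖h.truncPow N s (R (h.truncPow n (1 - s) φ))‖ ≤
          1 * ‖h.truncPow n s (R (h.truncPow n (1 - s) φ))‖ := by
        refine norm_le_of_ae_norm_le ?_
        filter_upwards [h.coeFn_truncPow N s (R (h.truncPow n (1 - s) φ)),
          h.coeFn_truncPow n s (R (h.truncPow n (1 - s) φ))] with x g1 g2
        rw [g1, g2, one_mul, norm_mul, norm_mul, Complex.norm_real, Complex.norm_real,
          Real.norm_of_nonneg (Real.rpow_nonneg (hmin0 N x).le _),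
          Real.norm_of_nonneg (Real.rpow_nonneg (hmin0 n x).le _)]
        have : (N : ℝ) ≤ n := by exact_mod_cast hn
        gcongr
        exact (hmin0 N x).le
      rw [one_mul] at h1
      refine h1.trans ?_
      exact ((h.truncPow n s * R * h.truncPow n (1 - s)).le_opNorm φ).trans
        (mul_le_mul_of_nonneg_right (h.norm_truncPow_resolvent_le hW hR hRW n hs0 hs1)
          (norm_nonneg _))
    refine (Lp.eLpNorm_lim_le_liminf_eLpNorm (f := fun N => (h.truncPow N s (B φ) : ℝ → ℂ))
      (fun N => Lp.aestronglyMeasurable _) _ ?_).trans ?_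
    · filter_upwards [ae_all_iff.2 fun N => h.coeFn_truncPow N s (B φ)] with x hx
      refine tendsto_const_nhds.congr' ?_
      obtain ⟨N, hN⟩ := exists_nat_ge (d x)
      filter_upwards [eventually_ge_atTop N] with n hn
      have : (N : ℝ) ≤ n := by exact_mod_cast hn
      rw [hx, min_eq_left (by linarith)]
    · refine liminf_le_of_frequently_le' (Frequently.of_forall fun N => ?_)
      rw [← ENNReal.ofReal_toReal (Lp.eLpNorm_ne_top _), ← Lp.norm_def]
      exact ENNReal.ofReal_le_ofReal (hbound N)

end IsEllipticSymbol

/-! ### The symbol `ξ coth(πξ)` -/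

/-- The symbol `ξ coth(πξ)` of the Prandtl operator at the frequency `ξ = πη`. -/
def symb (η : ℝ) : ℝ :=
  Real.pi * η * (Real.cosh (Real.pi * (Real.pi * η)) / Real.sinh (Real.pi * (Real.pi * η)))

/-- The weight `(1 + 4ξ²)^{1/2}` at the frequency `ξ = πη`. -/
def wt (η : ℝ) : ℝ := √(1 + 4 * (Real.pi * η) ^ 2)

theorem one_le_wt (η : ℝ) : 1 ≤ wt η := by
  rw [wt, Real.one_le_sqrt]
  nlinarith [sq_nonneg (Real.pi * η)]

theorem wt_pos (η : ℝ) : 0 < wt η := one_pos.trans_le (one_le_wt η)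

theorem continuous_wt : Continuous wt := by unfold wt; fun_prop

theorem wt_rpow (s η : ℝ) : wt η ^ s = (1 + 4 * (Real.pi * η) ^ 2) ^ (s / 2) := by
  rw [wt, Real.sqrt_eq_rpow, ← Real.rpow_mul (by positivity)]
  ring_nf

theorem abs_sinh_le (x : ℝ) : |Real.sinh x| ≤ |x| * Real.cosh x := by
  have key : ∀ y : ℝ, 0 ≤ y → Real.sinh y ≤ y * Real.cosh y := by
    intro y hy
    have hmono : MonotoneOn (fun t : ℝ => t * Real.cosh t - Real.sinh t) (Ici 0) := by
      refine monotoneOn_of_deriv_nonneg (convex_Ici 0) (by fun_prop) (by fun_prop) ?_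
      intro t ht
      rw [interior_Ici] at ht
      have h1 : HasDerivAt (fun t : ℝ => t * Real.cosh t - Real.sinh t)
          (1 * Real.cosh t + t * Real.sinh t - Real.cosh t) t :=
        ((hasDerivAt_id t).mul (Real.hasDerivAt_cosh t)).sub (Real.hasDerivAt_sinh t)
      rw [h1.deriv]
      have := Real.sinh_pos_iff.2 ht
      have : 0 < t := ht
      nlinarith [mul_pos ‹0 < t› (Real.sinh_pos_iff.2 ht)]
    have := hmono self_mem_Ici hy hy
    simp at this
    linarith
  rcases le_total 0 x with h | h
  · rw [abs_of_nonneg h, abs_of_nonneg (Real.sinh_nonneg_iff.2 h)]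
    exact key x h
  · rw [abs_of_nonpos h, abs_of_nonpos (Real.sinh_nonpos_iff.2 h), ← Real.sinh_neg,
      ← Real.cosh_neg]
    exact key (-x) (by linarith)

theorem sinh_sq_le (y : ℝ) : Real.sinh y ^ 2 ≤ y ^ 2 * Real.exp (y ^ 2 / 2) := by
  have h1 : |Real.sinh y| ≤ |y| * Real.exp (y ^ 2 / 4) := by
    have h2 : Real.sinh y = 2 * Real.sinh (y / 2) * Real.cosh (y / 2) := by
      rw [← Real.sinh_two_mul]; ring_nf
    have h3 := abs_sinh_le (y / 2)
    have h4 : Real.cosh (y / 2) ≤ Real.exp (y ^ 2 / 8) := by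
      have := Real.cosh_le_exp_half_sq (y / 2)
      ring_nf at this ⊢
      exact this
    have h5 := Real.cosh_pos (y / 2)
    have h6 : Real.exp (y ^ 2 / 4) = Real.exp (y ^ 2 / 8) * Real.exp (y ^ 2 / 8) := by
      rw [← Real.exp_add]; ring_nf
    rw [h2, abs_mul, abs_mul, abs_two, abs_of_pos h5, h6]
    rw [abs_div, abs_two] at h3
    calc 2 * |Real.sinh (y / 2)| * Real.cosh (y / 2)
        ≤ 2 * (|y| / 2 * Real.cosh (y / 2)) * Real.cosh (y / 2) := by gcongr
      _ = |y| * (Real.cosh (y / 2) * Real.cosh (y / 2)) := by ring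
      _ ≤ _ := by gcongr
  have h2 : Real.exp (y ^ 2 / 2) = Real.exp (y ^ 2 / 4) ^ 2 := by
    rw [← Real.exp_nat_mul]; ring_nf
  rw [h2, ← mul_pow, ← sq_abs, ← sq_abs (y * _), abs_mul, abs_of_pos (Real.exp_pos _)]
  gcongr

theorem mul_coth_sq_bounds {y : ℝ} (hy : y ≠ 0) :
    1 + y ^ 2 / 2 ≤ (y * (Real.cosh y / Real.sinh y)) ^ 2 ∧
      (y * (Real.cosh y / Real.sinh y)) ^ 2 ≤ 1 + y ^ 2 := by
  have hs : Real.sinh y ≠ 0 := Real.sinh_ne_zero.2 hy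
  have hs2 : 0 < Real.sinh y ^ 2 := by positivity
  have e : (y * (Real.cosh y / Real.sinh y)) ^ 2 = y ^ 2 + y ^ 2 / Real.sinh y ^ 2 := by
    rw [mul_pow, div_pow, Real.cosh_sq]
    field_simp
  rw [e]
  constructor
  · have h1 : 1 - y ^ 2 / 2 ≤ y ^ 2 / Real.sinh y ^ 2 := by
      rw [le_div_iff₀ hs2]
      rcases le_total (1 - y ^ 2 / 2) 0 with h | h
      · nlinarith [sq_nonneg y, mul_nonneg (neg_nonneg.2 h) hs2.le]
      · have h2 : 1 - y ^ 2 / 2 ≤ Real.exp (-(y ^ 2 / 2)) := by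
          linarith [Real.add_one_le_exp (-(y ^ 2 / 2))]
        calc (1 - y ^ 2 / 2) * Real.sinh y ^ 2
            ≤ Real.exp (-(y ^ 2 / 2)) * (y ^ 2 * Real.exp (y ^ 2 / 2)) := by
              gcongr
              exact sinh_sq_le y
          _ = y ^ 2 := by rw [Real.exp_neg]; field_simp
    linarith
  · have h1 : y ^ 2 / Real.sinh y ^ 2 ≤ 1 := by
      rw [div_le_one hs2, sq_le_sq]
      rcases le_total 0 y with h | h
      · rw [abs_of_nonneg h, abs_of_nonneg (Real.sinh_nonneg_iff.2 h)]
        exact Real.self_le_sinh_iff.2 h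
      · rw [abs_of_nonpos h, abs_of_nonpos (Real.sinh_nonpos_iff.2 h)]
        linarith [Real.sinh_le_self_iff.2 h]
    linarith

theorem symb_eq (η : ℝ) : symb η = Real.pi⁻¹ * (Real.pi * (Real.pi * η) *
    (Real.cosh (Real.pi * (Real.pi * η)) / Real.sinh (Real.pi * (Real.pi * η)))) := by
  rw [symb]
  have := Real.pi_pos.ne'
  field_simp

theorem symb_nonneg (η : ℝ) : 0 ≤ symb η := by
  rw [symb_eq]
  have h : ∀ y : ℝ, 0 ≤ y * (Real.cosh y / Real.sinh y) := by
    intro y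
    rw [← mul_div_assoc, mul_comm, mul_div_assoc]
    refine mul_nonneg (Real.cosh_pos y).le ?_
    rcases le_total 0 y with h | h
    · exact div_nonneg h (Real.sinh_nonneg_iff.2 h)
    · exact div_nonneg_of_nonpos h (Real.sinh_nonpos_iff.2 h)
  have := h (Real.pi * (Real.pi * η))
  positivity

theorem wt_le_pi_mul_symb {η : ℝ} (hη : η ≠ 0) : wt η ≤ Real.pi * symb η := by
  have hp := Real.pi_pos
  have h := (mul_coth_sq_bounds (y := Real.pi * (Real.pi * η)) (by positivity)).1
  refine Real.sqrt_le_iff.2 ⟨mul_nonneg hp.le (symb_nonneg η), ?_⟩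
  have e : Real.pi * symb η = Real.pi * (Real.pi * η) *
      (Real.cosh (Real.pi * (Real.pi * η)) / Real.sinh (Real.pi * (Real.pi * η))) := by
    rw [symb_eq, mul_inv_cancel_left₀ hp.ne']
  rw [e]
  refine le_trans ?_ h
  have : 8 ≤ Real.pi ^ 2 := by nlinarith [Real.pi_gt_three]
  nlinarith [sq_nonneg (Real.pi * η)]

theorem symb_le_wt (η : ℝ) : symb η ≤ wt η := by
  rcases eq_or_ne η 0 with rfl | hη
  · simp [symb, wt]
  have hp := Real.pi_pos
  have h := (mul_coth_sq_bounds (y := Real.pi * (Real.pi * η)) (by positivity)).2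
  refine Real.le_sqrt_of_sq_le ?_
  rw [symb_eq, mul_pow]
  calc Real.pi⁻¹ ^ 2 * _ ≤ Real.pi⁻¹ ^ 2 * (1 + (Real.pi * (Real.pi * η)) ^ 2) := by gcongr
    _ = Real.pi⁻¹ ^ 2 + (Real.pi * η) ^ 2 := by field_simp
    _ ≤ 1 + 4 * (Real.pi * η) ^ 2 := by
      have : Real.pi⁻¹ ^ 2 ≤ 1 := by
        rw [inv_pow]
        exact inv_le_one_of_one_le₀ (by nlinarith [Real.pi_gt_three])
      nlinarith [sq_nonneg (Real.pi * η)]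

theorem measurable_symb : Measurable symb := by
  unfold symb
  exact ((measurable_const.mul measurable_id)).mul
    ((Real.measurable_cosh.comp (by fun_prop)).div (Real.measurable_sinh.comp (by fun_prop)))

theorem isEllipticSymbol_symb : IsEllipticSymbol symb wt where
  measurable := measurable_symb
  continuous_weight := continuous_wt
  one_le := one_le_wt
  le_mul := by
    have h : ∀ᵐ η : ℝ, η ≠ 0 := by simp [ae_iff]
    filter_upwards [h] with η hη using wt_le_pi_mul_symb hη

/-! ### The Fourier picture of the spaces `H̃ˢ` -/

/-- The Fourier transform of `u ∘ tanh`, in Mathlib's normalization. -/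
def hat (u : LTilde2) : L2R := 𝓕 (toLine u)

theorem pTransform_eq_hat (u : LTilde2) (ξ : ℝ) : pTransform u ξ = hat u (ξ / Real.pi) := rfl

theorem measurableEmbedding_tanh : MeasurableEmbedding Real.tanh :=
  measurable_tanh.measurableEmbedding Real.tanh_injective

theorem toLine_surjective : Function.Surjective toLine := by
  intro φ
  have h : MemLp (fun x => φ (Real.artanh x)) 2 tildeMeasure := by
    rw [← measurePreserving_tanh.map_eq, measurableEmbedding_tanh.memLp_map_measure_iff]
    refine (memLp_congr_ae (ae_of_all _ fun w => ?_)).1 (Lp.memLp φ)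
    rw [Function.comp_apply, Real.artanh_tanh]
  refine ⟨h.toLp, ?_⟩
  refine Lp.ext ?_
  have h1 : (toLine h.toLp : ℝ → ℂ) =ᵐ[volume] h.toLp ∘ Real.tanh :=
    Lp.coeFn_compMeasurePreserving _ measurePreserving_tanh
  filter_upwards [h1, measurePreserving_tanh.quasiMeasurePreserving.ae_eq h.coeFn_toLp]
    with w g1 g2
  rw [g1, g2, Function.comp_apply, Real.artanh_tanh]

theorem toLine_ae_eq (u : LTilde2) : (toLine u : ℝ → ℂ) =ᵐ[volume] fun w => u (Real.tanh w) :=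
  Lp.coeFn_compMeasurePreserving u measurePreserving_tanh

theorem hat_surjective : Function.Surjective hat := by
  intro φ
  obtain ⟨u, hu⟩ := toLine_surjective (𝓕⁻ φ)
  exact ⟨u, by rw [hat, hu, FourierTransform.fourier_fourierInv_eq]⟩

theorem hat_injective : Function.Injective hat := by
  intro u v h
  have h1 := congrArg (fun F : L2R => (𝓕⁻ F : L2R)) h
  simp only [hat, FourierTransform.fourierInv_fourier_eq] at h1
  exact toLine.injective h1

theorem fourierInv_hat (u : LTilde2) : (𝓕⁻ (hat u) : L2R) = toLine u :=
  FourierTransform.fourierInv_fourier_eq _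

/-- The function `(1 + 4ξ²)^{s/2} U(ξ)` in the variable `η = ξ / π`. -/
def whtd (s : ℝ) (u : LTilde2) (η : ℝ) : ℂ := ((wt η ^ s : ℝ) : ℂ) * hat u η

theorem aestronglyMeasurable_whtd (s : ℝ) (u : LTilde2) :
    AEStronglyMeasurable (whtd s u) volume :=
  (Complex.measurable_ofReal.comp (continuous_wt.measurable.pow_const s)).aestronglyMeasurable.mul
    (Lp.aestronglyMeasurable _)

theorem norm_whtd_sq (s : ℝ) (u : LTilde2) (η : ℝ) :
    ‖whtd s u η‖ ^ 2 = (1 + 4 * (Real.pi * η) ^ 2) ^ s * ‖hat u η‖ ^ 2 := by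
  have h : (0 : ℝ) < 1 + 4 * (Real.pi * η) ^ 2 := by positivity
  rw [whtd, norm_mul, mul_pow, Complex.norm_real,
    Real.norm_of_nonneg (Real.rpow_nonneg (wt_pos η).le _), wt_rpow,
    ← Real.rpow_natCast, ← Real.rpow_mul h.le]
  norm_num

theorem weight_comp_div (s : ℝ) (u : LTilde2) :
    (fun ξ : ℝ => (1 + 4 * ξ ^ 2) ^ s * ‖pTransform u ξ‖ ^ 2) =
      fun ξ => ‖whtd s u (ξ / Real.pi)‖ ^ 2 := by
  ext ξ
  rw [norm_whtd_sq, mul_div_cancel₀ _ Real.pi_pos.ne', pTransform_eq_hat]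

theorem memHTilde_iff_memLp_whtd (s : ℝ) (u : LTilde2) :
    MemHTilde s u ↔ MemLp (whtd s u) 2 volume := by
  rw [memLp_two_iff_integrable_sq_norm (aestronglyMeasurable_whtd s u), MemHTilde,
    weight_comp_div, integrable_comp_div_iff (fun η => ‖whtd s u η‖ ^ 2) Real.pi_pos.ne']

theorem HTilde.norm_sq_eq {s : ℝ} (u : HTilde s) : ‖u‖ ^ 2 = ∫ η, ‖whtd s u.val η‖ ^ 2 := by
  rw [HTilde.norm_def, Real.sq_sqrt (mul_nonneg (by positivity)
    (integral_nonneg fun ξ => by positivity)), weight_comp_div,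
    Measure.integral_comp_div (fun η => ‖whtd s u.val η‖ ^ 2), abs_of_pos Real.pi_pos, smul_eq_mul,
    ← mul_assoc, one_div, inv_mul_cancel₀ Real.pi_pos.ne', one_mul]

/-- The element of `L₂(ℝ)` given by the weighted transform. -/
def HTilde.whtdLp {s : ℝ} (u : HTilde s) : L2R :=
  ((memHTilde_iff_memLp_whtd s u.val).1 u.val_mem).toLp

theorem HTilde.coeFn_whtdLp {s : ℝ} (u : HTilde s) : u.whtdLp =ᵐ[volume] whtd s u.val :=
  MemLp.coeFn_toLp _

theorem HTilde.norm_whtdLp {s : ℝ} (u : HTilde s) : ‖u.whtdLp‖ = ‖u‖ := by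
  have h : ‖u.whtdLp‖ ^ 2 = ‖u‖ ^ 2 := by
    rw [norm_sq_L2R, u.norm_sq_eq]
    refine integral_congr_ae ?_
    filter_upwards [u.coeFn_whtdLp] with η h
    rw [h]
  rwa [sq_eq_sq₀ (norm_nonneg _) (norm_nonneg _)] at h

theorem exists_hTilde {s : ℝ} {F : L2R} (hF : MemLp (fun η => ((wt η ^ s : ℝ) : ℂ) * F η) 2 volume) :
    ∃ u : HTilde s, hat u.val = F := by
  obtain ⟨u, rfl⟩ := hat_surjective F
  exact ⟨(⟨u, (memHTilde_iff_memLp_whtd s u).2 hF⟩ : hTilde s), rfl⟩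

theorem HTilde.val_injective {s : ℝ} : Function.Injective (HTilde.val : HTilde s → LTilde2) :=
  Subtype.val_injective

theorem memLp_wt_rpow_neg {s : ℝ} (hs : 0 ≤ s) :
    MemLp (fun η => ((wt η ^ (-s) : ℝ) : ℂ)) ∞ volume := by
  refine memLp_top_of_bound (Complex.measurable_ofReal.comp
    (continuous_wt.measurable.pow_const _)).aestronglyMeasurable 1 (ae_of_all _ fun η => ?_)
  rw [Complex.norm_real, Real.norm_of_nonneg (Real.rpow_nonneg (wt_pos η).le _)]
  exact Real.rpow_le_one_of_one_le_of_nonpos (one_le_wt η) (by linarith)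

theorem exists_whtdLp_eq {s : ℝ} (hs : 0 ≤ s) (ψ : L2R) : ∃ u : HTilde s, u.whtdLp = ψ := by
  have h1 : (fun η => ((wt η ^ s : ℝ) : ℂ) * mulOp _ (memLp_wt_rpow_neg hs) ψ η) =ᵐ[volume] ψ := by
    filter_upwards [coeFn_mulOp (memLp_wt_rpow_neg hs) ψ] with η h
    rw [h, ← mul_assoc, ← Complex.ofReal_mul, ← Real.rpow_add (wt_pos η)]
    simp
  obtain ⟨u, hu⟩ := exists_hTilde ((memLp_congr_ae h1).2 (Lp.memLp ψ))
  refine ⟨u, Lp.ext (u.coeFn_whtdLp.trans ?_)⟩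
  refine EventuallyEq.trans (ae_of_all _ fun η => ?_) h1
  rw [whtd, hu]

theorem whtdLp_injective {s : ℝ} {u v : HTilde s} (h : u.whtdLp = v.whtdLp) : u = v := by
  refine HTilde.val_injective (hat_injective (Lp.ext ?_))
  have h2 := v.coeFn_whtdLp
  rw [← h] at h2
  filter_upwards [u.coeFn_whtdLp, h2] with η g1 g2
  rw [g1, whtd, whtd] at g2
  have : ((wt η ^ s : ℝ) : ℂ) ≠ 0 := by exact_mod_cast (Real.rpow_pos_of_pos (wt_pos η) s).ne'
  exact mul_left_cancel₀ this g2

theorem hat_add (u v : LTilde2) : hat (u + v) = hat u + hat v := by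
  rw [hat, map_add, FourierTransform.fourier_add]; rfl

theorem hat_smul (c : ℂ) (u : LTilde2) : hat (c • u) = c • hat u := by
  rw [hat, map_smul, FourierTransform.fourier_smul]; rfl

theorem HTilde.whtdLp_add {s : ℝ} (u v : HTilde s) : (u + v).whtdLp = u.whtdLp + v.whtdLp := by
  refine Lp.ext ?_
  filter_upwards [u.coeFn_whtdLp, v.coeFn_whtdLp, (u + v).coeFn_whtdLp,
    Lp.coeFn_add u.whtdLp v.whtdLp, Lp.coeFn_add (hat u.val) (hat v.val)] with η h1 h2 h3 h4 h5
  rw [h3, h4, Pi.add_apply, h1, h2, whtd, whtd, whtd, map_add, hat_add, h5, Pi.add_apply, mul_add]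

theorem HTilde.whtdLp_smul {s : ℝ} (c : ℂ) (u : HTilde s) : (c • u).whtdLp = c • u.whtdLp := by
  refine Lp.ext ?_
  filter_upwards [u.coeFn_whtdLp, (c • u).coeFn_whtdLp,
    Lp.coeFn_smul c u.whtdLp, Lp.coeFn_smul c (hat u.val)] with η h1 h3 h4 h5
  rw [h3, h4, Pi.smul_apply, h1, whtd, whtd, map_smul, hat_smul, h5, Pi.smul_apply, smul_eq_mul,
    smul_eq_mul]
  ring

/-- The weighted transform, as an isometry of `H̃ˢ` onto `L₂(ℝ)`. -/
def HTilde.whtdEquiv {s : ℝ} (hs : 0 ≤ s) : HTilde s ≃ₗᵢ[ℂ] L2R where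
  toLinearEquiv := LinearEquiv.ofBijective
    { toFun := HTilde.whtdLp
      map_add' := HTilde.whtdLp_add
      map_smul' := HTilde.whtdLp_smul } ⟨fun _ _ h => whtdLp_injective h, exists_whtdLp_eq hs⟩
  norm_map' := HTilde.norm_whtdLp

/-- Riesz representation of the functionals in `(H̃ˢ)*` on the Fourier side. -/
theorem exists_riesz {s : ℝ} (hs : 0 ≤ s) (f : HTildeDual s) :
    ∃ φ : L2R, ‖φ‖ ≤ ‖f‖ ∧ ∀ g : HTilde s, f g = ∫ η, φ η * conj (whtd s g.val η) := by
  set e := HTilde.whtdEquiv hs with he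
  set T : L2R →L[ℂ] ℂ := LinearMap.mkContinuous
    { toFun := fun ψ => conj (f (e.symm ψ))
      map_add' := fun x y => by rw [map_add, map_add, map_add]
      map_smul' := fun c x => by simp } ‖f‖ fun ψ => by
        change ‖conj (f (e.symm ψ))‖ ≤ _
        rw [RCLike.norm_conj]
        refine (f.le_opNorm _).trans_eq ?_
        rw [LinearIsometryEquiv.norm_map] with hT
  refine ⟨(InnerProductSpace.toDual ℂ L2R).symm T, ?_, fun g => ?_⟩
  · rw [LinearIsometryEquiv.norm_map]
    exact LinearMap.mkContinuous_norm_le _ (norm_nonneg _) _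
  · set φ := (InnerProductSpace.toDual ℂ L2R).symm T with hφ
    have h1 : inner ℂ φ (e g) = T (e g) := InnerProductSpace.toDual_symm_apply
    have h2 : T (e g) = conj (f g) := by
      change conj (f (e.symm (e g))) = _
      rw [LinearIsometryEquiv.symm_apply_apply]
    have h3 : f g = inner ℂ (e g) φ := by
      rw [← inner_conj_symm, h1, h2, Complex.conj_conj]
    rw [h3, inner_L2R]
    refine integral_congr_ae ?_
    filter_upwards [g.coeFn_whtdLp] with η h
    have : (e g) η = whtd s g.val η := h
    rw [this]

/-! ### The potential and the form on the Fourier side -/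

/-- The potential `(1 - x²) V(x)`, `x = tanh w`, on the line. -/
def lineV (V : ℝ → ℝ) (w : ℝ) : ℝ := (1 - Real.tanh w ^ 2) * V (Real.tanh w)

theorem one_sub_tanh_sq_pos (w : ℝ) : 0 < 1 - Real.tanh w ^ 2 := by
  nlinarith [Real.tanh_sq_lt_one w]

theorem tanh_mem_Ioo (w : ℝ) : Real.tanh w ∈ Ioo (-1 : ℝ) 1 :=
  ⟨Real.neg_one_lt_tanh w, Real.tanh_lt_one w⟩

theorem quasiMeasurePreserving_tanh :
    Measure.QuasiMeasurePreserving Real.tanh volume (volume.restrict (Ioo (-1) 1)) :=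
  ⟨measurable_tanh, by
    rw [measurePreserving_tanh.map_eq]
    exact withDensity_absolutelyContinuous _ _⟩

/-- A property holds almost everywhere on `(-1,1)` if it holds at `tanh w` for almost all `w`. -/
theorem ae_of_ae_tanh {p : ℝ → Prop} (h : ∀ᵐ w : ℝ, p (Real.tanh w)) :
    ∀ᵐ x ∂volume.restrict (Ioo (-1 : ℝ) 1), p x := by
  have h1 : ∀ᵐ x ∂tildeMeasure, p x := by
    rw [← measurePreserving_tanh.map_eq, measurableEmbedding_tanh.ae_map_iff]
    exact h
  rw [tildeMeasure, ae_withDensity_iff (by fun_prop)] at h1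
  filter_upwards [h1, ae_restrict_mem measurableSet_Ioo] with x h2 h3
  refine h2 ?_
  rw [ne_eq, ENNReal.ofReal_eq_zero, not_le]
  have : 0 < 1 - x ^ 2 := by nlinarith [h3.1, h3.2]
  positivity

theorem integral_Ioo_eq_integral_line (F : ℝ → ℂ) :
    ∫ x in Ioo (-1 : ℝ) 1, F x = ∫ w, ((1 - Real.tanh w ^ 2 : ℝ) : ℂ) * F (Real.tanh w) := by
  rw [measurePreserving_tanh.integral_comp measurableEmbedding_tanh
    (fun x => ((1 - x ^ 2 : ℝ) : ℂ) * F x), integral_tildeMeasure]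
  refine setIntegral_congr_fun measurableSet_Ioo fun x hx => ?_
  have h : (1 - x ^ 2 : ℝ) ≠ 0 := by nlinarith [hx.1, hx.2]
  change F x = (1 / (1 - x ^ 2)) • (((1 - x ^ 2 : ℝ) : ℂ) * F x)
  rw [Complex.real_smul, ← mul_assoc, ← Complex.ofReal_mul, one_div_mul_cancel h,
    Complex.ofReal_one, one_mul]

/-- The assumptions on the potential `V`. -/
structure IsPotential (V : ℝ → ℝ) (M : ℝ) : Prop where
  aemeasurable : AEMeasurable V (volume.restrict (Ioo (-1) 1))
  nonneg : ∀ᵐ x ∂volume.restrict (Ioo (-1 : ℝ) 1), 0 ≤ V x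
  mul_le : ∀ᵐ x ∂volume.restrict (Ioo (-1 : ℝ) 1), (1 - x ^ 2) * V x ≤ M

namespace IsPotential

variable {V : ℝ → ℝ} {M : ℝ}

theorem lineV_nonneg (h : IsPotential V M) : ∀ᵐ w, 0 ≤ lineV V w := by
  filter_upwards [quasiMeasurePreserving_tanh.ae h.nonneg] with w h1
  exact mul_nonneg (one_sub_tanh_sq_pos w).le h1

theorem lineV_le (h : IsPotential V M) : ∀ᵐ w, lineV V w ≤ M :=
  quasiMeasurePreserving_tanh.ae h.mul_le

theorem bound_nonneg (h : IsPotential V M) : 0 ≤ M := by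
  obtain ⟨w, h1, h2⟩ := (h.lineV_nonneg.and h.lineV_le).exists
  exact h1.trans h2

theorem aemeasurable_lineV (h : IsPotential V M) : AEMeasurable (lineV V) :=
  ((measurable_const.sub (measurable_tanh.pow_const 2)).aemeasurable).mul
    (h.aemeasurable.comp_quasiMeasurePreserving quasiMeasurePreserving_tanh)

theorem memLp_lineV (h : IsPotential V M) :
    MemLp (fun w => (lineV V w : ℂ)) ∞ volume := by
  refine memLp_top_of_bound
    (Complex.measurable_ofReal.comp_aemeasurable h.aemeasurable_lineV).aestronglyMeasurable M ?_
  filter_upwards [h.lineV_nonneg, h.lineV_le] with w h1 h2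
  rwa [Complex.norm_real, Real.norm_of_nonneg h1]

/-- Multiplication by the potential, on the Fourier side. -/
def op (h : IsPotential V M) : L2R →L[ℂ] L2R :=
  ((Lp.fourierTransformₗᵢ ℝ ℂ).toContinuousLinearEquiv : L2R →L[ℂ] L2R) ∘L
    mulOp _ h.memLp_lineV ∘L
      ((Lp.fourierTransformₗᵢ ℝ ℂ).symm.toContinuousLinearEquiv : L2R →L[ℂ] L2R)

theorem op_apply (h : IsPotential V M) (F : L2R) :
    h.op F = 𝓕 (mulOp _ h.memLp_lineV (𝓕⁻ F)) := rfl

theorem inner_fourier_right (F G : L2R) : inner ℂ F (𝓕 G : L2R) = inner ℂ (𝓕⁻ F : L2R) G := by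
  rw [← Lp.inner_fourier_eq (𝓕⁻ F : L2R) G, FourierTransform.fourier_fourierInv_eq]

theorem inner_op (h : IsPotential V M) (F G : L2R) :
    inner ℂ F (h.op G) = inner ℂ (𝓕⁻ F : L2R) (mulOp _ h.memLp_lineV (𝓕⁻ G)) := by
  rw [op_apply, inner_fourier_right]

theorem isBoundedPotential_op (h : IsPotential V M) : IsBoundedPotential h.op M := by
  have hre : ∀ F : L2R, (inner ℂ F (h.op F)).re = ∫ w, lineV V w * ‖(𝓕⁻ F : L2R) w‖ ^ 2 := by
    intro F
    rw [h.inner_op, inner_L2R]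
    have : ∫ w, (mulOp _ h.memLp_lineV (𝓕⁻ F) : L2R) w * conj ((𝓕⁻ F : L2R) w) =
        ∫ w, ((lineV V w * ‖(𝓕⁻ F : L2R) w‖ ^ 2 : ℝ) : ℂ) := by
      refine integral_congr_ae ?_
      filter_upwards [coeFn_mulOp h.memLp_lineV (𝓕⁻ F)] with w h1
      rw [h1, mul_assoc, Complex.mul_conj, Complex.normSq_eq_norm_sq, Complex.ofReal_mul]
    rw [this, integral_complex_ofReal, Complex.ofReal_re]
  refine ⟨?_, fun F => ?_, fun F => ?_, h.bound_nonneg⟩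
  · refine ContinuousLinearMap.isSelfAdjoint_iff_isSymmetric.2 fun F G => ?_
    change inner ℂ (h.op F) G = inner ℂ F (h.op G)
    rw [h.inner_op, ← inner_conj_symm, h.inner_op, inner_conj_symm,
      inner_mulOp_left _ (ae_of_all _ fun _ => Complex.conj_ofReal _)]
  · rw [hre]
    refine integral_nonneg_of_ae ?_
    filter_upwards [h.lineV_nonneg] with w h1
    positivity
  · rw [hre, op_apply, Lp.norm_fourier_eq, norm_sq_L2R, ← integral_const_mul]
    refine integral_mono_ae (integrable_norm_sq_L2R _) ?_ ?_
    · refine Integrable.const_mul ?_ M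
      have h1 := integrable_norm_sq_L2R (𝓕⁻ F : L2R)
      refine (h1.const_mul M).mono' (h.aemeasurable_lineV.aestronglyMeasurable.mul
        h1.aestronglyMeasurable) ?_
      filter_upwards [h.lineV_nonneg, h.lineV_le] with w h2 h3
      rw [Real.norm_of_nonneg (by positivity)]
      gcongr
    · filter_upwards [coeFn_mulOp h.memLp_lineV (𝓕⁻ F), h.lineV_nonneg, h.lineV_le] with w h1 h2 h3
      simp only [h1, norm_mul, mul_pow, Complex.norm_real, Real.norm_of_nonneg h2]
      have : lineV V w ^ 2 ≤ M * lineV V w := by nlinarith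
      calc lineV V w ^ 2 * ‖(𝓕⁻ F : L2R) w‖ ^ 2 ≤ M * lineV V w * ‖(𝓕⁻ F : L2R) w‖ ^ 2 := by gcongr
        _ = _ := by ring

theorem integral_potential (h : IsPotential V M) (u g : LTilde2) :
    ∫ x in Ioo (-1 : ℝ) 1, (V x : ℂ) * u x * conj (g x) = inner ℂ (hat g) (h.op (hat u)) := by
  rw [h.inner_op, fourierInv_hat, fourierInv_hat, inner_L2R, integral_Ioo_eq_integral_line]
  refine integral_congr_ae ?_
  filter_upwards [coeFn_mulOp h.memLp_lineV (toLine u), toLine_ae_eq u, toLine_ae_eq g]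
    with w h1 h2 h3
  rw [h1, h2, h3, lineV]
  push_cast
  ring

theorem form_eq (h : IsPotential V M) (u g : LTilde2) :
    form V u g = inner ℂ (hat g) (h.op (hat u)) +
      ∫ η, (symb η : ℂ) * hat u η * conj (hat g η) := by
  rw [form, h.integral_potential]
  congr 1
  have e : (fun ξ : ℝ => ((ξ * (Real.cosh (Real.pi * ξ) / Real.sinh (Real.pi * ξ)) : ℝ) : ℂ) *
      pTransform u ξ * conj (pTransform g ξ)) = fun ξ =>
        (fun η => (symb η : ℂ) * hat u η * conj (hat g η)) (ξ / Real.pi) := by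
    ext ξ
    simp only [symb, pTransform_eq_hat, mul_div_cancel₀ _ Real.pi_pos.ne']
  rw [e, Measure.integral_comp_div
    (fun η => (symb η : ℂ) * hat u η * conj (hat g η)), abs_of_pos Real.pi_pos, Complex.real_smul, ← mul_assoc]
  have : (Real.pi : ℂ) ≠ 0 := by exact_mod_cast Real.pi_pos.ne'
  field_simp

/-- The equation `a û + Ŵ û = d^t φ` gives `[u, g] = (φ, d^t ĝ)` for all `g ∈ H̃ᵗ`. -/
theorem form_eq_of_ae_eq (h : IsPotential V M) {t : ℝ} {u : LTilde2} {φ : L2R}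
    (hu : ∀ᵐ η, symb η * hat u η = ((wt η ^ t : ℝ) : ℂ) * φ η - (h.op (hat u)) η)
    (g : HTilde t) : form V u g.val = ∫ η, φ η * conj (whtd t g.val η) := by
  have hi1 : Integrable fun η => φ η * conj (whtd t g.val η) := by
    have := L2.integrable_inner (𝕜 := ℂ) g.whtdLp φ
    refine (integrable_congr ?_).1 this
    filter_upwards [g.coeFn_whtdLp] with η h1
    rw [RCLike.inner_apply, h1]
  have hi2 : Integrable fun η => (h.op (hat u)) η * conj (hat g.val η) := by
    simpa [RCLike.inner_apply] using L2.integrable_inner (𝕜 := ℂ) (hat g.val) (h.op (hat u))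
  rw [h.form_eq, inner_L2R, ← eq_sub_iff_add_eq', ← integral_sub hi1 hi2]
  refine integral_congr_ae ?_
  filter_upwards [hu] with η h1
  rw [h1, whtd, map_mul, Complex.conj_ofReal]
  ring

/-- Very weak solutions are unique. -/
theorem eq_of_form_eq (h : IsPotential V M) {u v : LTilde2}
    (huv : ∀ g : HTilde 1, form V u g.val = form V v g.val) : u = v := by
  have hG := isEllipticSymbol_symb.memLp_div (p := fun _ => 1) measurable_const
    (fun x => by rw [abs_one]; exact one_le_wt x)
  set G := mulOp _ hG with hGdef
  have hpos := isEllipticSymbol_symb.pos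
  have hform : ∀ (w : LTilde2) (ψ : L2R) (g : HTilde 1), hat g.val = G ψ →
      form V w g.val = inner ℂ ψ (hat w + G (h.op (hat w))) := by
    intro w ψ g hg
    rw [h.form_eq, hg, inner_add_right, add_comm, inner_L2R ψ (hat w),
      inner_mulOp_left hG (ae_of_all _ fun _ => Complex.conj_ofReal _)]
    congr 1
    refine integral_congr_ae ?_
    filter_upwards [coeFn_mulOp hG ψ, hpos] with η h1 h2
    rw [h1, map_mul, Complex.conj_ofReal]
    have : (symb η : ℂ) ≠ 0 := by exact_mod_cast h2.ne'
    push_cast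
    field_simp
  have h1 : ∀ ψ : L2R, inner ℂ ψ (hat u + G (h.op (hat u))) =
      inner ℂ ψ (hat v + G (h.op (hat v))) := by
    intro ψ
    have hmem : MemLp (fun η => ((wt η ^ (1 : ℝ) : ℝ) : ℂ) * G ψ η) 2 volume := by
      have hQ := isEllipticSymbol_symb.memLp_div (p := wt) continuous_wt.measurable
        (fun x => by rw [abs_of_pos (wt_pos x)])
      refine (memLp_congr_ae ?_).1 (Lp.memLp (mulOp _ hQ ψ))
      filter_upwards [coeFn_mulOp hG ψ, coeFn_mulOp hQ ψ] with η h1 h2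
      rw [h1, h2, Real.rpow_one]
      push_cast
      ring
    obtain ⟨g, hg⟩ := exists_hTilde hmem
    rw [← hform u ψ g hg, ← hform v ψ g hg, huv]
  have h2 : hat u + G (h.op (hat u)) = hat v + G (h.op (hat v)) := ext_inner_left ℂ h1
  have h3 : hat u - hat v = 0 := by
    refine isEllipticSymbol_symb.eq_zero h.isBoundedPotential_op ?_
    have e : hat u - hat v = G (-(h.op (hat u - hat v))) := by
      rw [map_neg, map_sub, map_sub]
      have := sub_eq_zero.2 h2
      rw [← sub_eq_zero, ← this]
      abel
    have h4 := coeFn_mulOp hG (-(h.op (hat u - hat v)))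
    rw [← hGdef, ← e] at h4
    filter_upwards [h4, hpos, Lp.coeFn_neg (h.op (hat u - hat v))] with η g1 g2 g3
    have : (symb η : ℂ) ≠ 0 := by exact_mod_cast g2.ne'
    rw [g1, g3, Pi.neg_apply]
    push_cast
    field_simp
  exact hat_injective (sub_eq_zero.1 h3)

/-- For every `f ∈ (H̃^{1-s})*` there is `u ∈ H̃ˢ` with `[u, g] = (f, g)` for all `g ∈ H̃^{1-s}`. -/
theorem exists_hTilde_solution (h : IsPotential V M) {s : ℝ} (hs0 : 0 ≤ s) (hs1 : s ≤ 1)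
    (f : HTildeDual (1 - s)) :
    ∃ (u : HTilde s) (φ : L2R),
      (∀ᵐ η, symb η * hat u.val η = ((wt η ^ (1 - s) : ℝ) : ℂ) * φ η - (h.op (hat u.val)) η) ∧
      (∀ g : HTilde (1 - s), f g = ∫ η, φ η * conj (whtd (1 - s) g.val η)) ∧
      ‖u‖ ≤ √(Real.pi ^ 2 * (2 + Real.pi / 2 * M)) * ‖f‖ := by
  obtain ⟨φ, hφ, hφf⟩ := exists_riesz (sub_nonneg.2 hs1) f
  obtain ⟨F, hF, hFn⟩ := isEllipticSymbol_symb.exists_solution h.isBoundedPotential_op hs0 hs1 φ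
  have hmem : MemLp (fun η => ((wt η ^ s : ℝ) : ℂ) * F η) 2 volume :=
    ⟨(Complex.measurable_ofReal.comp
      (continuous_wt.measurable.pow_const s)).aestronglyMeasurable.mul (Lp.aestronglyMeasurable _),
      hFn.trans_lt ENNReal.ofReal_lt_top⟩
  obtain ⟨u, rfl⟩ := exists_hTilde hmem
  refine ⟨u, φ, hF, hφf, ?_⟩
  rw [← u.norm_whtdLp, Lp.norm_def, eLpNorm_congr_ae u.coeFn_whtdLp]
  refine (ENNReal.toReal_mono ENNReal.ofReal_ne_top hFn).trans ?_
  rw [ENNReal.toReal_ofReal (by positivity)]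
  gcongr

end IsPotential

/-! ### Pointwise inversion of the Fourier transform -/

/-- The character `e^{2πix}`. -/
def ker (x : ℝ) : ℂ := Complex.exp (((2 * Real.pi * x : ℝ) : ℂ) * Complex.I)

theorem norm_ker (x : ℝ) : ‖ker x‖ = 1 := Complex.norm_exp_ofReal_mul_I _

theorem continuous_ker : Continuous ker := by unfold ker; fun_prop

theorem ker_add (x y : ℝ) : ker (x + y) = ker x * ker y := by
  rw [ker, ker, ker, ← Complex.exp_add]
  congr 1
  push_cast
  ring

theorem conj_ker (x : ℝ) : conj (ker x) = ker (-x) := by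
  rw [ker, ker, ← Complex.exp_conj, map_mul, Complex.conj_ofReal, Complex.conj_I]
  congr 1
  push_cast
  ring

theorem hasDerivAt_ker_mul (η w : ℝ) :
    HasDerivAt (fun w : ℝ => ker (η * w)) (((2 * Real.pi * η : ℝ) : ℂ) * Complex.I * ker (η * w)) w := by
  have h1 : HasDerivAt (fun w : ℝ => ((2 * Real.pi * (η * w) : ℝ) : ℂ) * Complex.I)
      (((2 * Real.pi * η : ℝ) : ℂ) * Complex.I) w := by
    have h2 : HasDerivAt (fun w : ℝ => 2 * Real.pi * (η * w)) (2 * Real.pi * (η * 1)) w :=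
      ((hasDerivAt_id w).const_mul η).const_mul _
    rw [mul_one] at h2
    have h3 := h2.ofReal_comp.mul_const Complex.I
    rwa [mul_assoc] at h3 ⊢
  have h2 := h1.cexp
  rw [mul_comm]
  exact h2

theorem two_pi_mul_integral_ker (η a b : ℝ) :
    ((2 * Real.pi * η : ℝ) : ℂ) * Complex.I * ∫ w in a..b, ker (η * w) =
      ker (η * b) - ker (η * a) := by
  rw [← intervalIntegral.integral_const_mul]
  exact intervalIntegral.integral_eq_sub_of_hasDerivAt (fun w _ => hasDerivAt_ker_mul η w)
    ((continuous_const.mul (continuous_ker.comp (by fun_prop))).intervalIntegrable _ _)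

theorem locallyIntegrable_L2R (F : L2R) : LocallyIntegrable F volume :=
  (Lp.memLp F).locallyIntegrable (by norm_num)

theorem intervalIntegrable_L2R (F : L2R) (a b : ℝ) : IntervalIntegrable F volume a b :=
  intervalIntegrable_iff.2 (((locallyIntegrable_L2R F).integrableOn_isCompact
    isCompact_uIcc).mono_set uIoc_subset_uIcc)

theorem integral_fourierInv_L2R_of_le (F : L2R) {a b : ℝ} (hab : a ≤ b) :
    ∫ w in a..b, (𝓕⁻ F : L2R) w = ∫ η, F η * ∫ w in a..b, ker (η * w) := by
  have hfin : volume (Ioc a b) ≠ (⊤ : ℝ≥0∞) := by simp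
  set χ : L2R := indicatorConstLp 2 measurableSet_Ioc hfin (1 : ℂ) with hχ
  have hχae : χ =ᵐ[volume] (Ioc a b).indicator fun _ => (1 : ℂ) := indicatorConstLp_coeFn
  have hχint : Integrable χ :=
    (integrable_congr hχae).2 ((integrable_indicator_iff measurableSet_Ioc).2 (by simp))
  have h1 : inner ℂ χ (𝓕⁻ F : L2R) = ∫ w in a..b, (𝓕⁻ F : L2R) w := by
    rw [hχ, L2.inner_indicatorConstLp_one, intervalIntegral.integral_of_le hab]
  rw [← h1, ← Lp.inner_fourier_eq χ (𝓕⁻ F : L2R), FourierTransform.fourier_fourierInv_eq, inner_L2R]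
  refine integral_congr_ae ?_
  filter_upwards [fourier_Lp_ae_eq χ hχint] with η h2
  rw [h2, Real.fourier_eq', ← integral_conj, intervalIntegral.integral_of_le hab,
    ← integral_indicator measurableSet_Ioc]
  congr 1
  refine integral_congr_ae ?_
  filter_upwards [hχae] with w h3
  rw [h3]
  by_cases hw : w ∈ Ioc a b
  · simp only [indicator_of_mem hw, smul_eq_mul, mul_one]
    rw [← neg_neg (η * w), ← conj_ker, ker]
    congr 2
    simp only [RCLike.inner_apply, conj_trivial]
    push_cast
    ring
  · simp [indicator_of_notMem hw]

/-- Plancherel's theorem against the indicator function of an interval. -/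
theorem integral_fourierInv_L2R (F : L2R) (a b : ℝ) :
    ∫ w in a..b, (𝓕⁻ F : L2R) w = ∫ η, F η * ∫ w in a..b, ker (η * w) := by
  rcases le_total a b with h | h
  · exact integral_fourierInv_L2R_of_le F h
  · rw [intervalIntegral.integral_symm, integral_fourierInv_L2R_of_le F h, ← integral_neg]
    refine integral_congr_ae (ae_of_all _ fun η => ?_)
    simp only
    rw [intervalIntegral.integral_symm a b, mul_neg, neg_neg]

/-- The inverse Fourier integral of an integrable function. -/
def invFourier (F : ℝ → ℂ) (w : ℝ) : ℂ := ∫ η, F η * ker (η * w)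

theorem integrable_mul_ker {F : ℝ → ℂ} (hF : Integrable F) (w : ℝ) :
    Integrable fun η => F η * ker (η * w) := by
  refine hF.mul_bdd (c := 1) (continuous_ker.comp (by fun_prop)).aestronglyMeasurable
    (ae_of_all _ fun η => (norm_ker _).le)

theorem continuous_invFourier {F : ℝ → ℂ} (hF : Integrable F) : Continuous (invFourier F) := by
  refine continuous_of_dominated (bound := fun η => ‖F η‖)
    (fun w => (integrable_mul_ker hF w).aestronglyMeasurable)
    (fun w => ae_of_all _ fun η => ?_) hF.norm (ae_of_all _ fun η => ?_)
  · rw [norm_mul, norm_ker, mul_one]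
  · exact continuous_const.mul (continuous_ker.comp (by fun_prop))

theorem invFourier_eq_fourier (F : ℝ → ℂ) (w : ℝ) : invFourier F w = 𝓕 F (-w) := by
  rw [invFourier, Real.fourier_eq']
  refine integral_congr_ae (ae_of_all _ fun η => ?_)
  simp only [RCLike.inner_apply, conj_trivial, smul_eq_mul, ker]
  rw [mul_comm]
  congr 3
  push_cast
  ring

theorem tendsto_invFourier_atTop (F : ℝ → ℂ) : Tendsto (invFourier F) atTop (𝓝 0) := by
  have h := (Real.zero_at_infty_fourier F).mono_left (atBot_le_cocompact)
  exact (h.comp tendsto_neg_atTop_atBot).congr fun w => (invFourier_eq_fourier F w).symm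

theorem tendsto_invFourier_atBot (F : ℝ → ℂ) : Tendsto (invFourier F) atBot (𝓝 0) := by
  have h := (Real.zero_at_infty_fourier F).mono_left (atTop_le_cocompact)
  exact (h.comp tendsto_neg_atBot_atTop).congr fun w => (invFourier_eq_fourier F w).symm

theorem integral_invFourier {F : ℝ → ℂ} (hF : Integrable F) (a b : ℝ) :
    ∫ w in a..b, invFourier F w = ∫ η, F η * ∫ w in a..b, ker (η * w) := by
  simp only [invFourier, ← intervalIntegral.integral_const_mul]
  refine intervalIntegral_integral_swap ?_
  have : IsFiniteMeasure (volume.restrict (uIoc a b)) := ⟨by simp [uIoc]⟩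
  have h1 : Integrable (fun p : ℝ × ℝ => F p.2)
      ((volume.restrict (uIoc a b)).prod (volume : Measure ℝ)) := hF.comp_snd _
  refine h1.mul_bdd (c := 1) (continuous_ker.comp (by fun_prop)).aestronglyMeasurable
    (ae_of_all _ fun η => (norm_ker _).le)

/-- The `L₂`-transform is the Fourier integral for integrable `F`: both have the same primitives. -/
theorem fourierInv_ae_eq (F : L2R) (hF : Integrable F) :
    (𝓕⁻ F : L2R) =ᵐ[volume] invFourier F := by
  filter_upwards [_root_.LocallyIntegrable.ae_hasDerivAt_integral
    (locallyIntegrable_L2R (𝓕⁻ F : L2R))] with w h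
  have h1 := h 0
  have h2 : HasDerivAt (fun x => ∫ t in (0 : ℝ)..x, invFourier F t) (invFourier F w) w :=
    (continuous_invFourier hF).integral_hasStrictDerivAt 0 w |>.hasDerivAt
  refine h1.unique (h2.congr_of_eventuallyEq (Eventually.of_forall fun x => ?_))
  simp only
  rw [integral_fourierInv_L2R, integral_invFourier hF]

/-! ### Functions in `H̃¹` on the line -/

theorem integrable_wt_neg_sq : Integrable fun η => wt η ^ (-2 : ℝ) := by
  have h : (fun η => wt η ^ (-2 : ℝ)) = fun η => (1 + ((2 * Real.pi) * η) ^ 2)⁻¹ := by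
    ext η
    rw [wt_rpow]
    have : (-2 / 2 : ℝ) = -1 := by norm_num
    rw [this, Real.rpow_neg_one]
    ring_nf
  rw [h]
  exact (integrable_comp_mul_left_iff (fun x : ℝ => (1 + x ^ 2)⁻¹)
    (by positivity)).2 integrable_inv_one_add_sq

theorem integrable_of_memLp_wt_mul {F : L2R}
    (hF : MemLp (fun η => (wt η : ℂ) * F η) 2 volume) : Integrable F := by
  have h1 : MemLp (fun η => (((wt η)⁻¹ : ℝ) : ℂ)) 2 volume := by
    rw [memLp_two_iff_integrable_sq_norm]
    · refine integrable_wt_neg_sq.congr (ae_of_all _ fun η => ?_)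
      simp only
      rw [Complex.norm_real, Real.norm_of_nonneg (inv_nonneg.2 (wt_pos η).le),
        Real.rpow_neg (wt_pos η).le, inv_pow]
      norm_num
    · exact (Complex.measurable_ofReal.comp continuous_wt.measurable.inv).aestronglyMeasurable
  refine (h1.integrable_mul hF).congr (ae_of_all _ fun η => ?_)
  have : (wt η : ℂ) ≠ 0 := by exact_mod_cast (wt_pos η).ne'
  simp only [Pi.mul_apply]
  push_cast
  field_simp

/-- Multipliers of the size `O(wt)` act from `H̃¹` to `L₂`. -/
theorem memLp_mul_of_norm_le_wt {F : L2R} (hF : MemLp (fun η => (wt η : ℂ) * F η) 2 volume)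
    {m : ℝ → ℂ} (hm : Measurable m) {C : ℝ} (hC : ∀ η, ‖m η‖ ≤ C * wt η) :
    MemLp (fun η => m η * F η) 2 volume := by
  refine MemLp.of_le_mul (c := C) hF (hm.aestronglyMeasurable.mul (Lp.aestronglyMeasurable _))
    (ae_of_all _ fun η => ?_)
  rw [norm_mul, norm_mul, Complex.norm_real, Real.norm_of_nonneg (wt_pos η).le, ← mul_assoc]
  gcongr
  exact hC η

theorem norm_two_pi_mul_le (η : ℝ) : ‖((2 * Real.pi * η : ℝ) : ℂ) * Complex.I‖ ≤ 1 * wt η := by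
  rw [norm_mul, Complex.norm_I, mul_one, Complex.norm_real, one_mul, Real.norm_eq_abs, wt]
  refine Real.abs_le_sqrt ?_
  nlinarith [sq_nonneg (Real.pi * η)]

/-- The derivative `𝓕⁻(2πiη F)` of the inverse Fourier transform of `F`. -/
theorem exists_deriv_invFourier {F : L2R} (hF : MemLp (fun η => (wt η : ℂ) * F η) 2 volume) :
    ∃ g : L2R, ∀ a b, ∫ w in a..b, g w = invFourier F b - invFourier F a := by
  have hG : MemLp (fun η => ((2 * Real.pi * η : ℝ) : ℂ) * Complex.I * F η) 2 volume :=
    memLp_mul_of_norm_le_wt hF (m := fun η => ((2 * Real.pi * η : ℝ) : ℂ) * Complex.I)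
      (by fun_prop) norm_two_pi_mul_le
  have hi := integrable_of_memLp_wt_mul hF
  refine ⟨𝓕⁻ (hG.toLp), fun a b => ?_⟩
  rw [integral_fourierInv_L2R, invFourier, invFourier,
    ← integral_sub (integrable_mul_ker hi b) (integrable_mul_ker hi a)]
  refine integral_congr_ae ?_
  filter_upwards [hG.coeFn_toLp] with η h
  rw [h, ← mul_sub, ← two_pi_mul_integral_ker]
  ring

/-! ### The Lévy–Khintchine formula for the symbol -/

theorem integrableOn_one_sub_cos_mul_exp (b : ℝ) {c : ℝ} (hc : 0 < c) :
    IntegrableOn (fun s => (1 - Real.cos (b * s)) * Real.exp (-c * s)) (Ioi 0) := by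
  have h1 := integrableOn_exp_mul_Ioi (neg_lt_zero.2 hc) 0
  refine h1.bdd_mul (c := 2) (by fun_prop) (ae_of_all _ fun s => ?_)
  rw [Real.norm_eq_abs, abs_le]
  constructor <;> linarith [Real.cos_le_one (b * s), Real.neg_one_le_cos (b * s)]

theorem integral_one_sub_cos_mul_exp (b : ℝ) {c : ℝ} (hc : 0 < c) :
    ∫ s in Ioi 0, (1 - Real.cos (b * s)) * Real.exp (-c * s) = b ^ 2 / (c * (c ^ 2 + b ^ 2)) := by
  have hre : ((-c : ℂ) + b * Complex.I).re < 0 := by simp [hc]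
  have h1 := integrableOn_exp_mul_Ioi (neg_lt_zero.2 hc) 0
  have h2 := integrableOn_exp_mul_complex_Ioi hre 0
  have h3 := integral_exp_mul_complex_Ioi hre 0
  have h4 : ∫ s in Ioi (0 : ℝ), Real.cos (b * s) * Real.exp (-c * s) = c / (c ^ 2 + b ^ 2) := by
    have h5 := integral_re h2
    rw [h3] at h5
    have h6 : ∀ s : ℝ, RCLike.re (Complex.exp (((-c : ℂ) + b * Complex.I) * s)) =
        Real.cos (b * s) * Real.exp (-c * s) := by
      intro s
      change (Complex.exp _).re = _
      rw [Complex.exp_re]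
      simp [mul_comm]
    simp only [h6] at h5
    rw [h5]
    change (-Complex.exp (((-c : ℂ) + b * Complex.I) * (0 : ℝ)) / ((-c : ℂ) + b * Complex.I)).re = _
    rw [Complex.ofReal_zero, mul_zero, Complex.exp_zero, Complex.div_re]
    simp [Complex.normSq_apply]
    ring
  have h7 : IntegrableOn (fun s : ℝ => Real.cos (b * s) * Real.exp (-c * s)) (Ioi 0) := by
    refine h1.bdd_mul (c := 1) (by fun_prop) (ae_of_all _ fun s => ?_)
    rw [Real.norm_eq_abs]
    exact Real.abs_cos_le_one _
  simp only [sub_mul, one_mul]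
  rw [integral_sub h1 h7, h4, integral_exp_mul_Ioi (neg_lt_zero.2 hc)]
  have : c ^ 2 + b ^ 2 ≠ 0 := by positivity
  simp
  field_simp
  ring

theorem hasSum_inv_sinh_sq {s : ℝ} (hs : 0 < s) :
    HasSum (fun n : ℕ => 4 * ((n : ℝ) + 1) * Real.exp (-(2 * ((n : ℝ) + 1)) * s))
      (1 / Real.sinh s ^ 2) := by
  have hr : ‖Real.exp (-2 * s)‖ < 1 := by
    rw [Real.norm_of_nonneg (Real.exp_pos _).le, Real.exp_lt_one_iff]
    linarith
  have h := hasSum_coe_mul_geometric_of_norm_lt_one hr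
  have h1 := (hasSum_nat_add_iff' 1).2 h
  have h2 := h1.mul_left 4
  simp only [Finset.range_one, Finset.sum_singleton, Nat.cast_zero, zero_mul, sub_zero] at h2
  have hterm : (fun n : ℕ => 4 * ((n : ℝ) + 1) * Real.exp (-(2 * ((n : ℝ) + 1)) * s)) =
      fun n : ℕ => 4 * (((n + 1 : ℕ) : ℝ) * Real.exp (-2 * s) ^ (n + 1)) := by
    ext n
    rw [← Real.exp_nat_mul]
    push_cast
    ring_nf
  have hval : 1 / Real.sinh s ^ 2 = 4 * (Real.exp (-2 * s) / (1 - Real.exp (-2 * s)) ^ 2) := by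
    have e1 : Real.exp (-2 * s) = Real.exp (-s) ^ 2 := by
      rw [← Real.exp_nat_mul]; ring_nf
    have e2 : Real.exp s = (Real.exp (-s))⁻¹ := by rw [Real.exp_neg, inv_inv]
    have e3 := Real.exp_pos (-s)
    have e4 : 1 - Real.exp (-s) ^ 2 ≠ 0 := by
      rw [← e1]
      rw [Real.norm_of_nonneg (Real.exp_pos _).le] at hr
      linarith
    rw [Real.sinh_eq, e1, e2]
    have e5 : (Real.exp (-s))⁻¹ - Real.exp (-s) ≠ 0 := by
      intro h0
      apply e4
      field_simp at h0
      linarith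
    field_simp
    norm_num
  rw [hterm, hval]
  exact h2

/-- The partial fractions of the hyperbolic cotangent. -/
theorem hasSum_mul_coth {ξ : ℝ} (hξ : ξ ≠ 0) :
    HasSum (fun n : ℕ => 2 * ξ ^ 2 / (((n : ℝ) + 1) ^ 2 + ξ ^ 2))
      (Real.pi * ξ * (Real.cosh (Real.pi * ξ) / Real.sinh (Real.pi * ξ)) - 1) := by
  have hξ' : (ξ : ℂ) ≠ 0 := by exact_mod_cast hξ
  have hmem : (ξ * Complex.I : ℂ) ∈ Complex.integerComplement := by
    rintro ⟨n, hn⟩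
    have := congrArg Complex.im hn
    simp at this
    exact hξ this.symm
  have h1 : HasSum (fun n : ℕ => cotTerm (ξ * Complex.I) n)
      (Real.pi * Complex.cot (Real.pi * (ξ * Complex.I)) - 1 / (ξ * Complex.I)) := by
    have h2 := (summable_cotTerm hmem).hasSum
    rwa [cot_series_rep' hmem]
  have h2 := h1.mul_left (ξ * Complex.I)
  rw [← Complex.hasSum_ofReal]
  have hterm : (fun n : ℕ => ((2 * ξ ^ 2 / (((n : ℝ) + 1) ^ 2 + ξ ^ 2) : ℝ) : ℂ)) =
      fun n : ℕ => ξ * Complex.I * cotTerm (ξ * Complex.I) n := by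
    ext n
    have e1 : ((n : ℂ) + 1) ^ 2 + ξ ^ 2 ≠ 0 := by
      have : ((n : ℝ) + 1) ^ 2 + ξ ^ 2 ≠ 0 := by positivity
      exact_mod_cast this
    rw [cotTerm_identity hmem]
    have e2 : (ξ * Complex.I + (n + 1)) * (ξ * Complex.I - (n + 1)) =
        -(((n : ℂ) + 1) ^ 2 + ξ ^ 2) := by
      linear_combination (ξ : ℂ) ^ 2 * Complex.I_sq
    rw [e2]
    push_cast
    field_simp
    rw [Complex.I_sq]
    ring
  have hval : ((Real.pi * ξ * (Real.cosh (Real.pi * ξ) / Real.sinh (Real.pi * ξ)) - 1 : ℝ) : ℂ) =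
      ξ * Complex.I * (Real.pi * Complex.cot (Real.pi * (ξ * Complex.I)) - 1 / (ξ * Complex.I)) := by
    have e1 : (Real.pi : ℂ) * (ξ * Complex.I) = (Real.pi * ξ) * Complex.I := by ring
    have e2 : Complex.sinh (Real.pi * ξ) ≠ 0 := by
      have : Real.sinh (Real.pi * ξ) ≠ 0 :=
        Real.sinh_ne_zero.2 (mul_ne_zero Real.pi_pos.ne' hξ)
      exact_mod_cast this
    rw [Complex.cot_eq_cos_div_sin, e1, Complex.cos_mul_I, Complex.sin_mul_I]
    push_cast
    field_simp
  rw [hterm, hval]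
  exact h2

theorem integral_one_sub_cos_div_sinh_sq {ξ : ℝ} (hξ : ξ ≠ 0) :
    ∫ s in Ioi 0, (1 - Real.cos (2 * ξ * s)) / Real.sinh s ^ 2 =
      Real.pi * ξ * (Real.cosh (Real.pi * ξ) / Real.sinh (Real.pi * ξ)) - 1 := by
  set F : ℕ → ℝ → ℝ := fun n s => 4 * ((n : ℝ) + 1) *
    ((1 - Real.cos (2 * ξ * s)) * Real.exp (-(2 * ((n : ℝ) + 1)) * s)) with hF
  have hFi : ∀ n, IntegrableOn (F n) (Ioi 0) := fun n =>
    (integrableOn_one_sub_cos_mul_exp (2 * ξ) (by positivity)).const_mul _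
  have hFint : ∀ n, ∫ s in Ioi 0, F n s = 2 * ξ ^ 2 / (((n : ℝ) + 1) ^ 2 + ξ ^ 2) := by
    intro n
    rw [hF]
    simp only
    rw [integral_const_mul, integral_one_sub_cos_mul_exp _ (by positivity)]
    have : ((n : ℝ) + 1) ^ 2 + ξ ^ 2 ≠ 0 := by positivity
    field_simp
    ring
  have hFn : ∀ n, ∫ s in Ioi 0, ‖F n s‖ = 2 * ξ ^ 2 / (((n : ℝ) + 1) ^ 2 + ξ ^ 2) := by
    intro n
    rw [← hFint]
    refine integral_congr_ae (ae_of_all _ fun s => ?_)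
    refine Real.norm_of_nonneg ?_
    have : 0 ≤ 1 - Real.cos (2 * ξ * s) := by linarith [Real.cos_le_one (2 * ξ * s)]
    positivity
  have hs := hasSum_mul_coth hξ
  have h1 := hasSum_integral_of_summable_integral_norm (μ := volume.restrict (Ioi 0)) hFi (by
    simp only [hFn]
    exact hs.summable)
  simp only [hFint] at h1
  rw [hs.unique h1]
  refine setIntegral_congr_fun measurableSet_Ioi fun s hs => ?_
  have h2 := (hasSum_inv_sinh_sq hs).mul_left (1 - Real.cos (2 * ξ * s))
  rw [← mul_one_div, ← h2.tsum_eq]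
  refine tsum_congr fun n => ?_
  simp only [hF]
  ring

theorem integrableOn_one_sub_cos_div_sinh_sq (ξ : ℝ) :
    IntegrableOn (fun s => (1 - Real.cos (2 * ξ * s)) / Real.sinh s ^ 2) (Ioi 0) := by
  rcases eq_or_ne ξ 0 with rfl | hξ
  · simp
  · refine .of_integral_ne_zero ?_
    rw [integral_one_sub_cos_div_sinh_sq hξ]
    have h := (mul_coth_sq_bounds (y := Real.pi * ξ) (mul_ne_zero Real.pi_pos.ne' hξ)).1
    intro h0
    rw [sub_eq_zero.1 h0] at h
    have : 0 < (Real.pi * ξ) ^ 2 := by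
      have := mul_ne_zero Real.pi_pos.ne' hξ
      positivity
    linarith

/-- The symbol of the operator truncated at the distance `ε` from the singularity. -/
def truncSymb (ε η : ℝ) : ℝ :=
  Real.pi⁻¹ * (1 + ∫ s in Ioi ε, (1 - Real.cos (2 * (Real.pi * η) * s)) / Real.sinh s ^ 2)

/-- The Lévy–Khintchine formula for the symbol. -/
theorem symb_eq_integral {η : ℝ} (hη : η ≠ 0) : symb η = Real.pi⁻¹ *
    (1 + ∫ s in Ioi 0, (1 - Real.cos (2 * (Real.pi * η) * s)) / Real.sinh s ^ 2) := by
  rw [integral_one_sub_cos_div_sinh_sq (mul_ne_zero Real.pi_pos.ne' hη), symb_eq]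
  ring

theorem inv_sinh_sq_le {s : ℝ} (hs : 0 < s) : 1 / Real.sinh s ^ 2 ≤ 1 / s ^ 2 := by
  have := Real.self_le_sinh_iff.2 hs.le
  gcongr

theorem integrableOn_inv_sq {ε : ℝ} (hε : 0 < ε) :
    IntegrableOn (fun s : ℝ => 1 / s ^ 2) (Ioi ε) := by
  refine (integrableOn_Ioi_rpow_of_lt (by norm_num : (-2 : ℝ) < -1) hε).congr_fun
    (fun s hs => ?_) measurableSet_Ioi
  have : 0 < s := hε.trans hs
  simp only
  rw [Real.rpow_neg this.le, one_div]
  norm_num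

theorem integral_inv_sq {ε : ℝ} (hε : 0 < ε) : ∫ s in Ioi ε, 1 / s ^ 2 = 1 / ε := by
  have h := integral_Ioi_rpow_of_lt (by norm_num : (-2 : ℝ) < -1) hε
  have e : ∫ s in Ioi ε, 1 / s ^ 2 = ∫ s in Ioi ε, s ^ (-2 : ℝ) := by
    refine setIntegral_congr_fun measurableSet_Ioi fun s hs => ?_
    have : 0 < s := hε.trans hs
    rw [Real.rpow_neg this.le, one_div]
    norm_num
  rw [e, h]
  have : (-2 + 1 : ℝ) = -1 := by norm_num
  rw [this, Real.rpow_neg_one]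
  ring

theorem integrableOn_inv_sinh_sq {ε : ℝ} (hε : 0 < ε) :
    IntegrableOn (fun s => 1 / Real.sinh s ^ 2) (Ioi ε) := by
  refine (integrableOn_inv_sq hε).mono'
    (measurable_const.div (Real.measurable_sinh.pow_const 2)).aestronglyMeasurable ?_
  filter_upwards [ae_restrict_mem measurableSet_Ioi] with s hs
  rw [Real.norm_of_nonneg (by positivity)]
  exact inv_sinh_sq_le (hε.trans hs)

theorem abs_symb_sub_truncSymb_le {ε η : ℝ} (hε : 0 < ε) (hη : η ≠ 0) :
    |truncSymb ε η - symb η| ≤ wt η * (|η| * ε) := by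
  have hI := integrableOn_one_sub_cos_div_sinh_sq (Real.pi * η)
  have hsplit : ∫ s in Ioi 0, (1 - Real.cos (2 * (Real.pi * η) * s)) / Real.sinh s ^ 2 =
      (∫ s in Ioc 0 ε, (1 - Real.cos (2 * (Real.pi * η) * s)) / Real.sinh s ^ 2) +
        ∫ s in Ioi ε, (1 - Real.cos (2 * (Real.pi * η) * s)) / Real.sinh s ^ 2 := by
    rw [← setIntegral_union (Ioc_disjoint_Ioi le_rfl) measurableSet_Ioi
      (hI.mono_set Ioc_subset_Ioi_self) (hI.mono_set (Ioi_subset_Ioi hε.le)),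
      Ioc_union_Ioi_eq_Ioi hε.le]
  have hle : ‖∫ s in Ioc 0 ε, (1 - Real.cos (2 * (Real.pi * η) * s)) / Real.sinh s ^ 2‖ ≤
      2 * (Real.pi * η) ^ 2 * (volume (Ioc 0 ε)).toReal := by
    refine norm_setIntegral_le_of_norm_le_const (by simp) fun s hs => ?_
    have h1 : 0 ≤ 1 - Real.cos (2 * (Real.pi * η) * s) := by linarith [Real.cos_le_one (2 * (Real.pi * η) * s)]
    have h2 := Real.one_sub_sq_div_two_le_cos (x := 2 * (Real.pi * η) * s)
    have h3 : s ≤ Real.sinh s := Real.self_le_sinh_iff.2 hs.1.le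
    have h4 : 0 < Real.sinh s := hs.1.trans_le h3
    rw [Real.norm_of_nonneg (by positivity), div_le_iff₀ (by positivity)]
    calc 1 - Real.cos (2 * (Real.pi * η) * s) ≤ 2 * (Real.pi * η) ^ 2 * s ^ 2 := by linarith
      _ ≤ _ := by
        have := hs.1.le
        gcongr
  rw [Real.volume_Ioc, sub_zero, ENNReal.toReal_ofReal hε.le] at hle
  rw [symb_eq_integral hη, truncSymb, hsplit]
  have e : ∀ A B : ℝ, Real.pi⁻¹ * (1 + B) - Real.pi⁻¹ * (1 + (A + B)) = -(Real.pi⁻¹ * A) := by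
    intro A B; ring
  rw [e, abs_neg, abs_mul, abs_of_pos (inv_pos.2 Real.pi_pos)]
  rw [Real.norm_eq_abs] at hle
  have h5 : 2 * Real.pi * |η| ≤ wt η := by
    have := norm_two_pi_mul_le η
    rwa [norm_mul, Complex.norm_I, mul_one, Complex.norm_real, one_mul, norm_mul,
      Real.norm_of_nonneg (by positivity)] at this
  calc Real.pi⁻¹ * _ ≤ Real.pi⁻¹ * (2 * (Real.pi * η) ^ 2 * ε) := by
        gcongr
    _ = (2 * Real.pi * |η|) * (|η| * ε) := by
        have := Real.pi_pos.ne'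
        rw [mul_pow, ← sq_abs η]
        field_simp
    _ ≤ _ := by gcongr

theorem abs_truncSymb_le {ε : ℝ} (hε : 0 < ε) (hε1 : ε ≤ 1) (η : ℝ) :
    |truncSymb ε η| ≤ 3 / (Real.pi * ε) := by
  have hle : ‖∫ s in Ioi ε, (1 - Real.cos (2 * (Real.pi * η) * s)) / Real.sinh s ^ 2‖ ≤
      ∫ s in Ioi ε, 2 * (1 / s ^ 2) := by
    refine norm_integral_le_of_norm_le ((integrableOn_inv_sq hε).const_mul 2) ?_
    filter_upwards [ae_restrict_mem measurableSet_Ioi] with s hs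
    have h1 : 0 ≤ 1 - Real.cos (2 * (Real.pi * η) * s) := by
      linarith [Real.cos_le_one (2 * (Real.pi * η) * s)]
    rw [Real.norm_of_nonneg (by positivity), ← mul_one_div]
    have := inv_sinh_sq_le (hε.trans hs)
    gcongr
    linarith [Real.neg_one_le_cos (2 * (Real.pi * η) * s)]
  rw [integral_const_mul, integral_inv_sq hε, Real.norm_eq_abs] at hle
  rw [truncSymb, abs_mul, abs_of_pos (inv_pos.2 Real.pi_pos)]
  have h1 : 1 ≤ 1 / ε := by rwa [le_div_iff₀ hε, one_mul]
  calc Real.pi⁻¹ * _ ≤ Real.pi⁻¹ * (1 / ε + 2 * (1 / ε)) := by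
        gcongr
        refine (abs_add_le _ _).trans ?_
        rw [abs_one]
        linarith
    _ = _ := by
        have := Real.pi_pos.ne'
        field_simp
        ring

/-! ### Almost everywhere convergence of the truncated operators -/

/-- The Prandtl operator on the line, truncated at the distance `ε` from the singularity. -/
def truncOp (U : ℝ → ℂ) (ε w : ℝ) : ℂ :=
  1 / (2 * (Real.pi : ℂ)) * (2 * U w +
    ∫ s in Ioi ε, (2 * U w - U (w + s) - U (w - s)) / ((Real.sinh s ^ 2 : ℝ) : ℂ))

theorem two_sub_ker (x : ℝ) :
    2 - ker x - ker (-x) = ((2 * (1 - Real.cos (2 * Real.pi * x)) : ℝ) : ℂ) := by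
  have h : ker x + ker (-x) = 2 * Complex.cos ((2 * Real.pi * x : ℝ) : ℂ) := by
    rw [Complex.two_cos, ker, ker]
    congr 2
    push_cast
    ring
  push_cast at h ⊢
  linear_combination -h

theorem two_mul_invFourier_sub {F : ℝ → ℂ} (hF : Integrable F) (w s : ℝ) :
    2 * invFourier F w - invFourier F (w + s) - invFourier F (w - s) =
      ∫ η, F η * ker (η * w) * ((2 * (1 - Real.cos (2 * (Real.pi * η) * s)) : ℝ) : ℂ) := by
  rw [invFourier, invFourier, invFourier, ← integral_const_mul,
    ← integral_sub ((integrable_mul_ker hF w).const_mul 2) (integrable_mul_ker hF _),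
    ← integral_sub (f := fun η => 2 * (F η * ker (η * w)) - F η * ker (η * (w + s)))
      (((integrable_mul_ker hF w).const_mul 2).sub (integrable_mul_ker hF _))
      (integrable_mul_ker hF _)]
  refine integral_congr_ae (ae_of_all _ fun η => ?_)
  have e1 : η * (w + s) = η * w + η * s := by ring
  have e2 : η * (w - s) = η * w + -(η * s) := by ring
  have e3 : 2 * (Real.pi * η) * s = 2 * Real.pi * (η * s) := by ring
  simp only
  rw [e1, e2, e3, ker_add, ker_add, ← two_sub_ker]
  ring

/-- The truncated operator is the multiplier `truncSymb`. -/
theorem truncOp_invFourier {F : ℝ → ℂ} (hF : Integrable F) {ε : ℝ} (hε : 0 < ε) (w : ℝ) :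
    truncOp (invFourier F) ε w = ∫ η, (truncSymb ε η : ℂ) * F η * ker (η * w) := by
  have hi : Integrable (fun p : ℝ × ℝ => F p.2 * ker (p.2 * w) *
      ((2 * (1 - Real.cos (2 * (Real.pi * p.2) * p.1)) : ℝ) : ℂ) / ((Real.sinh p.1 ^ 2 : ℝ) : ℂ))
      ((volume.restrict (Ioi ε)).prod volume) := by
    have h1 : Integrable (fun p : ℝ × ℝ => ((1 / Real.sinh p.1 ^ 2 : ℝ) : ℂ) *
        (F p.2 * ker (p.2 * w))) ((volume.restrict (Ioi ε)).prod volume) :=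
      Integrable.mul_prod (f := fun s => ((1 / Real.sinh s ^ 2 : ℝ) : ℂ))
        (integrableOn_inv_sinh_sq hε).ofReal (integrable_mul_ker hF w)
    have h2 := h1.mul_bdd (c := 4)
      (g := fun p : ℝ × ℝ => ((2 * (1 - Real.cos (2 * (Real.pi * p.2) * p.1)) : ℝ) : ℂ))
      (Complex.continuous_ofReal.comp (by fun_prop)).aestronglyMeasurable
      (ae_of_all _ fun p => by
        rw [Complex.norm_real, Real.norm_eq_abs, abs_le]
        constructor <;> linarith [Real.cos_le_one (2 * (Real.pi * p.2) * p.1),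
          Real.neg_one_le_cos (2 * (Real.pi * p.2) * p.1)])
    refine h2.congr (ae_of_all _ fun p => ?_)
    simp only
    push_cast
    ring
  have h1 : ∫ s in Ioi ε, (2 * invFourier F w - invFourier F (w + s) - invFourier F (w - s)) /
      ((Real.sinh s ^ 2 : ℝ) : ℂ) = ∫ η, F η * ker (η * w) *
        ((2 * ∫ s in Ioi ε, (1 - Real.cos (2 * (Real.pi * η) * s)) / Real.sinh s ^ 2 : ℝ) : ℂ) := by
    simp only [two_mul_invFourier_sub hF, ← integral_div]
    rw [integral_integral_swap hi]
    refine integral_congr_ae (ae_of_all _ fun η => ?_)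
    simp only
    rw [← integral_const_mul, ← integral_complex_ofReal, ← integral_const_mul]
    refine integral_congr_ae (ae_of_all _ fun s => ?_)
    simp only
    push_cast
    ring
  have hi2 := hi.integral_prod_right
  have hi3 : Integrable fun η => F η * ker (η * w) *
        ((2 * ∫ s in Ioi ε, (1 - Real.cos (2 * (Real.pi * η) * s)) / Real.sinh s ^ 2 : ℝ) : ℂ) := by
    refine hi2.congr (ae_of_all _ fun η => ?_)
    simp only
    rw [← integral_const_mul, ← integral_complex_ofReal, ← integral_const_mul]
    refine integral_congr_ae (ae_of_all _ fun s => ?_)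
    simp only
    push_cast
    ring
  rw [truncOp, h1, invFourier, ← integral_const_mul,
    ← integral_add ((integrable_mul_ker hF w).const_mul 2) hi3, ← integral_const_mul]
  refine integral_congr_ae (ae_of_all _ fun η => ?_)
  simp only
  rw [truncSymb]
  push_cast
  have : (Real.pi : ℂ) ≠ 0 := by exact_mod_cast Real.pi_pos.ne'
  field_simp

/-- The Fourier multiplier of the average over `[w - ε, w + ε]`. -/
def avgSymb (ε η : ℝ) : ℂ := 1 / (2 * (ε : ℂ)) * ∫ t in (-ε)..ε, ker (η * t)

theorem average_fourierInv (G : L2R) (ε w : ℝ) :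
    1 / (2 * (ε : ℂ)) * ∫ t in (w - ε)..(w + ε), (𝓕⁻ G : L2R) t =
      ∫ η, avgSymb ε η * G η * ker (η * w) := by
  rw [integral_fourierInv_L2R, ← integral_const_mul]
  refine integral_congr_ae (ae_of_all _ fun η => ?_)
  have h : ∫ t in (w - ε)..(w + ε), ker (η * t) = ker (η * w) * ∫ t in (-ε)..ε, ker (η * t) := by
    rw [← intervalIntegral.integral_const_mul]
    have h1 := intervalIntegral.integral_comp_add_left (fun t => ker (η * t)) w (a := -ε) (b := ε)
    rw [← sub_eq_add_neg] at h1
    rw [← h1]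
    congr 1
    ext t
    rw [mul_add, ker_add]
  simp only
  rw [h, avgSymb]
  ring

theorem norm_avgSymb_le_one {ε : ℝ} (hε : 0 < ε) (η : ℝ) : ‖avgSymb ε η‖ ≤ 1 := by
  have h : ‖∫ t in (-ε)..ε, ker (η * t)‖ ≤ 1 * |ε - -ε| :=
    intervalIntegral.norm_integral_le_of_norm_le_const fun t _ => (norm_ker _).le
  rw [abs_of_pos (by linarith)] at h
  rw [avgSymb, norm_mul, norm_div, norm_mul, norm_one, Complex.norm_two, Complex.norm_real,
    Real.norm_of_nonneg hε.le, div_mul_eq_mul_div, one_mul, div_le_one (by positivity)]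
  linarith

theorem norm_ker_sub_one_le (x : ℝ) : ‖ker x - 1‖ ≤ 2 * Real.pi * |x| := by
  have h := Real.norm_exp_I_mul_ofReal_sub_one_le (x := 2 * Real.pi * x)
  rw [mul_comm Complex.I] at h
  refine h.trans_eq ?_
  rw [Real.norm_eq_abs, abs_mul, abs_of_pos Real.two_pi_pos]

theorem norm_avgSymb_sub_one_le {ε : ℝ} (hε : 0 < ε) (η : ℝ) :
    ‖avgSymb ε η - 1‖ ≤ 2 * Real.pi * (|η| * ε) := by
  have h1 : avgSymb ε η - 1 = 1 / (2 * (ε : ℂ)) * ∫ t in (-ε)..ε, (ker (η * t) - 1) := by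
    have hc : Continuous fun t => ker (η * t) := continuous_ker.comp (by fun_prop)
    rw [intervalIntegral.integral_sub (hc.intervalIntegrable _ _) (by simp),
      intervalIntegral.integral_const, avgSymb]
    have : (ε : ℂ) ≠ 0 := by exact_mod_cast hε.ne'
    rw [Complex.real_smul]
    push_cast
    field_simp
    ring
  have h : ‖∫ t in (-ε)..ε, (ker (η * t) - 1)‖ ≤ (2 * Real.pi * (|η| * ε)) * |ε - -ε| := by
    refine intervalIntegral.norm_integral_le_of_norm_le_const fun t ht => ?_
    refine (norm_ker_sub_one_le _).trans ?_
    rw [abs_mul]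
    rw [uIoc_of_le (by linarith)] at ht
    have : |t| ≤ ε := abs_le.2 ⟨ht.1.le, ht.2⟩
    have := Real.pi_pos
    gcongr
  rw [abs_of_pos (show 0 < ε - -ε by linarith)] at h
  rw [h1, norm_mul, norm_div, norm_mul, norm_one, Complex.norm_two, Complex.norm_real,
    Real.norm_of_nonneg hε.le, div_mul_eq_mul_div, one_mul, div_le_iff₀ (by positivity)]
  linarith

theorem norm_avgSymb_le {ε η : ℝ} (hε : 0 < ε) (hη : η ≠ 0) :
    ‖avgSymb ε η‖ ≤ 1 / (2 * Real.pi * (|η| * ε)) := by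
  have h := congrArg norm (two_pi_mul_integral_ker η (-ε) ε)
  have h2 : ‖ker (η * ε) - ker (η * -ε)‖ ≤ 2 := by
    refine (norm_sub_le _ _).trans ?_
    rw [norm_ker, norm_ker]
    norm_num
  have hη' := abs_pos.2 hη
  rw [norm_mul, norm_mul, Complex.norm_I, mul_one, Complex.norm_real, norm_mul,
    Real.norm_of_nonneg Real.two_pi_pos.le, Real.norm_eq_abs] at h
  rw [avgSymb, norm_mul, norm_div, norm_mul, norm_one, Complex.norm_two, Complex.norm_real,
    Real.norm_of_nonneg hε.le, le_div_iff₀ (by positivity)]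
  calc 1 / (2 * ε) * ‖∫ t in (-ε)..ε, ker (η * t)‖ * (2 * Real.pi * (|η| * ε))
      = (2 * Real.pi * |η| * ‖∫ t in (-ε)..ε, ker (η * t)‖) / 2 := by field_simp
    _ ≤ 1 := by rw [h]; linarith

/-- The difference between the symbol of the truncated operator and that of the average. -/
def diffSymb (ε η : ℝ) : ℂ := truncSymb ε η - symb η * avgSymb ε η

theorem measurable_truncSymb (ε : ℝ) : Measurable (truncSymb ε) := by
  have h : StronglyMeasurable fun η : ℝ =>
      ∫ s in Ioi ε, (1 - Real.cos (2 * (Real.pi * η) * s)) / Real.sinh s ^ 2 := by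
    refine StronglyMeasurable.integral_prod_right (f := fun η s : ℝ =>
      (1 - Real.cos (2 * (Real.pi * η) * s)) / Real.sinh s ^ 2) ?_
    refine Measurable.stronglyMeasurable ?_
    exact (Continuous.measurable (by fun_prop)).div
      ((Real.measurable_sinh.comp measurable_snd).pow_const 2)
  exact measurable_const.mul (measurable_const.add h.measurable)

theorem measurable_avgSymb (ε : ℝ) : Measurable (avgSymb ε) := by
  unfold avgSymb
  refine measurable_const.mul (Continuous.measurable ?_)
  exact intervalIntegral.continuous_parametric_intervalIntegral_of_continuous'
    (f := fun η t => ker (η * t)) (continuous_ker.comp (by fun_prop)) _ _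

theorem measurable_diffSymb (ε : ℝ) : Measurable (diffSymb ε) :=
  (Complex.measurable_ofReal.comp (measurable_truncSymb ε)).sub
    ((Complex.measurable_ofReal.comp measurable_symb).mul (measurable_avgSymb ε))

theorem norm_diffSymb_le_const_mul {ε : ℝ} (hε : 0 < ε) (hε1 : ε ≤ 1) (η : ℝ) :
    ‖diffSymb ε η‖ ≤ (3 / (Real.pi * ε) + 1) * wt η := by
  refine (norm_sub_le _ _).trans ?_
  rw [norm_mul, Complex.norm_real, Complex.norm_real, Real.norm_of_nonneg (symb_nonneg η), add_mul]
  have h1 := abs_truncSymb_le hε hε1 η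
  have h2 := one_le_wt η
  have h3 : 0 < 3 / (Real.pi * ε) := by have := Real.pi_pos; positivity
  have h4 := mul_le_mul (symb_le_wt η) (norm_avgSymb_le_one hε η) (norm_nonneg _) (wt_pos η).le
  rw [Real.norm_eq_abs]
  nlinarith

theorem norm_diffSymb_le_small {ε η : ℝ} (hε : 0 < ε) (hη : η ≠ 0) :
    ‖diffSymb ε η‖ ≤ 8 * wt η * (|η| * ε) := by
  have e : diffSymb ε η = ((truncSymb ε η - symb η : ℝ) : ℂ) - symb η * (avgSymb ε η - 1) := by
    rw [diffSymb]; push_cast; ring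
  rw [e]
  refine (norm_sub_le _ _).trans ?_
  rw [norm_mul, Complex.norm_real, Complex.norm_real, Real.norm_of_nonneg (symb_nonneg η),
    Real.norm_eq_abs]
  have h1 := abs_symb_sub_truncSymb_le hε hη
  have h2 := mul_le_mul (symb_le_wt η) (norm_avgSymb_sub_one_le hε η) (norm_nonneg _) (wt_pos η).le
  have h3 : 0 ≤ wt η * (|η| * ε) := by have := wt_pos η; positivity
  nlinarith [Real.pi_lt_d2]

theorem norm_diffSymb_le_large {ε η : ℝ} (hε : 0 < ε) (hε1 : ε ≤ 1) (hη : η ≠ 0) :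
    ‖diffSymb ε η‖ ≤ 8 * wt η * (1 / (|η| * ε)) := by
  refine (norm_sub_le _ _).trans ?_
  rw [norm_mul, Complex.norm_real, Complex.norm_real, Real.norm_of_nonneg (symb_nonneg η),
    Real.norm_eq_abs]
  have hη' := abs_pos.2 hη
  have hp := Real.pi_gt_three
  have h1 := abs_truncSymb_le hε hε1 η
  have h2 := mul_le_mul (symb_le_wt η) (norm_avgSymb_le hε hη) (norm_nonneg _) (wt_pos η).le
  have h5 : 2 * Real.pi * |η| ≤ wt η := by
    have := norm_two_pi_mul_le η
    rwa [norm_mul, Complex.norm_I, mul_one, Complex.norm_real, one_mul, norm_mul,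
      Real.norm_of_nonneg (by positivity)] at this
  have h6 : |η| ≤ wt η := by nlinarith
  have h3 : 3 / (Real.pi * ε) ≤ wt η * (1 / (|η| * ε)) := by
    have e1 : wt η * (1 / (|η| * ε)) = (wt η / |η|) * (1 / ε) := by field_simp
    have e2 : 3 / (Real.pi * ε) = (3 / Real.pi) * (1 / ε) := by field_simp
    rw [e1, e2]
    refine mul_le_mul_of_nonneg_right ?_ (by positivity)
    refine ((div_le_one (by linarith)).2 hp.le).trans ?_
    rwa [le_div_iff₀ hη', one_mul]
  have h4 : wt η * (1 / (2 * Real.pi * (|η| * ε))) ≤ wt η * (1 / (|η| * ε)) := by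
    refine mul_le_mul_of_nonneg_left ?_ (wt_pos η).le
    have : 0 < |η| * ε := by positivity
    refine one_div_le_one_div_of_le this ?_
    nlinarith
  have h7 : 0 ≤ wt η * (1 / (|η| * ε)) := by have := wt_pos η; positivity
  linarith

/-- The dyadic sum `∑ min(t 2⁻ᵏ, (t 2⁻ᵏ)⁻¹)²` is bounded uniformly in `t`: its terms are
dominated by the differences of `x / (1 + x)` along the sequence `x = t 2⁻ᵏ`. -/
theorem sum_min_sq_le {t : ℝ} (ht : 0 < t) (n : ℕ) :
    ∑ k ∈ Finset.range n, min (t * (1 / 2) ^ k) (1 / (t * (1 / 2) ^ k)) ^ 2 ≤ 6 := by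
  set x : ℕ → ℝ := fun k => t * (1 / 2) ^ k with hx
  have hx0 : ∀ k, 0 < x k := fun k => by positivity
  have hxs : ∀ k, x (k + 1) = x k / 2 := fun k => by simp only [hx, pow_succ]; ring
  have key : ∀ y : ℝ, 0 < y → min y (1 / y) ^ 2 ≤
      6 * (y / (1 + y) - y / 2 / (1 + y / 2)) := by
    intro y hy
    have e : y / (1 + y) - y / 2 / (1 + y / 2) = y / ((1 + y) * (2 + y)) := by
      field_simp
      ring
    rw [e]
    rcases le_total y 1 with h | h
    · have h1 : min y (1 / y) ≤ y := min_le_left _ _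
      have h2 : 0 ≤ min y (1 / y) := le_min hy.le (by positivity)
      calc min y (1 / y) ^ 2 ≤ y ^ 2 := by gcongr
        _ ≤ _ := by
          rw [← mul_div_assoc, le_div_iff₀ (by positivity)]
          nlinarith [mul_pos hy hy, mul_pos (mul_pos hy hy) hy, mul_nonneg hy.le (sub_nonneg.2 h),
            mul_nonneg (mul_pos hy hy).le (sub_nonneg.2 h),
            mul_nonneg (mul_pos (mul_pos hy hy) hy).le (sub_nonneg.2 h)]
    · have h1 : min y (1 / y) ≤ 1 / y := min_le_right _ _
      have h2 : 0 ≤ min y (1 / y) := le_min hy.le (by positivity)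
      calc min y (1 / y) ^ 2 ≤ (1 / y) ^ 2 := by gcongr
        _ ≤ _ := by
          rw [div_pow, one_pow, ← mul_div_assoc, div_le_div_iff₀ (by positivity) (by positivity)]
          nlinarith [mul_nonneg hy.le (sub_nonneg.2 h), mul_nonneg (mul_pos hy hy).le (sub_nonneg.2 h)]
  have h1 : ∑ k ∈ Finset.range n, min (x k) (1 / x k) ^ 2 ≤
      ∑ k ∈ Finset.range n, 6 * (x k / (1 + x k) - x (k + 1) / (1 + x (k + 1))) := by
    refine Finset.sum_le_sum fun k _ => ?_
    rw [hxs]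
    exact key _ (hx0 k)
  refine h1.trans ?_
  rw [← Finset.mul_sum, Finset.sum_range_sub' (fun k => x k / (1 + x k))]
  have h2 : x 0 / (1 + x 0) ≤ 1 := by
    rw [div_le_one (by linarith [hx0 0])]
    linarith
  have h3 : 0 ≤ x n / (1 + x n) := div_nonneg (hx0 n).le (by linarith [hx0 n])
  linarith

theorem sum_norm_diffSymb_sq_le {η : ℝ} (hη : η ≠ 0) (n : ℕ) :
    ∑ k ∈ Finset.range n, ‖diffSymb ((1 / 2) ^ k) η‖ ^ 2 ≤ 384 * wt η ^ 2 := by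
  have h : ∀ k : ℕ, ‖diffSymb ((1 / 2) ^ k) η‖ ^ 2 ≤ 64 * wt η ^ 2 *
      min (|η| * (1 / 2) ^ k) (1 / (|η| * (1 / 2) ^ k)) ^ 2 := by
    intro k
    have hε : (0 : ℝ) < (1 / 2) ^ k := by positivity
    have hε1 : ((1 : ℝ) / 2) ^ k ≤ 1 := pow_le_one₀ (by norm_num) (by norm_num)
    have h1 := norm_diffSymb_le_small hε hη
    have h2 := norm_diffSymb_le_large hε hε1 hη
    have h3 : ‖diffSymb ((1 / 2) ^ k) η‖ ≤ 8 * wt η *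
        min (|η| * (1 / 2) ^ k) (1 / (|η| * (1 / 2) ^ k)) := by
      rw [mul_min_of_nonneg _ _ (by linarith [wt_pos η])]
      exact le_min h1 h2
    calc _ ≤ (8 * wt η * min (|η| * (1 / 2) ^ k) (1 / (|η| * (1 / 2) ^ k))) ^ 2 := by gcongr
      _ = _ := by ring
  refine (Finset.sum_le_sum fun k _ => h k).trans ?_
  rw [← Finset.mul_sum]
  have h4 := sum_min_sq_le (abs_pos.2 hη) n
  have h5 : 0 ≤ 64 * wt η ^ 2 := by positivity
  nlinarith

/-- A sequence in `L₂` with `∑ ‖f_k‖² < ∞` tends to zero almost everywhere. -/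
theorem ae_tendsto_zero_of_sum_norm_sq_le {f : ℕ → L2R} {C : ℝ}
    (h : ∀ n, ∑ k ∈ Finset.range n, ‖f k‖ ^ 2 ≤ C) :
    ∀ᵐ x, Tendsto (fun k => f k x) atTop (𝓝 0) := by
  have h1 : ∀ k, ∫⁻ x, ‖f k x‖ₑ ^ 2 = ENNReal.ofReal (‖f k‖ ^ 2) := by
    intro k
    rw [norm_sq_L2R, ofReal_integral_eq_lintegral_ofReal (integrable_norm_sq_L2R _)
      (ae_of_all _ fun x => by positivity)]
    refine lintegral_congr fun x => ?_
    rw [ENNReal.ofReal_pow (norm_nonneg _), ofReal_norm]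
  have h2 : ∫⁻ x, ∑' k, ‖f k x‖ₑ ^ 2 ≠ ⊤ := by
    rw [lintegral_tsum fun k => ((Lp.aestronglyMeasurable (f k)).enorm.pow_const 2)]
    simp only [h1]
    refine ne_top_of_le_ne_top (ENNReal.ofReal_ne_top (r := C)) ?_
    refine ENNReal.tsum_le_of_sum_range_le fun n => ?_
    rw [← ENNReal.ofReal_sum_of_nonneg fun k _ => by positivity]
    exact ENNReal.ofReal_le_ofReal (h n)
  have h3 := ae_lt_top' (AEMeasurable.tsum fun k =>
    ((Lp.aestronglyMeasurable (f k)).enorm.pow_const 2)) h2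
  filter_upwards [h3] with x hx
  have h4 := ENNReal.tendsto_atTop_zero_of_tsum_ne_top hx.ne
  rw [tendsto_zero_iff_norm_tendsto_zero]
  have h5 := (ENNReal.tendsto_toReal ENNReal.zero_ne_top).comp h4
  have h6 : Tendsto (fun k => ‖f k x‖ ^ 2) atTop (𝓝 0) := by
    refine h5.congr fun k => ?_
    simp
  have h7 := h6.sqrt
  simpa using h7

theorem tendsto_slope_right {E : Type*} [NormedAddCommGroup E] [NormedSpace ℝ E] {P : ℝ → E}
    {P' : E} {w : ℝ} (h : HasDerivAt P P' w) :
    Tendsto (fun t : ℝ => t⁻¹ • (P (w + t) - P w)) (𝓝[>] 0) (𝓝 P') :=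
  (hasDerivAt_iff_tendsto_slope_zero.1 h).comp
    (tendsto_id.mono_left (nhdsWithin_mono _ fun _ (ht : 0 < _) => ht.ne'))

theorem tendsto_slope_left {E : Type*} [NormedAddCommGroup E] [NormedSpace ℝ E] {P : ℝ → E}
    {P' : E} {w : ℝ} (h : HasDerivAt P P' w) :
    Tendsto (fun t : ℝ => t⁻¹ • (P (w - t) - P w)) (𝓝[>] 0) (𝓝 (-P')) := by
  have h3 : Tendsto (fun t : ℝ => -t) (𝓝[>] 0) (𝓝[≠] 0) := by
    refine tendsto_nhdsWithin_iff.2 ⟨?_, ?_⟩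
    · have := (continuous_neg (G := ℝ)).tendsto 0
      rw [neg_zero] at this
      exact this.mono_left nhdsWithin_le_nhds
    · filter_upwards [self_mem_nhdsWithin] with t (ht : 0 < t)
      exact (neg_neg_iff_pos.2 ht).ne
  refine ((hasDerivAt_iff_tendsto_slope_zero.1 h).comp h3).neg.congr fun t => ?_
  rw [Function.comp_apply, inv_neg, neg_smul, neg_neg, sub_eq_add_neg w t]

theorem tendsto_symm_slope {P : ℝ → ℂ} {P' : ℂ} {w : ℝ} (h : HasDerivAt P P' w) :
    Tendsto (fun t : ℝ => 1 / (2 * (t : ℂ)) * (P (w + t) - P (w - t))) (𝓝[>] 0) (𝓝 P') := by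
  have h4 := ((tendsto_slope_right h).sub (tendsto_slope_left h)).const_mul (1 / 2)
  have e : (1 / 2 : ℂ) * (P' - -P') = P' := by ring
  rw [e] at h4
  refine h4.congr' ?_
  filter_upwards [self_mem_nhdsWithin] with t (ht : 0 < t)
  have : (t : ℂ) ≠ 0 := by exact_mod_cast ht.ne'
  simp only [Complex.real_smul]
  push_cast
  field_simp
  ring

theorem memLp_symb_mul {F : L2R} (hF : MemLp (fun η => (wt η : ℂ) * F η) 2 volume) :
    MemLp (fun η => (symb η : ℂ) * F η) 2 volume :=
  memLp_mul_of_norm_le_wt hF (m := fun η => (symb η : ℂ))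
    (Complex.measurable_ofReal.comp measurable_symb) (C := 1) fun η => by
      rw [Complex.norm_real, Real.norm_of_nonneg (symb_nonneg η), one_mul]
      exact symb_le_wt η

/-- The operators truncated at `2⁻ᵏ` converge almost everywhere to the multiplier `symb`. -/
theorem ae_tendsto_truncOp {F : L2R} (hF : MemLp (fun η => (wt η : ℂ) * F η) 2 volume) :
    ∀ᵐ w, Tendsto (fun k : ℕ => truncOp (invFourier F) ((1 / 2) ^ k) w) atTop
      (𝓝 ((𝓕⁻ (memLp_symb_mul hF).toLp : L2R) w)) := by
  have hFi := integrable_of_memLp_wt_mul hF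
  have hε : ∀ k : ℕ, (0 : ℝ) < (1 / 2) ^ k := fun k => by positivity
  have hε1 : ∀ k : ℕ, ((1 : ℝ) / 2) ^ k ≤ 1 := fun k => pow_le_one₀ (by norm_num) (by norm_num)
  have hG : ∀ k : ℕ, MemLp (fun η => diffSymb ((1 / 2) ^ k) η * F η) 2 volume := fun k =>
    memLp_mul_of_norm_le_wt hF (measurable_diffSymb _) (norm_diffSymb_le_const_mul (hε k) (hε1 k))
  set S : L2R := (memLp_symb_mul hF).toLp with hS
  have hSae : S =ᵐ[volume] fun η => (symb η : ℂ) * F η := MemLp.coeFn_toLp _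
  have hne : ∀ᵐ η : ℝ, η ≠ 0 := by simp [ae_iff]
  set G : ℕ → L2R := fun k => (hG k).toLp with hGdef
  have hGae : ∀ k, G k =ᵐ[volume] fun η => diffSymb ((1 / 2) ^ k) η * F η :=
    fun k => MemLp.coeFn_toLp _
  -- all the multipliers of `F` below are integrable
  have htr : ∀ k : ℕ, Integrable fun η => (truncSymb ((1 / 2) ^ k) η : ℂ) * F η := fun k => by
    refine hFi.bdd_mul (c := 3 / (Real.pi * (1 / 2) ^ k))
      (Complex.measurable_ofReal.comp (measurable_truncSymb _)).aestronglyMeasurable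
      (ae_of_all _ fun η => ?_)
    rw [Complex.norm_real]
    exact abs_truncSymb_le (hε k) (hε1 k) η
  have havg : ∀ k : ℕ, Integrable fun η => avgSymb ((1 / 2) ^ k) η * S η := fun k => by
    refine (hFi.bdd_mul (c := 1 / (1 / 2) ^ k + 1)
      (f := fun η => avgSymb ((1 / 2) ^ k) η * symb η)
      ((measurable_avgSymb _).mul
        (Complex.measurable_ofReal.comp measurable_symb)).aestronglyMeasurable ?_).congr ?_
    · filter_upwards [hne] with η hη
      have hη' := abs_pos.2 hη
      have hp := Real.pi_gt_three
      have h1 := norm_avgSymb_le (hε k) hη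
      have h2 := norm_avgSymb_le_one (hε k) η
      have h3 : symb η ≤ 1 + 2 * Real.pi * |η| := by
        refine (symb_le_wt η).trans (Real.sqrt_le_iff.2 ⟨by positivity, ?_⟩)
        have := sq_abs η
        nlinarith [mul_pos Real.pi_pos hη', mul_pow Real.pi η 2, mul_pow Real.pi |η| 2]
      rw [norm_mul, Complex.norm_real, Real.norm_of_nonneg (symb_nonneg η)]
      calc ‖avgSymb ((1 / 2) ^ k) η‖ * symb η
          ≤ ‖avgSymb ((1 / 2) ^ k) η‖ * (1 + 2 * Real.pi * |η|) := by gcongr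
        _ = ‖avgSymb ((1 / 2) ^ k) η‖ + ‖avgSymb ((1 / 2) ^ k) η‖ * (2 * Real.pi * |η|) := by ring
        _ ≤ 1 + 1 / (2 * Real.pi * (|η| * (1 / 2) ^ k)) * (2 * Real.pi * |η|) := by gcongr
        _ = 1 / (1 / 2) ^ k + 1 := by field_simp; ring
    · filter_upwards [hSae] with η h
      rw [h]
      ring
  have hGi : ∀ k, Integrable (G k) := fun k => by
    refine ((htr k).sub (havg k)).congr ?_
    filter_upwards [hGae k, hSae] with η h1 h2
    rw [h1, Pi.sub_apply, h2, diffSymb]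
    ring
  have hsum : ∀ n, ∑ k ∈ Finset.range n, ‖(𝓕⁻ (G k) : L2R)‖ ^ 2 ≤
      ∫ η, 384 * ‖(wt η : ℂ) * F η‖ ^ 2 := by
    intro n
    have h1 : ∀ k, ‖(𝓕⁻ (G k) : L2R)‖ = ‖G k‖ := fun k => by
      rw [← Lp.norm_fourier_eq, FourierTransform.fourier_fourierInv_eq]
    simp only [h1, norm_sq_L2R]
    rw [← integral_finsetSum _ fun k _ => integrable_norm_sq_L2R _]
    refine integral_mono_ae (integrable_finsetSum _ fun k _ => integrable_norm_sq_L2R _)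
      (((memLp_two_iff_integrable_sq_norm hF.1).1 hF).const_mul _) ?_
    filter_upwards [ae_all_iff.2 hGae, hne] with η h2 h3
    simp only [h2, norm_mul, mul_pow]
    rw [← Finset.sum_mul, Complex.norm_real, Real.norm_of_nonneg (wt_pos η).le, ← mul_assoc]
    gcongr
    exact sum_norm_diffSymb_sq_le h3 n
  have hlim := ae_tendsto_zero_of_sum_norm_sq_le hsum
  filter_upwards [hlim, ae_all_iff.2 fun k => fourierInv_ae_eq (G k) (hGi k),
    _root_.LocallyIntegrable.ae_hasDerivAt_integral (locallyIntegrable_L2R (𝓕⁻ S : L2R))]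
    with w h1 h2 h3
  -- the averages tend to the value by the Lebesgue differentiation theorem
  have hav : Tendsto (fun k : ℕ => 1 / (2 * (((1 / 2) ^ k : ℝ) : ℂ)) *
      ∫ t in (w - (1 / 2) ^ k)..(w + (1 / 2) ^ k), (𝓕⁻ S : L2R) t) atTop
      (𝓝 ((𝓕⁻ S : L2R) w)) := by
    have hpos : Tendsto (fun k : ℕ => ((1 : ℝ) / 2) ^ k) atTop (𝓝[>] 0) :=
      tendsto_nhdsWithin_iff.2 ⟨tendsto_pow_atTop_nhds_zero_of_lt_one (by norm_num) (by norm_num),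
        Eventually.of_forall hε⟩
    refine ((tendsto_symm_slope (h3 0)).comp hpos).congr fun k => ?_
    rw [Function.comp_apply, intervalIntegral.integral_interval_sub_left
      (intervalIntegrable_L2R _ _ _) (intervalIntegrable_L2R _ _ _)]
  have hdiff : ∀ k : ℕ, truncOp (invFourier F) ((1 / 2) ^ k) w = (𝓕⁻ (G k) : L2R) w +
      1 / (2 * (((1 / 2) ^ k : ℝ) : ℂ)) *
        ∫ t in (w - (1 / 2) ^ k)..(w + (1 / 2) ^ k), (𝓕⁻ S : L2R) t := by
    intro k
    rw [truncOp_invFourier hFi (hε k), average_fourierInv, h2 k, invFourier,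
      ← integral_add (integrable_mul_ker (hGi k) w) (integrable_mul_ker (havg k) w)]
    refine integral_congr_ae ?_
    filter_upwards [hGae k, hSae] with η h4 h5
    rw [h4, h5, diffSymb]
    ring
  simp only [hdiff]
  simpa using h1.add hav

/-! ### Integration by parts for primitives of integrable functions -/

theorem setIntegral_Ioc_indicator_le {a b s : ℝ} (hs : s ∈ Ioc a b) (f : ℝ → ℂ) :
    ∫ t in Ioc a b, (Iic s).indicator f t = ∫ t in a..s, f t := by
  rw [setIntegral_indicator measurableSet_Iic, Ioc_inter_Iic, min_eq_right hs.2,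
    intervalIntegral.integral_of_le hs.1.le]

theorem setIntegral_Ioc_indicator_ge {a b t : ℝ} (ht : t ∈ Ioc a b) (f : ℝ → ℂ) :
    ∫ s in Ioc a b, (Ici t).indicator f s = ∫ s in t..b, f s := by
  rw [setIntegral_indicator measurableSet_Ici, intervalIntegral.integral_of_le ht.2,
    ← integral_Icc_eq_integral_Ioc]
  congr 2
  ext s
  exact ⟨fun h => ⟨h.2, h.1.2⟩, fun h => ⟨⟨ht.1.trans_le h.1, h.2⟩, h.1⟩⟩

/-- Integration by parts where one factor is `C¹` and the other, `U`, is a primitive of an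
integrable function `g`. -/
theorem integral_mul_of_primitive {a b : ℝ} (hab : a ≤ b) {g U κ κ' : ℝ → ℂ}
    (hg : IntervalIntegrable g volume a b)
    (hU : ∀ y ∈ Icc a b, ∫ t in a..y, g t = U y - U a)
    (hκ : ∀ y ∈ Icc a b, HasDerivAt κ (κ' y) y) (hκ' : ContinuousOn κ' (Icc a b)) :
    ∫ y in a..b, κ y * g y = κ b * U b - κ a * U a - ∫ y in a..b, κ' y * U y := by
  have hg' : IntegrableOn g (Ioc a b) := (intervalIntegrable_iff_integrableOn_Ioc_of_le hab).1 hg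
  have hκi : IntegrableOn κ' (Ioc a b) :=
    (hκ'.integrableOn_compact isCompact_Icc).mono_set Ioc_subset_Icc_self
  have hκc : ContinuousOn κ (Icc a b) := fun y hy => (hκ y hy).continuousAt.continuousWithinAt
  have hUc : ContinuousOn U (Icc a b) := by
    have h1 : ContinuousOn (fun y => (∫ t in a..y, g t) + U a) (Icc a b) := by
      rw [← uIcc_of_le hab]
      refine ContinuousOn.add ?_ continuousOn_const
      refine intervalIntegral.continuousOn_primitive_interval' hg left_mem_uIcc
    exact h1.congr fun y hy => by simp only [hU y hy]; ring
  have hint : Integrable (fun p : ℝ × ℝ =>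
      {p : ℝ × ℝ | p.2 ≤ p.1}.indicator (fun p => κ' p.1 * g p.2) p)
      ((volume.restrict (Ioc a b)).prod (volume.restrict (Ioc a b))) :=
    (hκi.mul_prod hg').indicator (measurableSet_le measurable_snd measurable_fst)
  have hswap := integral_integral_swap (f := fun s t =>
    {p : ℝ × ℝ | p.2 ≤ p.1}.indicator (fun p => κ' p.1 * g p.2) (s, t)) hint
  have hL : ∫ s in Ioc a b, ∫ t in Ioc a b,
      {p : ℝ × ℝ | p.2 ≤ p.1}.indicator (fun p => κ' p.1 * g p.2) (s, t) =
      (∫ y in a..b, κ' y * U y) - (κ b - κ a) * U a := by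
    have h1 : ∀ s ∈ Ioc a b, ∫ t in Ioc a b,
        {p : ℝ × ℝ | p.2 ≤ p.1}.indicator (fun p => κ' p.1 * g p.2) (s, t) =
        κ' s * U s - κ' s * U a := by
      intro s hs
      rw [← mul_sub, ← hU s (Ioc_subset_Icc_self hs), ← intervalIntegral.integral_const_mul,
        ← setIntegral_Ioc_indicator_le hs]
      rfl
    rw [setIntegral_congr_fun measurableSet_Ioc h1, ← intervalIntegral.integral_of_le hab,
      intervalIntegral.integral_sub, intervalIntegral.integral_mul_const,
      intervalIntegral.integral_eq_sub_of_hasDerivAt (f := κ) (f' := κ')]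
    · rwa [uIcc_of_le hab]
    · exact hκ'.intervalIntegrable_of_Icc hab
    · exact (hκ'.mul hUc).intervalIntegrable_of_Icc hab
    · exact (hκ'.mul (continuousOn_const (c := U a))).intervalIntegrable_of_Icc hab
  have hR : ∫ t in Ioc a b, ∫ s in Ioc a b,
      {p : ℝ × ℝ | p.2 ≤ p.1}.indicator (fun p => κ' p.1 * g p.2) (s, t) =
      κ b * (U b - U a) - ∫ y in a..b, κ y * g y := by
    have h1 : ∀ t ∈ Ioc a b, ∫ s in Ioc a b,
        {p : ℝ × ℝ | p.2 ≤ p.1}.indicator (fun p => κ' p.1 * g p.2) (s, t) =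
        κ b * g t - κ t * g t := by
      intro t ht
      have h2 : ∫ s in t..b, κ' s * g t = (κ b - κ t) * g t := by
        rw [intervalIntegral.integral_mul_const, intervalIntegral.integral_eq_sub_of_hasDerivAt]
        · intro y hy
          rw [uIcc_of_le ht.2] at hy
          exact hκ y ⟨ht.1.le.trans hy.1, hy.2⟩
        · exact (hκ'.mono (Icc_subset_Icc_left ht.1.le)).intervalIntegrable_of_Icc ht.2
      rw [← sub_mul, ← h2, ← setIntegral_Ioc_indicator_ge ht]
      rfl
    rw [setIntegral_congr_fun measurableSet_Ioc h1, ← intervalIntegral.integral_of_le hab,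
      intervalIntegral.integral_sub, intervalIntegral.integral_const_mul,
      hU b (right_mem_Icc.2 hab)]
    · exact hg.const_mul _
    · refine hg.continuousOn_mul ?_
      rwa [uIcc_of_le hab]
  rw [hL, hR] at hswap
  linear_combination hswap

/-! ### The inverse hyperbolic tangent -/

theorem hasDerivAt_artanh {x : ℝ} (hx : x ∈ Ioo (-1 : ℝ) 1) :
    HasDerivAt Real.artanh (1 / (1 - x ^ 2)) x := by
  have h1 : 0 < 1 + x := by linarith [hx.1]
  have h2 : 0 < 1 - x := by linarith [hx.2]
  have h3 : HasDerivAt (fun x : ℝ => 1 / 2 * Real.log ((1 + x) / (1 - x)))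
      (1 / 2 * (((0 + 1) * (1 - x) - (1 + x) * (0 - 1)) / (1 - x) ^ 2 / ((1 + x) / (1 - x)))) x :=
    ((((hasDerivAt_const x 1).add (hasDerivAt_id x)).div
      ((hasDerivAt_const x 1).sub (hasDerivAt_id x)) h2.ne').log
      (div_pos h1 h2).ne').const_mul _
  have h4 : 1 / 2 * (((0 + 1) * (1 - x) - (1 + x) * (0 - 1)) / (1 - x) ^ 2 /
      ((1 + x) / (1 - x))) = 1 / (1 - x ^ 2) := by
    have : (1 - x ^ 2) = (1 + x) * (1 - x) := by ring
    rw [this]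
    field_simp
    ring
  rw [← h4]
  refine h3.congr_of_eventuallyEq ?_
  filter_upwards [Ioo_mem_nhds hx.1 hx.2] with y hy
  exact Real.artanh_eq_half_log (Ioo_subset_Icc_self hy)

theorem tanh_lt_tanh_iff {y z : ℝ} : Real.tanh y < Real.tanh z ↔ y < z := by
  rw [← Real.artanh_lt_artanh_iff (tanh_mem_Ioo y) (tanh_mem_Ioo z), Real.artanh_tanh,
    Real.artanh_tanh]

theorem tendsto_artanh_one : Tendsto Real.artanh (𝓝[<] 1) atTop := by
  refine tendsto_atTop.2 fun b => ?_
  filter_upwards [Ioo_mem_nhdsLT (Real.tanh_lt_one b)] with x hx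
  rw [← Real.artanh_tanh b]
  exact Real.artanh_le_artanh (Real.neg_one_lt_tanh b) hx.2 hx.1.le

theorem tendsto_artanh_neg_one : Tendsto Real.artanh (𝓝[>] (-1)) atBot := by
  refine tendsto_atBot.2 fun b => ?_
  filter_upwards [Ioo_mem_nhdsGT (Real.neg_one_lt_tanh b)] with x hx
  rw [← Real.artanh_tanh b]
  exact Real.artanh_le_artanh hx.1 (Real.tanh_lt_one b) hx.2.le

/-! ### Transplantation from the line to the interval -/

/-- The function `U ∘ artanh` on `(-1,1)`, extended by zero. -/
def pull (U : ℝ → ℂ) (x : ℝ) : ℂ := (Ioo (-1 : ℝ) 1).indicator (fun x => U (Real.artanh x)) x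

theorem pull_tanh (U : ℝ → ℂ) (w : ℝ) : pull U (Real.tanh w) = U w := by
  rw [pull, indicator_of_mem (tanh_mem_Ioo w), Real.artanh_tanh]

theorem continuousOn_pull {U : ℝ → ℂ} (hU : Continuous U) (hT : Tendsto U atTop (𝓝 0))
    (hB : Tendsto U atBot (𝓝 0)) : ContinuousOn (pull U) (Icc (-1) 1) := by
  have hin : ∀ x ∈ Ioo (-1 : ℝ) 1, pull U x = U (Real.artanh x) := fun x hx =>
    indicator_of_mem hx _
  have h1 : pull U 1 = 0 := indicator_of_notMem (by simp) _
  have h2 : pull U (-1) = 0 := indicator_of_notMem (by simp) _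
  intro x hx
  rcases eq_or_lt_of_le hx.1 with h | h
  · subst h
    rw [continuousWithinAt_Icc_iff_Ici (by norm_num), ← continuousWithinAt_Ioi_iff_Ici,
      ContinuousWithinAt, h2]
    refine (hB.comp tendsto_artanh_neg_one).congr' ?_
    filter_upwards [Ioo_mem_nhdsGT (show (-1 : ℝ) < 1 by norm_num)] with y hy
    exact (hin y hy).symm
  rcases eq_or_lt_of_le hx.2 with h' | h'
  · subst h'
    rw [continuousWithinAt_Icc_iff_Iic (by norm_num), ← continuousWithinAt_Iio_iff_Iic,
      ContinuousWithinAt, h1]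
    refine (hT.comp tendsto_artanh_one).congr' ?_
    filter_upwards [Ioo_mem_nhdsLT (show (-1 : ℝ) < 1 by norm_num)] with y hy
    exact (hin y hy).symm
  · refine ContinuousAt.continuousWithinAt ?_
    refine (hU.continuousAt.comp (hasDerivAt_artanh ⟨h, h'⟩).continuousAt).congr ?_
    filter_upwards [Ioo_mem_nhds h h'] with y hy
    exact (hin y hy).symm

/-- The derivative of `pull U` when `g` is the derivative of `U`. -/
def pullDeriv (g : ℝ → ℂ) (x : ℝ) : ℂ := pull g x / ((1 - x ^ 2 : ℝ) : ℂ)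

theorem one_sub_tanh_sq_mul_pullDeriv (g : ℝ → ℂ) (w : ℝ) :
    ((1 - Real.tanh w ^ 2 : ℝ) : ℂ) * pullDeriv g (Real.tanh w) = g w := by
  have : ((1 - Real.tanh w ^ 2 : ℝ) : ℂ) ≠ 0 := by exact_mod_cast (one_sub_tanh_sq_pos w).ne'
  rw [pullDeriv, pull_tanh, mul_div_cancel₀ _ this]

theorem pull_ae_eq {U : ℝ → ℂ} {u : LTilde2} (h : toLine u =ᵐ[volume] U) :
    pull U =ᵐ[volume.restrict (Ioo (-1) 1)] u := by
  refine ae_of_ae_tanh (p := fun x => pull U x = u x) ?_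
  filter_upwards [h, toLine_ae_eq u] with w h1 h2
  rw [pull_tanh, ← h1, h2]

theorem isCompact_artanh_image {K : Set ℝ} (hK : IsCompact K) (hK1 : K ⊆ Ioo (-1) 1) :
    IsCompact (Real.artanh '' K) :=
  hK.image_of_continuousOn fun _ hx =>
    (hasDerivAt_artanh (hK1 hx)).continuousAt.continuousWithinAt

theorem locallyIntegrableOn_pullDeriv (g : L2R) :
    LocallyIntegrableOn (pullDeriv g) (Ioo (-1) 1) := by
  refine (locallyIntegrableOn_iff isOpen_Ioo.isLocallyClosed).2 fun K hK1 hK => ?_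
  have himg : Real.tanh '' (Real.artanh '' K) = K := by
    rw [image_image]
    refine (image_congr fun x hx => ?_).trans (image_id K)
    exact Real.tanh_artanh (hK1 hx)
  have hcomp := isCompact_artanh_image hK hK1
  rw [← himg, integrableOn_image_iff_integrableOn_abs_deriv_smul hcomp.measurableSet
    (fun w _ => (hasDerivAt_tanh w).hasDerivWithinAt) Real.tanh_injective.injOn]
  refine ((locallyIntegrable_L2R g).integrableOn_isCompact hcomp).congr_fun
    (fun w _ => ?_) hcomp.measurableSet
  rw [abs_of_pos (one_sub_tanh_sq_pos w), Complex.real_smul, one_sub_tanh_sq_mul_pullDeriv]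

/-- The chain rule for generalized derivatives under `x = tanh w`. -/
theorem isWeakDeriv_pull {U : ℝ → ℂ} {g : L2R} (hUc : Continuous U)
    (hT : Tendsto U atTop (𝓝 0)) (hB : Tendsto U atBot (𝓝 0))
    (hU : ∀ a b, ∫ w in a..b, g w = U b - U a) : IsWeakDeriv (pull U) (pullDeriv g) := by
  refine ⟨((continuousOn_pull hUc hT hB).mono Ioo_subset_Icc_self).locallyIntegrableOn
    measurableSet_Ioo, locallyIntegrableOn_pullDeriv g, fun φ hφ hφc hφs => ?_⟩
  obtain ⟨R, hR0, hR⟩ := (isCompact_artanh_image hφc hφs).isBounded.subset_ball_lt 0 0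
  have hout : ∀ w, w ∉ Ioo (-R) R → Real.tanh w ∉ tsupport φ := by
    intro w hw h
    have h1 := hR (mem_image_of_mem Real.artanh h)
    rw [Real.artanh_tanh, Real.ball_eq_Ioo, zero_sub, zero_add] at h1
    exact hw h1
  have hφ0 : ∀ w, w ∉ Ioo (-R) R → φ (Real.tanh w) = 0 := fun w hw =>
    image_eq_zero_of_notMem_tsupport (hout w hw)
  have hφ1 : ∀ w, w ∉ Ioo (-R) R → deriv φ (Real.tanh w) = 0 := fun w hw =>
    image_eq_zero_of_notMem_tsupport fun h => hout w hw (tsupport_deriv_subset h)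
  have hdφ : Continuous (deriv φ) := hφ.continuous_deriv (by simp)
  have htanh : Continuous Real.tanh :=
    continuous_iff_continuousAt.2 fun w => (hasDerivAt_tanh w).continuousAt
  set ψ' : ℝ → ℂ := fun w => ((deriv φ (Real.tanh w) * (1 - Real.tanh w ^ 2) : ℝ) : ℂ) with hψ'
  have hψ'c : Continuous ψ' := by
    refine Complex.continuous_ofReal.comp ((hdφ.comp htanh).mul ?_)
    fun_prop
  have hψ : ∀ w, HasDerivAt (fun w => ((φ (Real.tanh w) : ℝ) : ℂ)) (ψ' w) w := fun w =>
    (((hφ.differentiable (by simp)).differentiableAt.hasDerivAt).comp w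
      (hasDerivAt_tanh w)).ofReal_comp
  have hsub : Ioo (-R) R ⊆ Ioc (-R) R := Ioo_subset_Ioc_self
  have h1 : ∫ x in Ioo (-1 : ℝ) 1, deriv φ x • pull U x = ∫ w in (-R)..R, ψ' w * U w := by
    rw [integral_Ioo_eq_integral_line, intervalIntegral.integral_eq_integral_of_support_subset]
    · refine integral_congr_ae (ae_of_all _ fun w => ?_)
      simp only [hψ', pull_tanh, Complex.real_smul]
      push_cast
      ring
    · intro w hw
      refine hsub (by_contra fun h => hw ?_)
      simp [hψ', hφ1 w h]
  have h2 : ∫ x in Ioo (-1 : ℝ) 1, φ x • pullDeriv g x =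
      ∫ w in (-R)..R, ((φ (Real.tanh w) : ℝ) : ℂ) * g w := by
    rw [integral_Ioo_eq_integral_line, intervalIntegral.integral_eq_integral_of_support_subset]
    · refine integral_congr_ae (ae_of_all _ fun w => ?_)
      simp only
      rw [← one_sub_tanh_sq_mul_pullDeriv g w, Complex.real_smul]
      ring
    · intro w hw
      refine hsub (by_contra fun h => hw ?_)
      simp [hφ0 w h]
  have h3 := integral_mul_of_primitive (by linarith : -R ≤ R) (intervalIntegrable_L2R g _ _)
    (fun y _ => hU (-R) y) (fun w _ => hψ w) hψ'c.continuousOn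
  rw [hφ0 R (by simp), hφ0 (-R) (by simp)] at h3
  rw [h1, h2, h3]
  simp

/-! ### Tails of singular integrals -/

theorem norm_tail_sub_le {N : ℝ → ℂ} (hN : ∀ ε > 0, IntegrableOn N (Ioi ε)) {m r C : ℝ}
    (hm : 0 < m) (hC : ∀ s ∈ Ioc 0 r, s * ‖N s‖ ≤ C) {σ τ : ℝ} (hσ : σ ∈ Icc m r)
    (hτ : τ ∈ Icc m r) :
    ‖(∫ s in Ioi σ, N s) - ∫ s in Ioi τ, N s‖ ≤ C / m * |τ - σ| := by
  rw [intervalIntegral.integral_Ioi_sub_Ioi' (hN σ (hm.trans_le hσ.1)) (hN τ (hm.trans_le hτ.1))]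
  refine intervalIntegral.norm_integral_le_of_norm_le_const fun s hs => ?_
  have hs' : s ∈ Icc m r := by
    have := uIoc_subset_uIcc hs
    exact ⟨(le_min hσ.1 hτ.1).trans this.1, this.2.trans (max_le hσ.2 hτ.2)⟩
  rw [le_div_iff₀ hm, mul_comm]
  refine le_trans ?_ (hC s ⟨hm.trans_le hs'.1, hs'.2⟩)
  gcongr
  exact hs'.1

/-- If `N(s) = o(1/s)` at zero, it is enough to let the cut-off go to zero along powers of `1/2`. -/
theorem tendsto_tail_of_dyadic {N : ℝ → ℂ} (hN : ∀ ε > 0, IntegrableOn N (Ioi ε))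
    (h0 : Tendsto (fun s => s * ‖N s‖) (𝓝[>] 0) (𝓝 0)) {l : ℂ}
    (hl : Tendsto (fun k : ℕ => ∫ s in Ioi ((1 / 2 : ℝ) ^ k), N s) atTop (𝓝 l)) :
    Tendsto (fun σ => ∫ s in Ioi σ, N s) (𝓝[>] 0) (𝓝 l) := by
  refine Metric.tendsto_nhds.2 fun e he => ?_
  obtain ⟨K, hK⟩ := eventually_atTop.1 (Metric.tendsto_nhds.1 hl (e / 2) (by positivity))
  obtain ⟨r, hr0, hr⟩ := (mem_nhdsGT_iff_exists_Ioc_subset).1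
    (h0.eventually_le_const (show (0 : ℝ) < e / 4 by positivity))
  have hr0' : (0 : ℝ) < r := hr0
  filter_upwards [Ioo_mem_nhdsGT (show (0 : ℝ) < min 1 (min (r / 2) ((1 / 2) ^ (K + 1))) by
    positivity)] with σ hσ
  obtain ⟨h1, h2, h3⟩ : σ < 1 ∧ σ < r / 2 ∧ σ < (1 / 2) ^ (K + 1) := by
    simpa [lt_min_iff] using hσ.2
  obtain ⟨n, hn1, hn2⟩ := exists_nat_pow_near_of_lt_one hσ.1 h1.le
    (show (0 : ℝ) < 1 / 2 by norm_num) (by norm_num)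
  have hnK : K ≤ n := by
    have := (pow_lt_pow_iff_right_of_lt_one₀ (show (0 : ℝ) < 1 / 2 by norm_num)
      (by norm_num)).1 (hn1.trans h3)
    omega
  have hn3 : (1 / 2 : ℝ) ^ n < 2 * σ := by
    rw [pow_succ] at hn1
    linarith
  have h4 := norm_tail_sub_le hN hσ.1 hr (σ := σ) (τ := (1 / 2) ^ n) ⟨le_rfl, by linarith⟩
    ⟨hn2, by linarith⟩
  have h5 : e / 4 / σ * |(1 / 2) ^ n - σ| ≤ e / 4 := by
    rw [abs_of_nonneg (by linarith), div_mul_eq_mul_div, div_le_iff₀ hσ.1]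
    exact mul_le_mul_of_nonneg_left (by linarith) (by positivity)
  rw [← dist_eq_norm] at h4
  have h6 := hK n hnK
  have h7 := dist_triangle (∫ s in Ioi σ, N s) (∫ s in Ioi ((1 / 2 : ℝ) ^ n), N s) l
  linarith

/-- If `N(s) = O(1/s)` at zero, the tails do not distinguish equivalent cut-offs. -/
theorem tendsto_tail_sub {N : ℝ → ℂ} (hN : ∀ ε > 0, IntegrableOn N (Ioi ε)) {C : ℝ}
    (hC : ∀ᶠ s in 𝓝[>] (0 : ℝ), s * ‖N s‖ ≤ C) {σ τ : ℝ → ℝ} {l : ℝ} (hl : 0 < l)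
    (hσ : Tendsto (fun ε => σ ε / ε) (𝓝[>] 0) (𝓝 l))
    (hτ : Tendsto (fun ε => τ ε / ε) (𝓝[>] 0) (𝓝 l)) :
    Tendsto (fun ε => (∫ s in Ioi (σ ε), N s) - ∫ s in Ioi (τ ε), N s) (𝓝[>] 0) (𝓝 0) := by
  obtain ⟨r, hr0, hr⟩ := (mem_nhdsGT_iff_exists_Ioc_subset).1 hC
  have hr0' : (0 : ℝ) < r := hr0
  have h1 : Tendsto (fun ε => C / (l / 2) * |τ ε / ε - σ ε / ε|) (𝓝[>] 0) (𝓝 0) := by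
    simpa using ((hτ.sub hσ).abs).const_mul (C / (l / 2))
  refine squeeze_zero_norm' ?_ h1
  filter_upwards [hσ.eventually (Ioo_mem_nhds (show l / 2 < l by linarith)
    (show l < 2 * l by linarith)), hτ.eventually (Ioo_mem_nhds (show l / 2 < l by linarith)
    (show l < 2 * l by linarith)),
    Ioo_mem_nhdsGT (show 0 < r / (2 * l) by positivity)] with ε h2 h3 h4
  have h5 : ε * (2 * l) < r := (lt_div_iff₀ (by positivity)).1 h4.2
  have key : ∀ x : ℝ, x / ε ∈ Ioo (l / 2) (2 * l) → x ∈ Icc (l / 2 * ε) r := by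
    intro x hx
    have e1 := (lt_div_iff₀ h4.1).1 hx.1
    have e2 := (div_lt_iff₀ h4.1).1 hx.2
    exact ⟨e1.le, by linarith⟩
  refine (norm_tail_sub_le hN (by have := h4.1; positivity) hr (key _ h2) (key _ h3)).trans
    (le_of_eq ?_)
  rw [← sub_div, abs_div, abs_of_pos h4.1]
  have := h4.1.ne'
  field_simp

theorem tendsto_tail_atTop {N : ℝ → ℂ} (hN : ∀ ε > 0, IntegrableOn N (Ioi ε)) :
    Tendsto (fun T => ∫ s in Ioi T, N s) atTop (𝓝 0) := by
  have h1 := intervalIntegral_tendsto_integral_Ioi 1 (hN 1 one_pos) tendsto_id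
  have h2 := h1.const_sub (∫ s in Ioi 1, N s)
  rw [sub_self] at h2
  refine h2.congr' ?_
  filter_upwards [eventually_gt_atTop 0] with T hT
  rw [id, ← intervalIntegral.integral_Ioi_sub_Ioi' (hN 1 one_pos) (hN T hT)]
  ring

/-! ### The singular integral -/

theorem tanh_sub_tanh_sq (y w : ℝ) : (Real.tanh y - Real.tanh w) ^ 2 =
    (1 - Real.tanh y ^ 2) * (1 - Real.tanh w ^ 2) * Real.sinh (y - w) ^ 2 := by
  have h1 := Real.cosh_pos y
  have h2 := Real.cosh_pos w
  have h3 : ∀ z, 1 - Real.tanh z ^ 2 = 1 / Real.cosh z ^ 2 := by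
    intro z
    have := (Real.cosh_pos z).ne'
    rw [Real.tanh_eq_sinh_div_cosh]
    field_simp
    linarith [Real.cosh_sq z]
  rw [h3, h3, Real.sinh_sub, Real.tanh_eq_sinh_div_cosh, Real.tanh_eq_sinh_div_cosh]
  field_simp

theorem hasDerivAt_inv_tanh_sub {y w : ℝ} (h : y ≠ w) :
    HasDerivAt (fun y => 1 / ((Real.tanh y - Real.tanh w : ℝ) : ℂ))
      (-(1 / ((1 - Real.tanh w ^ 2 : ℝ) : ℂ)) * (1 / ((Real.sinh (y - w) ^ 2 : ℝ) : ℂ))) y := by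
  have h1 : Real.tanh y - Real.tanh w ≠ 0 := sub_ne_zero.2 (Real.tanh_injective.ne h)
  have h2 := ((((hasDerivAt_tanh y).sub_const (Real.tanh w)).inv h1)).ofReal_comp
  simp only [Pi.inv_apply] at h2
  have h3 : Real.sinh (y - w) ≠ 0 := by rwa [ne_eq, Real.sinh_eq_zero, sub_eq_zero]
  have h4 := (one_sub_tanh_sq_pos w).ne'
  have h5 := (one_sub_tanh_sq_pos y).ne'
  have h6 : -(1 - Real.tanh y ^ 2) / (Real.tanh y - Real.tanh w) ^ 2 =
      -(1 / (1 - Real.tanh w ^ 2)) * (1 / Real.sinh (y - w) ^ 2) := by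
    rw [tanh_sub_tanh_sq]
    field_simp
  rw [h6] at h2
  have h7 : (fun y => 1 / ((Real.tanh y - Real.tanh w : ℝ) : ℂ)) =
      fun y => (((Real.tanh y - Real.tanh w)⁻¹ : ℝ) : ℂ) := by
    ext y
    push_cast
    rw [one_div]
  rw [h7]
  refine h2.congr_deriv ?_
  push_cast
  ring

/-- The integrand of the hypersingular integral `∫ (U(w + s) - U(w)) / sinh² s ds`. -/
def diffQuot (U : ℝ → ℂ) (w s : ℝ) : ℂ := (U (w + s) - U w) / ((Real.sinh s ^ 2 : ℝ) : ℂ)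

theorem integrableOn_sinh_quot {f : ℝ → ℂ} (hf : Continuous f) {C : ℝ} (hC : ∀ s, ‖f s‖ ≤ C)
    {ε : ℝ} (hε : 0 < ε) :
    IntegrableOn (fun s => f s / ((Real.sinh s ^ 2 : ℝ) : ℂ)) (Ioi ε) := by
  have h1 : IntegrableOn (fun s => ((1 / Real.sinh s ^ 2 : ℝ) : ℂ)) (Ioi ε) :=
    (integrableOn_inv_sinh_sq hε).ofReal
  refine (h1.bdd_mul (c := C) hf.aestronglyMeasurable (ae_of_all _ hC)).congr
    (ae_of_all _ fun s => ?_)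
  simp only
  push_cast
  ring

theorem integrableOn_diffQuot {U : ℝ → ℂ} (hU : Continuous U) {C : ℝ} (hC : ∀ s, ‖U s‖ ≤ C)
    (w : ℝ) {ε : ℝ} (hε : 0 < ε) : IntegrableOn (diffQuot U w) (Ioi ε) :=
  integrableOn_sinh_quot (f := fun s => U (w + s) - U w) (by fun_prop) (C := C + C)
    (fun s => (norm_sub_le _ _).trans (add_le_add (hC _) (hC _))) hε

theorem diffQuot_neg (U : ℝ → ℂ) (w s : ℝ) :
    diffQuot U w (-s) = (U (w - s) - U w) / ((Real.sinh s ^ 2 : ℝ) : ℂ) := by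
  rw [diffQuot, Real.sinh_neg, neg_sq, sub_eq_add_neg w s]

theorem integrableOn_diffQuot_neg {U : ℝ → ℂ} (hU : Continuous U) {C : ℝ} (hC : ∀ s, ‖U s‖ ≤ C)
    (w : ℝ) {ε : ℝ} (hε : 0 < ε) : IntegrableOn (fun s => diffQuot U w (-s)) (Ioi ε) := by
  simp only [diffQuot_neg]
  exact integrableOn_sinh_quot (f := fun s => U (w - s) - U w) (by fun_prop) (C := C + C)
    (fun s => (norm_sub_le _ _).trans (add_le_add (hC _) (hC _))) hε

/-- Integration by parts turns the singular integral of `U'` into a hypersingular one of `U`. -/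
theorem integral_inv_tanh_sub_mul {U : ℝ → ℂ} {g : L2R}
    (hU : ∀ a b, ∫ y in a..b, g y = U b - U a) {w a b : ℝ} (hab : a ≤ b) (hw : w ∉ Icc a b) :
    ∫ y in a..b, 1 / ((Real.tanh y - Real.tanh w : ℝ) : ℂ) * g y =
      1 / ((Real.tanh b - Real.tanh w : ℝ) : ℂ) * (U b - U w) -
      1 / ((Real.tanh a - Real.tanh w : ℝ) : ℂ) * (U a - U w) +
      1 / ((1 - Real.tanh w ^ 2 : ℝ) : ℂ) * ∫ s in (a - w)..(b - w), diffQuot U w s := by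
  have hne : ∀ y ∈ Icc a b, y ≠ w := fun y hy h => hw (h ▸ hy)
  rw [integral_mul_of_primitive (U := fun y => U y - U w) hab (intervalIntegrable_L2R g a b)
    (fun y _ => by rw [hU]; ring) (fun y hy => hasDerivAt_inv_tanh_sub (hne y hy)),
    ← intervalIntegral.integral_comp_sub_right, ← intervalIntegral.integral_const_mul,
    sub_eq_add_neg, ← intervalIntegral.integral_neg]
  · congr 1
    refine intervalIntegral.integral_congr fun y _ => ?_
    simp only [diffQuot, add_sub_cancel]
    ring
  · refine continuousOn_const.mul (continuousOn_const.div (Continuous.continuousOn ?_) ?_)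
    · exact Complex.continuous_ofReal.comp (by fun_prop)
    · intro y hy
      have : Real.sinh (y - w) ≠ 0 := by
        rw [ne_eq, Real.sinh_eq_zero, sub_eq_zero]
        exact hne y hy
      exact_mod_cast pow_ne_zero 2 this

theorem intervalIntegrable_inv_tanh_sub_mul (g : L2R) {w a b : ℝ} (hab : a ≤ b)
    (hw : w ∉ Icc a b) :
    IntegrableOn (fun y => 1 / ((Real.tanh y - Real.tanh w : ℝ) : ℂ) * g y) (Ioc a b) := by
  rw [← intervalIntegrable_iff_integrableOn_Ioc_of_le hab]
  refine (intervalIntegrable_L2R g a b).continuousOn_mul fun y hy => ?_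
  rw [uIcc_of_le hab] at hy
  exact (hasDerivAt_inv_tanh_sub (w := w) fun h => hw (h ▸ hy)).continuousAt.continuousWithinAt

/-- The truncated singular integral in the variable of the line. -/
theorem setIntegral_pullDeriv_div (g : L2R) {w a p q b ε : ℝ} (hap : a < p) (hpw : p < w)
    (hwq : w < q) (hqb : q < b) (hp : Real.tanh p = Real.tanh w - ε)
    (hq : Real.tanh q = Real.tanh w + ε) :
    ∫ t in {t | t ∈ Ioo (Real.tanh a) (Real.tanh b) ∧ ε < |t - Real.tanh w|},
      pullDeriv g t / ((t - Real.tanh w : ℝ) : ℂ) =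
      (∫ y in a..p, 1 / ((Real.tanh y - Real.tanh w : ℝ) : ℂ) * g y) +
      ∫ y in q..b, 1 / ((Real.tanh y - Real.tanh w : ℝ) : ℂ) * g y := by
  have himg : Real.tanh '' (Ioo a p ∪ Ioo q b) =
      {t | t ∈ Ioo (Real.tanh a) (Real.tanh b) ∧ ε < |t - Real.tanh w|} := by
    ext t
    constructor
    · rintro ⟨y, h | h, rfl⟩
      · refine ⟨⟨tanh_lt_tanh_iff.2 h.1, tanh_lt_tanh_iff.2 (h.2.trans (hpw.trans (hwq.trans hqb)))⟩, ?_⟩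
        have := tanh_lt_tanh_iff.2 h.2
        refine lt_of_lt_of_le ?_ (neg_le_abs _)
        linarith
      · refine ⟨⟨tanh_lt_tanh_iff.2 (hap.trans (hpw.trans (hwq.trans h.1))), tanh_lt_tanh_iff.2 h.2⟩, ?_⟩
        have := tanh_lt_tanh_iff.2 h.1
        refine lt_of_lt_of_le ?_ (le_abs_self _)
        linarith
    · rintro ⟨⟨h1, h2⟩, h3⟩
      have ht : t ∈ Ioo (-1 : ℝ) 1 :=
        ⟨(tanh_mem_Ioo a).1.trans h1, h2.trans (tanh_mem_Ioo b).2⟩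
      refine ⟨Real.artanh t, ?_, Real.tanh_artanh ht⟩
      rw [← Real.tanh_artanh ht] at h1 h2 h3
      rcases lt_abs.1 h3 with h | h
      · exact Or.inr ⟨tanh_lt_tanh_iff.1 (by linarith), tanh_lt_tanh_iff.1 h2⟩
      · exact Or.inl ⟨tanh_lt_tanh_iff.1 h1, tanh_lt_tanh_iff.1 (by linarith)⟩
  have hd : Disjoint (Ioo a p) (Ioo q b) := by
    rw [Set.disjoint_left]
    intro y h1 h2
    linarith [h1.2, h2.1]
  rw [← himg, integral_image_eq_integral_abs_deriv_smul
    (measurableSet_Ioo.union measurableSet_Ioo)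
    (fun y _ => (hasDerivAt_tanh y).hasDerivWithinAt) Real.tanh_injective.injOn]
  have hcongr : ∀ y, |1 - Real.tanh y ^ 2| •
      (pullDeriv g (Real.tanh y) / ((Real.tanh y - Real.tanh w : ℝ) : ℂ)) =
      1 / ((Real.tanh y - Real.tanh w : ℝ) : ℂ) * g y := by
    intro y
    rw [abs_of_pos (one_sub_tanh_sq_pos y), Complex.real_smul,
      ← one_sub_tanh_sq_mul_pullDeriv g y]
    ring
  simp only [hcongr]
  rw [setIntegral_union hd measurableSet_Ioo
    ((intervalIntegrable_inv_tanh_sub_mul g hap.le fun h => by linarith [h.2]).mono_set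
      Ioo_subset_Ioc_self)
    ((intervalIntegrable_inv_tanh_sub_mul g hqb.le fun h => by linarith [h.1]).mono_set
      Ioo_subset_Ioc_self), intervalIntegral.integral_of_le hap.le,
    intervalIntegral.integral_of_le hqb.le, integral_Ioc_eq_integral_Ioo,
    integral_Ioc_eq_integral_Ioo]

theorem norm_mul_diffQuot_le (U : ℝ → ℂ) (w : ℝ) {s : ℝ} (hs : 0 < s) :
    s * ‖diffQuot U w s‖ ≤ ‖s⁻¹ • (U (w + s) - U w)‖ := by
  rw [diffQuot, norm_div, Complex.norm_real, Real.norm_of_nonneg (sq_nonneg _), norm_smul,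
    norm_inv, Real.norm_of_nonneg hs.le, div_eq_mul_one_div]
  have := inv_sinh_sq_le hs
  calc s * (‖U (w + s) - U w‖ * (1 / Real.sinh s ^ 2))
      ≤ s * (‖U (w + s) - U w‖ * (1 / s ^ 2)) := by gcongr
    _ = _ := by field_simp

theorem norm_mul_diffQuot_add_le (U : ℝ → ℂ) (w : ℝ) {s : ℝ} (hs : 0 < s) :
    s * ‖diffQuot U w s + diffQuot U w (-s)‖ ≤
      ‖s⁻¹ • (U (w + s) - U w) + s⁻¹ • (U (w - s) - U w)‖ := by
  rw [diffQuot_neg, diffQuot, ← add_div, ← smul_add, norm_div, Complex.norm_real,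
    Real.norm_of_nonneg (sq_nonneg _), norm_smul,
    norm_inv, Real.norm_of_nonneg hs.le, div_eq_mul_one_div]
  have := inv_sinh_sq_le hs
  calc s * (‖U (w + s) - U w + (U (w - s) - U w)‖ * (1 / Real.sinh s ^ 2))
      ≤ s * (‖U (w + s) - U w + (U (w - s) - U w)‖ * (1 / s ^ 2)) := by gcongr
    _ = _ := by field_simp

/-- The two-sided tails of the hypersingular integral converge, with cut-offs that are equivalent
but not necessarily equal on the two sides. -/
theorem tendsto_diffQuot_tails {U : ℝ → ℂ} (hUc : Continuous U) {C : ℝ} (hC : ∀ s, ‖U s‖ ≤ C)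
    {w : ℝ} {d h : ℂ} (hd : HasDerivAt U d w)
    (hh : Tendsto (fun k : ℕ => truncOp U ((1 / 2) ^ k) w) atTop (𝓝 h)) {σ τ : ℝ → ℝ} {l : ℝ}
    (hl : 0 < l) (hσ : Tendsto (fun ε => σ ε / ε) (𝓝[>] 0) (𝓝 l))
    (hτ : Tendsto (fun ε => τ ε / ε) (𝓝[>] 0) (𝓝 l)) (hτ0 : Tendsto τ (𝓝[>] 0) (𝓝[>] 0)) :
    Tendsto (fun ε => (∫ s in Ioi (τ ε), diffQuot U w (-s)) + ∫ s in Ioi (σ ε), diffQuot U w s)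
      (𝓝[>] 0) (𝓝 (2 * U w - 2 * Real.pi * h)) := by
  have hI1 : ∀ ε > 0, IntegrableOn (diffQuot U w) (Ioi ε) := fun ε hε =>
    integrableOn_diffQuot hUc hC w hε
  have hI2 : ∀ ε > 0, IntegrableOn (fun s => diffQuot U w (-s)) (Ioi ε) := fun ε hε =>
    integrableOn_diffQuot_neg hUc hC w hε
  have hI : ∀ ε > 0, IntegrableOn (fun s => diffQuot U w s + diffQuot U w (-s)) (Ioi ε) :=
    fun ε hε => (hI1 ε hε).add (hI2 ε hε)
  have h0 : Tendsto (fun s => s * ‖diffQuot U w s + diffQuot U w (-s)‖) (𝓝[>] 0) (𝓝 0) := by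
    have h1 := ((tendsto_slope_right hd).add (tendsto_slope_left hd)).norm
    rw [add_neg_cancel, norm_zero] at h1
    refine squeeze_zero' ?_ ?_ h1
    · filter_upwards [self_mem_nhdsWithin] with s (hs : 0 < s)
      positivity
    · filter_upwards [self_mem_nhdsWithin] with s (hs : 0 < s)
      exact norm_mul_diffQuot_add_le U w hs
  have h1 : Tendsto (fun k : ℕ => ∫ s in Ioi ((1 / 2 : ℝ) ^ k),
      (diffQuot U w s + diffQuot U w (-s))) atTop (𝓝 (2 * U w - 2 * Real.pi * h)) := by
    refine ((hh.const_mul (2 * (Real.pi : ℂ))).const_sub (2 * U w)).congr fun k => ?_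
    have hpi : (Real.pi : ℂ) ≠ 0 := by exact_mod_cast Real.pi_ne_zero
    have h2 : ∫ s in Ioi ((1 / 2 : ℝ) ^ k), (diffQuot U w s + diffQuot U w (-s)) =
        -∫ s in Ioi ((1 / 2 : ℝ) ^ k),
          (2 * U w - U (w + s) - U (w - s)) / ((Real.sinh s ^ 2 : ℝ) : ℂ) := by
      rw [← integral_neg]
      refine integral_congr_ae (ae_of_all _ fun s => ?_)
      simp only
      rw [diffQuot_neg, diffQuot]
      ring
    rw [h2, truncOp]
    field_simp
    ring
  have h2 := (tendsto_tail_of_dyadic hI h0 h1).comp hτ0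
  have h3 : ∀ᶠ s in 𝓝[>] (0 : ℝ), s * ‖diffQuot U w s‖ ≤ ‖d‖ + 1 := by
    filter_upwards [self_mem_nhdsWithin,
      (tendsto_slope_right hd).norm.eventually_le_const (lt_add_one ‖d‖)] with s (hs : 0 < s) h4
    exact (norm_mul_diffQuot_le U w hs).trans h4
  have h4 := h2.add (tendsto_tail_sub hI1 h3 hl hσ hτ)
  rw [add_zero] at h4
  refine h4.congr' ?_
  filter_upwards [tendsto_nhdsWithin_iff.1 hτ0 |>.2] with ε (hε : 0 < τ ε)
  rw [Function.comp_apply, integral_add (hI1 _ hε) (hI2 _ hε)]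
  ring

/-- The contribution of a neighbourhood of `x = tanh w` to the singular integral. -/
theorem tendsto_near_part {U : ℝ → ℂ} (hUc : Continuous U) {C : ℝ} (hC : ∀ s, ‖U s‖ ≤ C)
    {x w : ℝ} (hx : x ∈ Ioo (-1 : ℝ) 1) (hax : Real.artanh x = w) {d h : ℂ}
    (hd : HasDerivAt U d w)
    (hh : Tendsto (fun k : ℕ => truncOp U ((1 / 2) ^ k) w) atTop (𝓝 h)) :
    Tendsto (fun ε : ℝ => -(ε⁻¹ • (U (Real.artanh (x + ε)) - U w) +
      ε⁻¹ • (U (Real.artanh (x - ε)) - U w)) + 1 / ((1 - x ^ 2 : ℝ) : ℂ) *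
      ((∫ s in Ioi (w - Real.artanh (x - ε)), diffQuot U w (-s)) +
        ∫ s in Ioi (Real.artanh (x + ε) - w), diffQuot U w s)) (𝓝[>] 0)
      (𝓝 (1 / ((1 - x ^ 2 : ℝ) : ℂ) * (2 * U w - 2 * Real.pi * h))) := by
  have hc : 0 < 1 - x ^ 2 := by nlinarith [hx.1, hx.2]
  have hart := hasDerivAt_artanh hx
  have hUa : HasDerivAt (fun t => U (Real.artanh t)) ((1 / (1 - x ^ 2)) • d) x := by
    refine HasDerivAt.scomp x ?_ hart
    rwa [hax]
  have h1 := ((tendsto_slope_right hUa).add (tendsto_slope_left hUa)).neg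
  rw [add_neg_cancel, hax, neg_zero] at h1
  have h2 := tendsto_slope_right hart
  have h3 := (tendsto_slope_left hart).neg
  rw [hax] at h2 h3
  rw [neg_neg] at h3
  have h4 : Tendsto (fun ε => w - Real.artanh (x - ε)) (𝓝[>] 0) (𝓝[>] 0) := by
    refine tendsto_nhdsWithin_iff.2 ⟨?_, ?_⟩
    · have h5 : Tendsto (fun ε => x - ε) (𝓝[>] 0) (𝓝 (x - 0)) :=
        ((continuous_const.sub continuous_id).tendsto 0).mono_left nhdsWithin_le_nhds
      rw [sub_zero] at h5
      have h6 := (hart.continuousAt.tendsto.comp h5).const_sub w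
      rwa [hax, sub_self] at h6
    · filter_upwards [Ioo_mem_nhdsGT (show 0 < x + 1 by linarith [hx.1])] with ε hε
      have := Real.artanh_lt_artanh (by linarith [hε.2] : -1 < x - ε) hx.2
        (by linarith [hε.1])
      rw [hax] at this
      exact sub_pos.2 this
  have h5 := tendsto_diffQuot_tails hUc hC hd hh (one_div_pos.2 hc)
    (σ := fun ε => Real.artanh (x + ε) - w) (τ := fun ε => w - Real.artanh (x - ε))
    (h2.congr fun ε => by rw [smul_eq_mul]; ring) (h3.congr fun ε => by rw [smul_eq_mul]; ring) h4
  have h6 := h1.add (h5.const_mul (1 / ((1 - x ^ 2 : ℝ) : ℂ)))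
  rwa [zero_add] at h6

theorem tendsto_artanh_neg_one_add :
    Tendsto (fun δ : ℝ => Real.artanh (-1 + δ)) (𝓝[>] 0) atBot := by
  refine tendsto_artanh_neg_one.comp (tendsto_nhdsWithin_iff.2 ⟨?_, ?_⟩)
  · have h : Tendsto (fun δ : ℝ => -1 + δ) (𝓝[>] 0) (𝓝 (-1 + 0)) :=
      ((continuous_const.add continuous_id).tendsto 0).mono_left nhdsWithin_le_nhds
    rwa [add_zero] at h
  · filter_upwards [self_mem_nhdsWithin] with δ (hδ : 0 < δ)
    exact mem_Ioi.2 (by linarith)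

theorem tendsto_artanh_one_sub :
    Tendsto (fun δ : ℝ => Real.artanh (1 - δ)) (𝓝[>] 0) atTop := by
  refine tendsto_artanh_one.comp (tendsto_nhdsWithin_iff.2 ⟨?_, ?_⟩)
  · have h : Tendsto (fun δ : ℝ => 1 - δ) (𝓝[>] 0) (𝓝 (1 - 0)) :=
      ((continuous_const.sub continuous_id).tendsto 0).mono_left nhdsWithin_le_nhds
    rwa [sub_zero] at h
  · filter_upwards [self_mem_nhdsWithin] with δ (hδ : 0 < δ)
    exact mem_Iio.2 (by linarith)

theorem tendsto_kernel {e : ℝ → ℝ} {e₀ x : ℝ} (he : Continuous e) (h0 : e 0 = e₀)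
    (hne : e₀ - x ≠ 0) :
    Tendsto (fun δ => 1 / ((e δ - x : ℝ) : ℂ)) (𝓝[>] 0) (𝓝 (1 / ((e₀ - x : ℝ) : ℂ))) := by
  have h1 : Tendsto (fun δ => ((e δ - x : ℝ) : ℂ)) (𝓝[>] 0) (𝓝 ((e₀ - x : ℝ) : ℂ)) := by
    rw [← h0]
    exact ((Complex.continuous_ofReal.comp (he.sub continuous_const)).tendsto 0).mono_left
      nhdsWithin_le_nhds
  exact tendsto_const_nhds.div h1 (by exact_mod_cast hne)

/-- Pointwise reduction of the singular integral to the truncated operators on the line: the boundary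
terms at `±1` give `-2U(w)`, which cancels the term `2U(w)` of `truncOp`. -/
theorem isSingularIntegral_pullDeriv {U : ℝ → ℂ} {g : L2R} (hUc : Continuous U) {C : ℝ}
    (hC : ∀ s, ‖U s‖ ≤ C) (hT : Tendsto U atTop (𝓝 0)) (hB : Tendsto U atBot (𝓝 0))
    (hU : ∀ a b, ∫ y in a..b, g y = U b - U a) {w : ℝ} {d h : ℂ} (hd : HasDerivAt U d w)
    (hh : Tendsto (fun k : ℕ => truncOp U ((1 / 2) ^ k) w) atTop (𝓝 h)) :
    IsSingularIntegral (pullDeriv g) (Real.tanh w)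
      (-(2 * Real.pi * h) / ((1 - Real.tanh w ^ 2 : ℝ) : ℂ)) := by
  have hx := tanh_mem_Ioo w
  have hc := one_sub_tanh_sq_pos w
  set x := Real.tanh w with hxw
  have hax : Real.artanh x = w := Real.artanh_tanh w
  have hI1 : ∀ ε > 0, IntegrableOn (diffQuot U w) (Ioi ε) := fun ε hε =>
    integrableOn_diffQuot hUc hC w hε
  have hI2 : ∀ ε > 0, IntegrableOn (fun s => diffQuot U w (-s)) (Ioi ε) := fun ε hε =>
    integrableOn_diffQuot_neg hUc hC w hε
  have hA := tendsto_near_part hUc hC hx hax hd hh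
  -- the contributions of the ends of the interval
  have hBa : Tendsto (fun δ : ℝ => -(1 / ((-1 + δ - x : ℝ) : ℂ) * (U (Real.artanh (-1 + δ)) - U w))
      - 1 / ((1 - x ^ 2 : ℝ) : ℂ) * ∫ s in Ioi (w - Real.artanh (-1 + δ)), diffQuot U w (-s))
      (𝓝[>] 0) (𝓝 (-(1 / ((-1 - x : ℝ) : ℂ) * (0 - U w)) - 1 / ((1 - x ^ 2 : ℝ) : ℂ) * 0)) := by
    refine (((tendsto_kernel (e := fun δ => -1 + δ) (by fun_prop) (by simp)
      (by linarith [hx.1])).mul ((hB.comp tendsto_artanh_neg_one_add).sub_const (U w))).neg).sub (Tendsto.const_mul _ ?_)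
    exact (tendsto_tail_atTop hI2).comp (tendsto_atTop_add_const_left _ w
      (tendsto_neg_atBot_atTop.comp tendsto_artanh_neg_one_add))
  have hBb : Tendsto (fun δ : ℝ => 1 / ((1 - δ - x : ℝ) : ℂ) * (U (Real.artanh (1 - δ)) - U w)
      - 1 / ((1 - x ^ 2 : ℝ) : ℂ) * ∫ s in Ioi (Real.artanh (1 - δ) - w), diffQuot U w s)
      (𝓝[>] 0) (𝓝 (1 / ((1 - x : ℝ) : ℂ) * (0 - U w) - 1 / ((1 - x ^ 2 : ℝ) : ℂ) * 0)) := by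
    refine ((tendsto_kernel (e := fun δ => 1 - δ) (by fun_prop) (by simp)
      (by linarith [hx.2])).mul ((hT.comp tendsto_artanh_one_sub).sub_const (U w))).sub (Tendsto.const_mul _ ?_)
    exact (tendsto_tail_atTop hI1).comp (tendsto_atTop_add_const_right _ (-w) tendsto_artanh_one_sub)
  have hlim : 1 / ((1 - x ^ 2 : ℝ) : ℂ) * (2 * U w - 2 * Real.pi * h) +
      ((-(1 / ((-1 - x : ℝ) : ℂ) * (0 - U w)) - 1 / ((1 - x ^ 2 : ℝ) : ℂ) * 0) +
      (1 / ((1 - x : ℝ) : ℂ) * (0 - U w) - 1 / ((1 - x ^ 2 : ℝ) : ℂ) * 0)) =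
      -(2 * Real.pi * h) / ((1 - x ^ 2 : ℝ) : ℂ) := by
    have e1 : (1 + x : ℂ) ≠ 0 := by
      exact_mod_cast (show (1 + x : ℝ) ≠ 0 by linarith [hx.1])
    have e2 : (1 - x : ℂ) ≠ 0 := by
      exact_mod_cast (show (1 - x : ℝ) ≠ 0 by linarith [hx.2])
    have e3 : ((1 - x ^ 2 : ℝ) : ℂ) = (1 + x) * (1 - x) := by push_cast; ring
    have e4 : ((-1 - x : ℝ) : ℂ) = -(1 + x) := by push_cast; ring
    rw [e3, e4]
    push_cast
    field_simp
    ring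
  rw [IsSingularIntegral, ← hlim]
  have htot := (hA.comp tendsto_fst).add (((hBa.comp tendsto_fst).add
    (hBb.comp tendsto_snd)).comp (tendsto_snd (f := 𝓝[>] (0 : ℝ)) (g := 𝓝[>] (0 : ℝ) ×ˢ 𝓝[>] (0 : ℝ))))
  refine htot.congr' ?_
  have hr : 0 < min (x + 1) (1 - x) / 2 := by
    have : 0 < min (x + 1) (1 - x) := lt_min (by linarith [hx.1]) (by linarith [hx.2])
    positivity
  have hsmall := Ioo_mem_nhdsGT hr
  filter_upwards [prod_mem_prod hsmall (prod_mem_prod hsmall hsmall)]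
  rintro ⟨ε, δ₁, δ₂⟩ ⟨hε, hδ₁, hδ₂⟩
  simp only [mem_Ioo] at hε hδ₁ hδ₂
  have hm1 : min (x + 1) (1 - x) ≤ x + 1 := min_le_left _ _
  have hm2 : min (x + 1) (1 - x) ≤ 1 - x := min_le_right _ _
  have ta : Real.tanh (Real.artanh (-1 + δ₁)) = -1 + δ₁ :=
    Real.tanh_artanh ⟨by linarith, by linarith⟩
  have tb : Real.tanh (Real.artanh (1 - δ₂)) = 1 - δ₂ :=
    Real.tanh_artanh ⟨by linarith, by linarith⟩
  have tp : Real.tanh (Real.artanh (x - ε)) = x - ε :=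
    Real.tanh_artanh ⟨by linarith, by linarith⟩
  have tq : Real.tanh (Real.artanh (x + ε)) = x + ε :=
    Real.tanh_artanh ⟨by linarith, by linarith⟩
  have hap : Real.artanh (-1 + δ₁) < Real.artanh (x - ε) :=
    Real.artanh_lt_artanh (by linarith) (by linarith) (by linarith)
  have hpw : Real.artanh (x - ε) < w := by
    rw [← hax]; exact Real.artanh_lt_artanh (by linarith) (by linarith) (by linarith)
  have hwq : w < Real.artanh (x + ε) := by
    rw [← hax]; exact Real.artanh_lt_artanh (by linarith) (by linarith) (by linarith)
  have hqb : Real.artanh (x + ε) < Real.artanh (1 - δ₂) :=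
    Real.artanh_lt_artanh (by linarith) (by linarith) (by linarith)
  have hset := setIntegral_pullDeriv_div g hap hpw hwq hqb tp tq
  rw [integral_inv_tanh_sub_mul hU hap.le fun h => by linarith [h.2],
    integral_inv_tanh_sub_mul hU hqb.le fun h => by linarith [h.1], ta, tb, tp, tq] at hset
  simp only [Function.comp_apply]
  rw [hset]
  have i1 : ∫ s in (Real.artanh (-1 + δ₁) - w)..(Real.artanh (x - ε) - w), diffQuot U w s =
      (∫ s in Ioi (w - Real.artanh (x - ε)), diffQuot U w (-s)) -
        ∫ s in Ioi (w - Real.artanh (-1 + δ₁)), diffQuot U w (-s) := by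
    rw [intervalIntegral.integral_Ioi_sub_Ioi' (hI2 _ (by linarith)) (hI2 _ (by linarith)),
      intervalIntegral.integral_comp_neg, neg_sub, neg_sub]
  have i2 : ∫ s in (Real.artanh (x + ε) - w)..(Real.artanh (1 - δ₂) - w), diffQuot U w s =
      (∫ s in Ioi (Real.artanh (x + ε) - w), diffQuot U w s) -
        ∫ s in Ioi (Real.artanh (1 - δ₂) - w), diffQuot U w s := by
    rw [intervalIntegral.integral_Ioi_sub_Ioi' (hI1 _ (by linarith)) (hI1 _ (by linarith))]
  rw [i1, i2, Complex.real_smul, Complex.real_smul]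
  have e1 : ((x - ε - x : ℝ) : ℂ) = -(ε : ℂ) := by push_cast; ring
  have e2 : ((x + ε - x : ℝ) : ℂ) = (ε : ℂ) := by push_cast; ring
  rw [e1, e2, ← hxw]
  push_cast
  ring

/-! ### Strong solutions -/

theorem MemHTilde.memLp_wt_mul {u : LTilde2} (hu : MemHTilde 1 u) :
    MemLp (fun η => (wt η : ℂ) * hat u η) 2 volume := by
  refine (memLp_congr_ae (ae_of_all _ fun η => ?_)).1 ((memHTilde_iff_memLp_whtd 1 u).1 hu)
  rw [whtd, Real.rpow_one]

/-- The image of `u ∈ H̃¹` under the operator with the symbol `ξ coth(πξ)`, on the line. -/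
def symbOp {u : LTilde2} (hu : MemHTilde 1 u) : L2R := 𝓕⁻ (memLp_symb_mul hu.memLp_wt_mul).toLp

/-- A function `u ∈ H̃¹` is continuous on `[-1,1]` and vanishes at `±1`, and the singular integral of
its derivative `w` is, up to a factor, the image of `u` under the operator with the symbol
`ξ coth(πξ)`. -/
theorem exists_singularIntegral {u : LTilde2} (hu : MemHTilde 1 u) :
    ∃ u₀ w : ℝ → ℂ, u₀ =ᵐ[volume.restrict (Ioo (-1) 1)] u ∧ ContinuousOn u₀ (Icc (-1) 1) ∧
      u₀ (-1) = 0 ∧ u₀ 1 = 0 ∧ IsWeakDeriv u₀ w ∧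
      ∀ᵐ x ∂volume.restrict (Ioo (-1 : ℝ) 1),
        IsSingularIntegral w x (-(2 * Real.pi * pullDeriv (symbOp hu) x)) := by
  have hwt := hu.memLp_wt_mul
  have hi := integrable_of_memLp_wt_mul hwt
  obtain ⟨g, hg⟩ := exists_deriv_invFourier hwt
  have hUc := continuous_invFourier hi
  have hT := tendsto_invFourier_atTop (hat u)
  have hB := tendsto_invFourier_atBot (hat u)
  have hC : ∀ w, ‖invFourier (hat u) w‖ ≤ ∫ η, ‖hat u η‖ := fun w =>
    (norm_integral_le_integral_norm _).trans (le_of_eq (integral_congr_ae (ae_of_all _ fun η => by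
      simp only [norm_mul, norm_ker, mul_one])))
  refine ⟨pull (invFourier (hat u)), pullDeriv g, pull_ae_eq ?_, continuousOn_pull hUc hT hB,
    indicator_of_notMem (by simp) _, indicator_of_notMem (by simp) _,
    isWeakDeriv_pull hUc hT hB hg, ae_of_ae_tanh (p := fun x =>
      IsSingularIntegral (pullDeriv g) x (-(2 * Real.pi * pullDeriv (symbOp hu) x))) ?_⟩
  · rw [← fourierInv_hat]
    exact fourierInv_ae_eq (hat u) hi
  · filter_upwards [ae_tendsto_truncOp hwt,
      _root_.LocallyIntegrable.ae_hasDerivAt_integral (locallyIntegrable_L2R g)] with w h1 h2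
    have h3 : HasDerivAt (invFourier (hat u)) (g w) w := by
      refine ((h2 0).add_const (invFourier (hat u) 0)).congr_of_eventuallyEq
        (Eventually.of_forall fun y => ?_)
      simp only [hg]
      ring
    have h4 := isSingularIntegral_pullDeriv hUc hC hT hB hg h3 h1
    rwa [neg_div, mul_div_assoc, ← pull_tanh (𝓕⁻ (memLp_symb_mul hwt).toLp : L2R) w] at h4

/-- The generalized derivative is unique, and depends only on the class of the function. -/
theorem IsWeakDeriv.ae_eq {u v w z : ℝ → ℂ} (h : u =ᵐ[volume.restrict (Ioo (-1) 1)] v)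
    (hu : IsWeakDeriv u w) (hv : IsWeakDeriv v z) :
    w =ᵐ[volume.restrict (Ioo (-1) 1)] z := by
  have h1 := isOpen_Ioo.ae_eq_zero_of_integral_contDiff_smul_eq_zero (f := w - z) (μ := volume)
    (U := Ioo (-1 : ℝ) 1) (hu.2.1.sub hv.2.1) ?_
  · rw [EventuallyEq, ae_restrict_iff' measurableSet_Ioo]
    filter_upwards [h1] with x hx hx'
    exact sub_eq_zero.1 (hx hx')
  · intro φ hφ hφc hφs
    have hint : ∀ {w : ℝ → ℂ}, LocallyIntegrableOn w (Ioo (-1) 1) →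
        IntegrableOn (fun x => φ x • w x) (Ioo (-1) 1) := by
      intro w hw
      have h2 : IntegrableOn w (tsupport φ) := hw.integrableOn_compact_subset hφs hφc
      have h3 := h2.continuousOn_smul hφ.continuous.continuousOn hφc
      exact ((integrableOn_iff_integrable_of_support_subset
        ((Function.support_smul_subset_left φ w).trans (subset_tsupport φ))).1 h3).integrableOn
    have h2 : ∫ x in Ioo (-1 : ℝ) 1, φ x • w x = ∫ x in Ioo (-1 : ℝ) 1, φ x • z x := by
      rw [← neg_inj, ← hu.2.2 φ hφ hφc hφs, ← hv.2.2 φ hφ hφc hφs]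
      refine integral_congr_ae ?_
      filter_upwards [h] with x hx
      rw [hx]
    rw [← setIntegral_eq_integral_of_forall_compl_eq_zero (s := Ioo (-1 : ℝ) 1)]
    · simp only [Pi.sub_apply, smul_sub]
      rw [integral_sub (hint hu.2.1) (hint hv.2.1), h2, sub_self]
    · intro x hx
      rw [image_eq_zero_of_notMem_tsupport fun h => hx (hφs h), zero_smul]

theorem IsSingularIntegral.unique {w z : ℝ → ℂ} (h : w =ᵐ[volume.restrict (Ioo (-1) 1)] z) {x : ℝ}
    {I J : ℂ} (hw : IsSingularIntegral w x I) (hz : IsSingularIntegral z x J) : I = J := by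
  refine tendsto_nhds_unique hw (hz.congr' ?_)
  filter_upwards [prod_mem_prod univ_mem (prod_mem_prod (self_mem_nhdsWithin (a := (0 : ℝ)))
    (self_mem_nhdsWithin (a := (0 : ℝ))))]
  rintro ⟨ε, δ₁, δ₂⟩ ⟨-, h1, h2⟩
  have h1' : 0 < δ₁ := h1
  have h2' : 0 < δ₂ := h2
  have hsub : {t | t ∈ Ioo (-1 + δ₁) (1 - δ₂) ∧ ε < |t - x|} ⊆ Ioo (-1 : ℝ) 1 := fun t ht =>
    ⟨by linarith [ht.1.1], by linarith [ht.1.2]⟩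
  refine integral_congr_ae ?_
  filter_upwards [ae_restrict_of_ae_restrict_of_subset hsub h] with t ht
  rw [ht]

namespace IsPotential

variable {V : ℝ → ℝ} {M : ℝ}

theorem fourierInv_op_hat (h : IsPotential V M) (u : LTilde2) :
    (𝓕⁻ (h.op (hat u)) : L2R) = mulOp _ h.memLp_lineV (toLine u) := by
  rw [op_apply, FourierTransform.fourierInv_fourier_eq, fourierInv_hat]

/-- For `u ∈ H̃¹` the form is the pairing on the line with `lineV u + symbOp u`, which is the left-hand
side of the Prandtl equation multiplied by `1 - x²`. -/
theorem form_eq_inner_line (h : IsPotential V M) {u : LTilde2} (hu : MemHTilde 1 u) (g : LTilde2) :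
    form V u g = inner ℂ (toLine g) (mulOp _ h.memLp_lineV (toLine u) + symbOp hu) := by
  rw [h.form_eq, inner_add_right, ← h.fourierInv_op_hat, ← fourierInv_hat g, symbOp,
    ← inner_fourier_right, FourierTransform.fourier_fourierInv_eq, ← inner_fourier_right,
    FourierTransform.fourier_fourierInv_eq, inner_L2R _ (MemLp.toLp _ _)]
  congr 1
  refine integral_congr_ae ?_
  filter_upwards [(memLp_symb_mul hu.memLp_wt_mul).coeFn_toLp] with η h1
  rw [h1]

/-- Strong solutions satisfy the identity `[u, g] = (f, g)`. -/
theorem form_eq_of_isStrongSolution (h : IsPotential V M) {f : HTildeDual 0} {u : LTilde2}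
    (hu : IsStrongSolution V f u) (g : HTilde 0) : form V u g.val = f g := by
  obtain ⟨hu1, u₀, w, f₀, hu₀, -, -, -, hw, hf, heq⟩ := hu
  obtain ⟨v₀, z, hv₀, -, -, -, hz, hsing⟩ := exists_singularIntegral hu1
  have hwz := hw.ae_eq (hu₀.trans hv₀.symm) hz
  have key : ∀ᵐ x ∂volume.restrict (Ioo (-1 : ℝ) 1),
      (V x : ℂ) * u x + pullDeriv (symbOp hu1) x = f₀ x := by
    filter_upwards [heq, hsing, hu₀] with x h1 h2 h3
    obtain ⟨I, hI, h4⟩ := h1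
    rw [hI.unique hwz h2, h3] at h4
    rw [← h4]
    have : (Real.pi : ℂ) ≠ 0 := by exact_mod_cast Real.pi_ne_zero
    field_simp
    ring
  rw [h.form_eq_inner_line hu1, hf.2.2 g, inner_L2R, integral_Ioo_eq_integral_line]
  refine integral_congr_ae ?_
  filter_upwards [quasiMeasurePreserving_tanh.ae key, toLine_ae_eq u, toLine_ae_eq g.val,
    coeFn_mulOp h.memLp_lineV (toLine u),
    Lp.coeFn_add (mulOp _ h.memLp_lineV (toLine u)) (symbOp hu1)] with w h1 h2 h3 h4 h5
  rw [h5, Pi.add_apply, h4, h2, h3, ← h1, ← one_sub_tanh_sq_mul_pullDeriv (symbOp hu1) w, lineV]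
  push_cast
  ring

theorem isRepresentedBy_pullDeriv {f : HTildeDual 0} {ψ : L2R}
    (hf : ∀ g : HTilde 0, f g = inner ℂ (toLine g.val) ψ) : IsRepresentedBy f (pullDeriv ψ) := by
  refine ⟨(locallyIntegrableOn_pullDeriv ψ).aestronglyMeasurable, ?_, fun g => ?_⟩
  · have himg : Real.tanh '' univ = Ioo (-1) 1 := Real.tanh_bijOn.image_eq
    rw [← himg, integrableOn_image_iff_integrableOn_abs_deriv_smul MeasurableSet.univ
      (fun w _ => (hasDerivAt_tanh w).hasDerivWithinAt) Real.tanh_injective.injOn,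
      integrableOn_univ]
    refine (integrable_norm_sq_L2R ψ).congr (ae_of_all _ fun w => ?_)
    have h1 := one_sub_tanh_sq_pos w
    simp only
    rw [abs_of_pos h1, smul_eq_mul, ← one_sub_tanh_sq_mul_pullDeriv ψ w, norm_mul,
      Complex.norm_real, Real.norm_of_nonneg h1.le]
    ring
  · rw [hf, inner_L2R, integral_Ioo_eq_integral_line]
    refine integral_congr_ae ?_
    filter_upwards [toLine_ae_eq g.val] with w h1
    rw [h1, ← mul_assoc, one_sub_tanh_sq_mul_pullDeriv]

/-- The converse: a function in `H̃¹` that satisfies the identity `[u, g] = (f, g)` is a strong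
solution. -/
theorem isStrongSolution_of_form_eq (h : IsPotential V M) {f : HTildeDual 0} {u : LTilde2}
    (hu1 : MemHTilde 1 u) (hu : ∀ g : HTilde 0, form V u g.val = f g) :
    IsStrongSolution V f u := by
  have hf : ∀ g : HTilde 0, f g =
      inner ℂ (toLine g.val) (mulOp _ h.memLp_lineV (toLine u) + symbOp hu1) := fun g => by
    rw [← hu g, h.form_eq_inner_line hu1]
  obtain ⟨u₀, w, hu₀, hc, hm, hp, hw, hsing⟩ := exists_singularIntegral hu1
  refine ⟨hu1, u₀, w, _, hu₀, hc, hm, hp, hw, isRepresentedBy_pullDeriv hf, ?_⟩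
  have key : ∀ᵐ x ∂volume.restrict (Ioo (-1 : ℝ) 1), (V x : ℂ) * u x + pullDeriv (symbOp hu1) x =
      pullDeriv (mulOp _ h.memLp_lineV (toLine u) + symbOp hu1 : L2R) x := by
    refine ae_of_ae_tanh (p := fun x => (V x : ℂ) * u x + pullDeriv (symbOp hu1) x =
      pullDeriv (mulOp _ h.memLp_lineV (toLine u) + symbOp hu1 : L2R) x) ?_
    filter_upwards [toLine_ae_eq u, coeFn_mulOp h.memLp_lineV (toLine u),
      Lp.coeFn_add (mulOp _ h.memLp_lineV (toLine u)) (symbOp hu1)] with w h2 h4 h5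
    have hne : ((1 - Real.tanh w ^ 2 : ℝ) : ℂ) ≠ 0 := by
      exact_mod_cast (one_sub_tanh_sq_pos w).ne'
    refine mul_left_cancel₀ hne ?_
    rw [one_sub_tanh_sq_mul_pullDeriv, mul_add, one_sub_tanh_sq_mul_pullDeriv, h5, Pi.add_apply, h4,
      h2, lineV]
    push_cast
    ring
  filter_upwards [key, hsing, hu₀] with x h1 h2 h3
  refine ⟨_, h2, ?_⟩
  rw [← h1, h3]
  have : (Real.pi : ℂ) ≠ 0 := by exact_mod_cast Real.pi_ne_zero
  field_simp
  ring

end IsPotential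

end Prandtl

end

theorem theorem3p9 (V : ℝ → ℝ) (M : ℝ)
    (hVm : AEMeasurable V (volume.restrict (Ioo (-1) 1)))
    (hV0 : ∀ᵐ x ∂volume.restrict (Ioo (-1) 1), 0 ≤ V x)
    (hVM : ∀ᵐ x ∂volume.restrict (Ioo (-1) 1), (1 - x ^ 2) * V x ≤ M)
    (s : ℝ) (hs0 : 0 ≤ s) (hs1 : s ≤ 1) (f : Prandtl.HTildeDual (1 - s)) :
    ∃ u : Prandtl.HTilde s,
      Prandtl.IsSolution V hs0 f u.val ∧
      (∀ v : Prandtl.LTilde2, Prandtl.IsSolution V hs0 f v → v = u.val) ∧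
      ‖u‖ ≤ √(Real.pi ^ 2 * (2 + Real.pi / 2 * M)) * ‖f‖ := by
  have hV : Prandtl.IsPotential V M := ⟨hVm, hV0, hVM⟩
  obtain ⟨u, φ, hu, hf, hnorm⟩ := hV.exists_hTilde_solution hs0 hs1 f
  have hform : ∀ g : Prandtl.HTilde (1 - s), Prandtl.form V u.val g.val = f g := fun g =>
    (hV.form_eq_of_ae_eq hu g).trans (hf g).symm
  -- all solutions satisfy the identity `[v, g] = (f, g)` for `g ∈ H̃¹`
  have huniq : ∀ v : Prandtl.LTilde2,
      (∀ g : Prandtl.HTilde 1, Prandtl.form V v g.val =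
        f (Prandtl.HTilde.incl (by linarith) g)) → v = u.val := fun v hv =>
    hV.eq_of_form_eq fun g => (hv g).trans (hform (Prandtl.HTilde.incl (by linarith) g)).symm
  refine ⟨u, ?_, fun v hv => huniq v ?_, hnorm⟩
  · by_cases h : s < 1 / 2
    · rw [Prandtl.IsSolution, dif_pos h]
      exact fun g => hform (Prandtl.HTilde.incl _ g)
    by_cases h' : s < 1
    · rw [Prandtl.IsSolution, dif_neg h, dif_pos h']
      exact ⟨Prandtl.MemHTilde.mono (not_lt.1 h) u.val_mem,
        fun g => hform (Prandtl.HTilde.incl _ g)⟩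
    · rw [Prandtl.IsSolution, dif_neg h, dif_neg h']
      exact hV.isStrongSolution_of_form_eq (Prandtl.MemHTilde.mono (not_lt.1 h') u.val_mem)
        fun g => hform (Prandtl.HTilde.incl _ g)
  · by_cases h : s < 1 / 2
    · rw [Prandtl.IsSolution, dif_pos h] at hv
      exact hv
    by_cases h' : s < 1
    · rw [Prandtl.IsSolution, dif_neg h, dif_pos h'] at hv
      exact fun g => hv.2 (Prandtl.HTilde.incl (by norm_num) g)
    · rw [Prandtl.IsSolution, dif_neg h, dif_neg h'] at hv
      exact fun g => hV.form_eq_of_isStrongSolution hv (Prandtl.HTilde.incl (by norm_num) g)
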